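/- **Definitions.** A promise problem is a pair $L=(L_{\rm yes},L_{\rm no})$ of disjoint sets of bit strings. *Fermionic states.* The $2p$ Majorana operators $c_1,\dots,c_{2p}$ of $p$ fermionic modes are Hermitian operators on Fock space $(\mathbb C^2)^{\otimes p}$ with $c_ic_j+c_jc_i=2\delta_{ij}\mathbb I$, the pair $c_{2k-1},c_{2k}$ belonging to mode $k$; concretely, in the occupation number basis, $c_{2k-1}=Z_1\cdots Z_{k-1}X_k$ and $c_{2k}=Z_1\cdots Z_{k-1}Y_k$. A state of $p$ fermionic modes is a density matrix $\rho$ ($\rho\ge 0$, $\operatorname{Tr}\rho=1$) that is an even polynomial in the Majorana operators. *Verifiers.* A quantum polynomial-time qubit (resp. fermionic) verifier is given by polynomials $p,a,m$ and a deterministic classical algorithm which, from an input $x\in\{0,1\}^n$ and a string $r$ of $m(n)$ uniformly random bits, writes down in time polynomial in $n$ a quantum circuit $V_{x,r}$ on a proof consisting of $p(n)$ qubits (resp. $p(n)$ fermionic modes) and on $a(n)+1$ ancilla qubits that start in $|0\cdots 0\rangle$. Elementary gates of a qubit verifier are $\exp(i\frac{\pi}{8}P)$ with $P$ a product of Pauli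 operators on at most two distinct qubits (up to global phases these generate exactly the Clifford$+T$ circuits). Elementary gates of a fermionic verifier are $\exp(i\frac{\pi}{8}Q)$ with $Q=\Gamma\otimes P$, where $\Gamma$ is $\mathbb I$, $i\,c_jc_k$ or $c_jc_kc_lc_m$ with distinct Majorana operators and $P$ is a product of Pauli operators on at most two distinct ancilla qubits. The verifier accepts if the measurement of the first ancilla qubit in the $Z$-basis after the circuit has the outcome $Z=+1$. She accesses at most $q(n)$ qubits (resp. modes) if for every $x\in\{0,1\}^n$ and every $r$ the gates of $V_{x,r}$ act on at most $q(n)$ qubits (resp. modes) of the proof. *Classes.* $L\in{\rm QPCP}[q]$ (resp. $L\in{\rm FermPCP}[q]$) if there is a qubit (resp. fermionic) verifier that accesses at most $q(n)$ qubits (resp. modes) of the proof and satisfies, with the probability taken over $r$ and the measurement: - if $x\in L_{\rm yes}$, there is a density matrix $\rho$ on $p(n)$ qubits (resp. a state $\rho$ of $p(n)$ fermionic modes) that is accepted with probability at least $2/3$; - if $x\in L_{\rm no}$, every density matrix on $p(n)$ qubits (resp. every state of $p(n)$ fermionic modes) is accepted with probability at most $1/3$. ${\rm QPCP}[O(f)]$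 is the union of the classes ${\rm QPCP}[q]$ over all $q:\mathbb N\to\mathbb N$ with $q(n)=O(f(n))$ as $n\to\infty$, and likewise for ${\rm FermPCP}[O(f)]$. **Lemma.** ${\rm FermPCP}[O(1)]\subseteq{\rm QPCP}[O(\log n)]$. -/

import Mathlib

namespace FermPCP

open scoped Matrix ComplexOrder

/-! ### Classical polynomial time: structured stack programs with a step count -/

/-- The memory: registers `0, 1, 2, …`, each a stack of natural numbers (top = head). -/
abbrev Store := ℕ → List ℕ

/-- Elementary instructions. On an empty stack `pop`, `succ`, `pred` and `copy` do nothing. -/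
inductive Instr
  /-- push `0` on stack `k` -/
  | push (k : ℕ)
  /-- remove the top of stack `k` -/
  | pop (k : ℕ)
  /-- add one to the top of stack `k` -/
  | succ (k : ℕ)
  /-- subtract one from the top of stack `k` (`0` stays `0`) -/
  | pred (k : ℕ)
  /-- push the top of stack `j` on stack `k` -/
  | copy (j k : ℕ)

/-- The effect of an elementary instruction. -/
def Instr.apply : Instr → Store → Store
  | .push k, s => Function.update s k (0 :: s k)
  | .pop k, s => Function.update s k (s k).tail
  | .succ k, s => Function.update s k ((s k).modifyHead (· + 1))
  | .pred k, s => Function.update s k ((s k).modifyHead (· - 1))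
  | .copy j k, s => Function.update s k ((s j).head?.toList ++ s k)

/-- The tests of the language. -/
inductive Test
  /-- stack `k` is not empty -/
  | nonempty (k : ℕ)
  /-- stack `k` is not empty and its top is not `0` -/
  | pos (k : ℕ)

/-- When a test succeeds. -/
def Test.Holds : Test → Store → Prop
  | .nonempty k, s => s k ≠ []
  | .pos k, s => ∃ a l, s k = (a + 1) :: l

/-- Programs. A program mentions only finitely many stacks. An instruction makes at most one stack
longer, by one entry, and `succ` is the only way to make a new number, so after `t` steps on a
binary input of length `n` all stacks together have at most `n + t` entries, each at most `t + 1`;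
hence a Turing machine simulates `t` steps in time polynomial in `n + t`, and conversely two stacks
simulate a Turing machine tape. -/
inductive Prog
  | instr (i : Instr)
  | seq (P Q : Prog)
  | ite (c : Test) (P Q : Prog)
  | loop (c : Test) (P : Prog)

/-- `Exec P s t s'`: started in `s`, the program `P` halts in `s'` after exactly `t` steps. Each
instruction and each evaluation of a test is one step. -/
inductive Exec : Prog → Store → ℕ → Store → Prop
  | instr (i : Instr) (s : Store) : Exec (.instr i) s 1 (i.apply s)
  | seq {P Q : Prog} {s s' s'' : Store} {t u : ℕ} :
      Exec P s t s' → Exec Q s' u s'' → Exec (.seq P Q) s (t + u) s''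
  | ite_true {c : Test} {P Q : Prog} {s s' : Store} {t : ℕ} :
      c.Holds s → Exec P s t s' → Exec (.ite c P Q) s (t + 1) s'
  | ite_false {c : Test} {P Q : Prog} {s s' : Store} {t : ℕ} :
      ¬ c.Holds s → Exec Q s t s' → Exec (.ite c P Q) s (t + 1) s'
  | loop_done {c : Test} {P : Prog} {s : Store} :
      ¬ c.Holds s → Exec (.loop c P) s 1 s
  | loop_step {c : Test} {P : Prog} {s s' s'' : Store} {t u : ℕ} :
      c.Holds s → Exec P s t s' → Exec (.loop c P) s' u s'' →
        Exec (.loop c P) s (t + u + 1) s''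

/-- The initial memory: the bits of `x` on stack `0`, those of `r` on stack `1`. -/
def initStore (x r : List Bool) : Store
  | 0 => x.map Bool.toNat
  | 1 => r.map Bool.toNat
  | _ => []

/-! ### Operators on registers of qubits -/

/-- Operators on the Hilbert space `⨂_{s ∈ ι} ℂ²`, as matrices in the computational basis. -/
abbrev Op (ι : Type) := Matrix (ι → Bool) (ι → Bool) ℂ

/-- The three Pauli axes. -/
inductive Axis
  | X
  | Y
  | Z

/-- The number that stands for an axis in circuit descriptions. -/
def Axis.code : Axis → ℕ
  | .X => 0
  | .Y => 1
  | .Z => 2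

section Operators

variable {ι : Type} [Fintype ι] [DecidableEq ι]

/-- The bit flip at `s`. -/
def pauliX (s : ι) : Op ι :=
  Matrix.of fun u v => if u = Function.update v s (!v s) then 1 else 0

/-- The phase flip at `s`. -/
def pauliZ (s : ι) : Op ι :=
  Matrix.diagonal fun u => if u s then -1 else 1

/-- The Pauli operator with axis `A` at `s`; `Y = i X Z`. -/
def pauli (s : ι) : Axis → Op ι
  | .X => pauliX s
  | .Y => Complex.I • (pauliX s * pauliZ s)
  | .Z => pauliZ s

/-- The Majorana operators of `p` fermionic modes in the occupation number basis of Fock space, mode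
`k` being stored in site `e k`. Mode `j` has the two operators `(j, false)` and `(j, true)`:
`c_{(j, false)} = (∏_{k < j} Z_k) X_j` and `c_{(j, true)} = (∏_{k < j} Z_k) Y_j`. -/
def majorana {p : ℕ} (e : Fin p → ι) (c : Fin p × Bool) : Op ι :=
  Matrix.diagonal (fun u => ∏ k ∈ Finset.Iio c.1, if u (e k) then (-1 : ℂ) else 1) *
    pauli (e c.1) (if c.2 then .Y else .X)

/-- `exp (i π/8 P)`, for an operator `P` with `P² = 1`. -/
noncomputable def rotation (P : Op ι) : Op ι :=
  ((Real.cos (Real.pi / 8) : ℝ) : ℂ) • (1 : Op ι) +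
    (Complex.I * ((Real.sin (Real.pi / 8) : ℝ) : ℂ)) • P

/-- Density matrices. -/
def IsDensity (ρ : Op ι) : Prop := ρ.PosSemidef ∧ ρ.trace = 1

end Operators

/-- States of `p` fermionic modes: density matrices on Fock space that are even polynomials in the
Majorana operators. -/
def IsFermionicState {p : ℕ} (ρ : Op (Fin p)) : Prop :=
  IsDensity ρ ∧
    ρ ∈ Submodule.span ℂ
      {M : Op (Fin p) | ∃ l : List (Fin p × Bool),
        Even l.length ∧ M = (l.map (majorana (fun k => k))).prod}

/-! ### Gates and circuits -/

/-- Products of Pauli operators on at most two distinct sites of `σ`. -/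
structure PauliWord (σ : Type) where
  letters : List (σ × Axis)
  nodup : (letters.map Prod.fst).Nodup
  length_le : letters.length ≤ 2

/-- A verifier works on the proof (`p` qubits or modes, sites `inl k`) and on `a + 1` ancilla
qubits (sites `inr k`). -/
abbrev Site (p a : ℕ) := Fin p ⊕ Fin (a + 1)

/-- Elementary qubit gates `exp (i π/8 P)` with `P` a Pauli word on at most two qubits. Up to
global phases they generate exactly the circuits over Clifford + T. -/
structure QubitGate (p a : ℕ) where
  word : PauliWord (Site p a)

/-- Elementary gates of a fermionic verifier: `exp (i π/8 Q)`, where `Q` is the product of zero,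
two or four distinct Majorana operators and a Pauli word on the ancilla qubits. -/
structure FermionGate (p a : ℕ) where
  maj : List (Fin p × Bool)
  nodup : maj.Nodup
  even : Even maj.length
  length_le : maj.length ≤ 4
  word : PauliWord (Fin (a + 1))

/-- The description of a site. -/
def siteCode {p a : ℕ} : Site p a → List ℕ
  | .inl k => [0, k]
  | .inr k => [1, k]

/-- The description of a qubit gate. -/
def QubitGate.code {p a : ℕ} (g : QubitGate p a) : List ℕ :=
  g.word.letters.length :: g.word.letters.flatMap fun l => siteCode l.1 ++ [l.2.code]

/-- The description of a fermionic gate. -/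
def FermionGate.code {p a : ℕ} (g : FermionGate p a) : List ℕ :=
  g.maj.length :: (g.maj.flatMap fun c => [(c.1 : ℕ), c.2.toNat]) ++
    g.word.letters.length :: g.word.letters.flatMap fun l => [(l.1 : ℕ), l.2.code]

/-- The unitary of a qubit gate. -/
noncomputable def QubitGate.op {p a : ℕ} (g : QubitGate p a) : Op (Site p a) :=
  rotation (g.word.letters.map fun l => pauli l.1 l.2).prod

/-- The unitary of a fermionic gate. The product of two distinct Majorana operators is
anti-Hermitian and is multiplied by `i`; those of zero or four are Hermitian. -/
noncomputable def FermionGate.op {p a : ℕ} (g : FermionGate p a) : Op (Site p a) :=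
  rotation ((if g.maj.length = 2 then Complex.I else 1) •
    ((g.maj.map (majorana Sum.inl)).prod *
      (g.word.letters.map fun l => pauli (Sum.inr l.1) l.2).prod))

/-- The proof qubits on which a qubit gate acts. -/
def QubitGate.access {p a : ℕ} (g : QubitGate p a) : Finset (Fin p) :=
  (g.word.letters.filterMap fun l => l.1.getLeft?).toFinset

/-- The modes of the proof on which a fermionic gate acts. -/
def FermionGate.access {p a : ℕ} (g : FermionGate p a) : Finset (Fin p) :=
  (g.maj.map Prod.fst).toFinset

/-- What distinguishes qubit from fermionic proof systems: the elementary gates on a proof of size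
`p` and `a + 1` ancilla qubits, with their descriptions, unitaries and accessed parts of the proof,
and the states that a prover may send. -/
structure Model where
  Gate : ℕ → ℕ → Type
  code : ∀ {p a : ℕ}, Gate p a → List ℕ
  op : ∀ {p a : ℕ}, Gate p a → Op (Site p a)
  access : ∀ {p a : ℕ}, Gate p a → Finset (Fin p)
  IsProof : ∀ {p : ℕ}, Op (Fin p) → Prop

/-- Qubit proofs. -/
noncomputable def qubitModel : Model where
  Gate := QubitGate
  code := QubitGate.code
  op := QubitGate.op
  access := QubitGate.access
  IsProof := IsDensity

/-- Fermionic proofs. -/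
noncomputable def fermionModel : Model where
  Gate := FermionGate
  code := FermionGate.code
  op := FermionGate.op
  access := FermionGate.access
  IsProof := IsFermionicState

/-- The unitary of a circuit; the first gate of the list is applied first. -/
noncomputable def circuitOp (M : Model) {p a : ℕ} : List (M.Gate p a) → Op (Site p a)
  | [] => 1
  | g :: gs => circuitOp M gs * M.op g

/-- The state `ρ ⊗ |0…0⟩⟨0…0|` of proof and ancilla qubits. -/
def withAncillas {p a : ℕ} (ρ : Op (Fin p)) : Op (Site p a) :=
  Matrix.of fun u v =>
    if (∀ k, u (.inr k) = false) ∧ (∀ k, v (.inr k) = false) then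
      ρ (fun k => u (.inl k)) (fun k => v (.inl k))
    else 0

/-- The projector on the outcome `Z = +1` (that is, `|0⟩`) of the ancilla qubit number `0`. -/
def acceptProjector (p a : ℕ) : Op (Site p a) :=
  Matrix.diagonal fun u => if u (.inr 0) = false then 1 else 0

/-- The probability that a circuit accepts the proof `ρ`. -/
noncomputable def circuitAccept (M : Model) {p a : ℕ} (C : List (M.Gate p a))
    (ρ : Op (Fin p)) : ℝ :=
  (acceptProjector p a *
    (circuitOp M C * withAncillas ρ * (circuitOp M C)ᴴ)).trace.re

/-! ### Verifiers and complexity classes -/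

/-- A promise problem. -/
structure PromiseProblem where
  yes : Set (List Bool)
  no : Set (List Bool)
  disjoint : Disjoint yes no

/-- A quantum polynomial-time verifier. On an input `x` of length `n` the proof consists of `p(n)`
qubits or modes. From `x` and `m(n)` random bits `r` a classical polynomial-time program writes
down a circuit on the proof and `a(n) + 1` ancilla qubits. The parts of the proof that the verifier
picks are those on which this circuit acts. -/
structure Verifier (M : Model) where
  p : Polynomial ℕ
  a : Polynomial ℕ
  m : Polynomial ℕ
  circuit : ∀ x : List Bool, (Fin (m.eval x.length) → Bool) →
    List (M.Gate (p.eval x.length) (a.eval x.length))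
  polyTime : ∃ (P : Prog) (T : Polynomial ℕ), ∀ x r, ∃ (t : ℕ) (s : Store),
    t ≤ T.eval x.length ∧ Exec P (initStore x (List.ofFn r)) t s ∧
      s 2 = (circuit x r).flatMap M.code

/-- The verifier accesses at most `q(n)` qubits (modes) of the proof on inputs of length `n`,
whatever her random bits are. -/
def Verifier.AccessesAtMost {M : Model} (V : Verifier M) (q : ℕ → ℕ) : Prop :=
  ∀ x r, {k | ∃ g ∈ V.circuit x r, k ∈ M.access g}.ncard ≤ q x.length

/-- The probability, over the uniform random bits and the measurement, of accepting `ρ`. -/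
noncomputable def Verifier.acceptProb {M : Model} (V : Verifier M) (x : List Bool)
    (ρ : Op (Fin (V.p.eval x.length))) : ℝ :=
  (∑ r : Fin (V.m.eval x.length) → Bool, circuitAccept M (V.circuit x r) ρ) /
    2 ^ (V.m.eval x.length)

/-- The promise problems that have a verifier with completeness `2/3` and soundness `1/3` that
accesses at most `q(n)` qubits (modes) of its proof. -/
def PCP (M : Model) (q : ℕ → ℕ) : Set PromiseProblem :=
  {L | ∃ V : Verifier M, V.AccessesAtMost q ∧
    (∀ x ∈ L.yes, ∃ ρ, M.IsProof ρ ∧ 2 / 3 ≤ V.acceptProb x ρ) ∧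
    (∀ x ∈ L.no, ∀ ρ, M.IsProof ρ → V.acceptProb x ρ ≤ 1 / 3)}

/-- `QPCP[O(f)]`. -/
def QPCPBigO (f : ℕ → ℝ) : Set PromiseProblem :=
  {L | ∃ q : ℕ → ℕ, (fun n => (q n : ℝ)) =O[Filter.atTop] f ∧ L ∈ PCP qubitModel q}

/-- `FermPCP[O(f)]`. -/
def FermPCPBigO (f : ℕ → ℝ) : Set PromiseProblem :=
  {L | ∃ q : ℕ → ℕ, (fun n => (q n : ℝ)) =O[Filter.atTop] f ∧ L ∈ PCP fermionModel q}

end FermPCP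

namespace FermPCP

open scoped Matrix ComplexOrder

set_option linter.unusedSectionVars false

/-! ### Pauli operators -/

section Pauli

variable {ι : Type} [Fintype ι] [DecidableEq ι]

/-! A Jordan-Wigner string touches too many qubits, so the $2p$ Majorana operators are represented
differently, by anticommuting Pauli words of length $O(\log p)$ on $2p$ qubits. The qubits are the
nodes of a binary heap. The word of a node has $Z$ at the node itself and, at each proper ancestor,
$X$ or $Y$ according to whether the path continues to the left or to the right child. Two such words
share sites only on the common part of their paths, where they agree except at the last common node;
there the letters differ, so the words anticommute (`IsPauliFamily.path_anti`). Their length is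
bounded in `length_path_le`.

The qubit space is larger than Fock space, so this is no unitary equivalence. Yet normalized traces
of Majorana words do not depend on the representation, and therefore the assignment extends to a
star homomorphism $\Phi$ of the full matrix algebra (`exists_isRepresentation`). A fermionic proof
$\rho$ becomes $2^{-p}\Phi(\rho)$. Conversely, a qubit proof $\rho'$ defines the functional
$A\mapsto\operatorname{Tr}\rho'\Phi(A)$, which is the expectation in a density matrix on Fock space.
That matrix need not be even, but all gates are, so its even part is accepted with the same
probability (`circuitAccept_evenPart`). Acceptance probabilities agree exactly in both directions,
so no amplification is needed.

A rotation about a long word is built from elementary gates with one additional ancilla in the state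
$|0\rangle$: conjugating a one-qubit rotation of this ancilla by the word, controlled letter by
letter by the ancilla, gives the rotation about $Z$ times the word, and $Z$ acts as $1$ on
$|0\rangle$ (`qubitCircuitOp_compileGate`, `circuitAccept_compile`).

Each accessed mode has two Majorana operators, each touching at most $\log_2(2p)+1$ qubits
(`ncard_access_compile_le`); for polynomial $p$ this is $O(\log n)$. It remains to translate
circuits in polynomial time: an explicit stack program does so and is run on the output of the given
verifier (`runs_compileProg`, `exec_composed`). -/

/-- Flipping the bit at `s`. -/
def flip (s : ι) (u : ι → Bool) : ι → Bool := Function.update u s (!u s)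

@[simp] lemma flip_flip (s : ι) (u : ι → Bool) : flip s (flip s u) = u := by
  simp [flip]

@[simp] lemma flip_same (s : ι) (u : ι → Bool) : flip s u s = !u s := by simp [flip]

lemma flip_of_ne {s t : ι} (h : t ≠ s) (u : ι → Bool) : flip s u t = u t := by
  simp [flip, h]

lemma flip_comm (s t : ι) (u : ι → Bool) : flip s (flip t u) = flip t (flip s u) := by
  by_cases h : s = t
  · subst h; rfl
  · simp only [flip, Function.update_of_ne h, Function.update_of_ne (Ne.symm h)]
    exact (Function.update_comm h _ _ _).symm

lemma eq_flip_iff (s : ι) (u v : ι → Bool) : u = flip s v ↔ flip s u = v :=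
  ⟨fun h => by rw [h, flip_flip], fun h => by rw [← h, flip_flip]⟩

lemma pauliX_apply (s : ι) (u v : ι → Bool) :
    pauliX s u v = if u = flip s v then 1 else 0 := rfl

lemma pauliX_mul_apply (s : ι) (M : Op ι) (u v : ι → Bool) :
    (pauliX s * M) u v = M (flip s u) v := by
  simp [Matrix.mul_apply, pauliX_apply, eq_flip_iff]

lemma mul_pauliX_apply (s : ι) (M : Op ι) (u v : ι → Bool) :
    (M * pauliX s) u v = M u (flip s v) := by
  simp [Matrix.mul_apply, pauliX_apply]

lemma pauliX_mul_self (s : ι) : pauliX s * pauliX s = 1 := by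
  ext u v
  simp only [pauliX_mul_apply, pauliX_apply, Matrix.one_apply, eq_flip_iff, flip_flip]

lemma pauliX_comm (s t : ι) : pauliX s * pauliX t = pauliX t * pauliX s := by
  ext u v
  simp only [pauliX_mul_apply, pauliX_apply, eq_flip_iff, flip_comm s t]

lemma diagonal_mul_pauliX (f : (ι → Bool) → ℂ) (s : ι) :
    Matrix.diagonal f * pauliX s = pauliX s * Matrix.diagonal (fun u => f (flip s u)) := by
  ext u v
  simp only [mul_pauliX_apply, pauliX_mul_apply, Matrix.diagonal_apply, eq_flip_iff, flip_flip]

lemma pauliX_conjTranspose (s : ι) : (pauliX s)ᴴ = pauliX s := by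
  ext u v
  simp only [Matrix.conjTranspose_apply, pauliX_apply, eq_flip_iff s u v, eq_comm (a := v)]
  split_ifs <;> simp

lemma pauliZ_mul_self (s : ι) : pauliZ s * pauliZ s = 1 := by
  rw [pauliZ, Matrix.diagonal_mul_diagonal, ← Matrix.diagonal_one]
  congr 1; ext u; split_ifs <;> simp

lemma pauliZ_comm (s t : ι) : pauliZ s * pauliZ t = pauliZ t * pauliZ s := by
  simp only [pauliZ, Matrix.diagonal_mul_diagonal, mul_comm]

lemma pauliZ_conjTranspose (s : ι) : (pauliZ s)ᴴ = pauliZ s := by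
  rw [pauliZ, Matrix.diagonal_conjTranspose]
  congr 1; ext u; simp only [Pi.star_apply]; split_ifs <;> simp

lemma pauliZ_mul_pauliX_of_ne {s t : ι} (h : s ≠ t) :
    pauliZ s * pauliX t = pauliX t * pauliZ s := by
  simp only [pauliZ, diagonal_mul_pauliX, flip_of_ne h]

lemma pauliZ_mul_pauliX_same (s : ι) : pauliZ s * pauliX s = -(pauliX s * pauliZ s) := by
  rw [pauliZ, diagonal_mul_pauliX, ← mul_neg, Matrix.diagonal_neg]
  congr 2; ext u; cases h : u s <;> simp [h]

lemma pauli_mul_self (s : ι) (A : Axis) : pauli s A * pauli s A = 1 := by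
  cases A
  · exact pauliX_mul_self s
  · simp only [pauli]
    rw [smul_mul_smul_comm, Complex.I_mul_I, mul_assoc, ← mul_assoc (pauliZ s),
      pauliZ_mul_pauliX_same, neg_mul, mul_neg, mul_assoc, pauliZ_mul_self, mul_one,
      pauliX_mul_self]
    simp
  · exact pauliZ_mul_self s

lemma pauli_comm {s t : ι} (h : s ≠ t) (A B : Axis) :
    Commute (pauli s A) (pauli t B) := by
  have hXX : Commute (pauliX s) (pauliX t) := pauliX_comm s t
  have hZZ : Commute (pauliZ s) (pauliZ t) := pauliZ_comm s t
  have hZX : Commute (pauliZ s) (pauliX t) := pauliZ_mul_pauliX_of_ne h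
  have hXZ : Commute (pauliX s) (pauliZ t) := (pauliZ_mul_pauliX_of_ne h.symm).symm
  have hX : ∀ B, Commute (pauliX s) (pauli t B)
    | .X => hXX
    | .Y => (hXX.mul_right hXZ).smul_right _
    | .Z => hXZ
  have hZ : ∀ B, Commute (pauliZ s) (pauli t B)
    | .X => hZX
    | .Y => (hZX.mul_right hZZ).smul_right _
    | .Z => hZZ
  cases A
  · exact hX B
  · exact ((hX B).mul_left (hZ B)).smul_left _
  · exact hZ B

/-- Two anticommuting elements. -/
def Anti {R : Type*} [Ring R] (a b : R) : Prop := a * b = -(b * a)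

lemma Anti.symm {R : Type*} [Ring R] {a b : R} (h : Anti a b) : Anti b a := by
  unfold Anti at *; rw [h, neg_neg]

lemma Anti.mul_commute_left {R : Type*} [Ring R] {a b c : R} (h : Anti a b) (hc : Commute c b) :
    Anti (c * a) b := by
  unfold Anti at *; rw [mul_assoc, h, mul_neg, ← mul_assoc, hc.eq, mul_assoc]

lemma Anti.mul_commute_right {R : Type*} [Ring R] {a b c : R} (h : Anti a b) (hc : Commute c a) :
    Anti a (c * b) := (h.symm.mul_commute_left hc).symm

lemma Anti.smul_left {R : Type*} [Ring R] [Algebra ℂ R] {a b : R} (h : Anti a b) (z : ℂ) :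
    Anti (z • a) b := by
  unfold Anti at *; rw [smul_mul_assoc, h, smul_neg, mul_smul_comm]

lemma anti_XZ (s : ι) : Anti (pauliX s) (pauliZ s) :=
  Anti.symm (pauliZ_mul_pauliX_same s)

lemma pauli_anti (s : ι) {A B : Axis} (h : A ≠ B) : Anti (pauli s A) (pauli s B) := by
  have hXZ := anti_XZ s
  have hYX : Anti (pauli s .Y) (pauli s .X) := by
    have : Anti (pauliX s * pauliZ s) (pauliX s) := hXZ.symm.mul_commute_left (Commute.refl _)
    exact this.smul_left _
  have hYZ : Anti (pauli s .Y) (pauli s .Z) := by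
    have : Anti (pauliX s * pauliZ s) (pauliZ s) := by
      unfold Anti at *; rw [mul_assoc, ← mul_assoc (pauliZ s), ← neg_eq_iff_eq_neg.2 hXZ]; simp [mul_assoc]
    exact this.smul_left _
  cases A <;> cases B <;> first | exact absurd rfl h | assumption | exact Anti.symm ‹_›

lemma pauli_conjTranspose (s : ι) (A : Axis) : (pauli s A)ᴴ = pauli s A := by
  cases A
  · exact pauliX_conjTranspose s
  · simp only [pauli]
    rw [Matrix.conjTranspose_smul, Matrix.conjTranspose_mul, pauliX_conjTranspose,
      pauliZ_conjTranspose, pauliZ_mul_pauliX_same]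
    simp
  · exact pauliZ_conjTranspose s

lemma pauliX_mul_pauliY (s : ι) :
    pauli s .X * pauli s .Y = Complex.I • pauli s .Z := by
  simp only [pauli]
  rw [mul_smul_comm, ← mul_assoc, pauliX_mul_self, one_mul]

/-! ### Rotations -/

lemma rotation_pow {P : Op ι} (hP : P * P = 1) (n : ℕ) :
    rotation P ^ n = ((Real.cos (n * (Real.pi / 8)) : ℝ) : ℂ) • (1 : Op ι) +
      (Complex.I * ((Real.sin (n * (Real.pi / 8)) : ℝ) : ℂ)) • P := by
  induction n with
  | zero => simp
  | succ n ih =>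
    rw [pow_succ, ih, rotation]
    push_cast
    rw [add_mul (n : ℂ) 1, one_mul, Complex.cos_add, Complex.sin_add]
    simp only [add_mul, mul_add, smul_mul_smul_comm, one_mul, mul_one, hP]
    have hI : Complex.I * Complex.I = -1 := Complex.I_mul_I
    set c := Complex.cos (n * (Real.pi / 8))
    set s := Complex.sin (n * (Real.pi / 8))
    set c' := Complex.cos (Real.pi / 8)
    set s' := Complex.sin (Real.pi / 8)
    have e : Complex.I * s * (Complex.I * s') = - (s * s') := by linear_combination s * s' * hI
    rw [e]
    module

lemma rotation_pow_two {P : Op ι} (hP : P * P = 1) :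
    rotation P ^ 2 = ((√2 / 2 : ℝ) : ℂ) • (1 + Complex.I • P) := by
  rw [rotation_pow hP]
  have h : ((2 : ℕ) : ℝ) * (Real.pi / 8) = Real.pi / 4 := by push_cast; ring
  rw [h, Real.cos_pi_div_four, Real.sin_pi_div_four]
  module

/-- A rotation by $\pi/8$ has order dividing 16, so fourteen copies undo two. Inverses are not among
the elementary gates, hence this detour. -/
lemma rotation_pow_fourteen {P : Op ι} (hP : P * P = 1) :
    rotation P ^ 14 = ((√2 / 2 : ℝ) : ℂ) • (1 - Complex.I • P) := by
  rw [rotation_pow hP]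
  have h : ((14 : ℕ) : ℝ) * (Real.pi / 8) = 2 * Real.pi - Real.pi / 4 := by push_cast; ring
  rw [h, Real.cos_two_pi_sub, Real.sin_two_pi_sub, Real.cos_pi_div_four, Real.sin_pi_div_four]
  push_cast
  module

/-- The operator `A` controlled by the outcome `+1` of a commuting involution `X`. -/
noncomputable def controlled (X A : Op ι) : Op ι :=
  (1 / 2 : ℂ) • ((1 - X) + (1 + X) * A)

/-- Expand $\exp(i\frac\pi4(1+X)(1-A))$ into four commuting rotations. The exponent vanishes where
$X=-1$, and where $X=+1$ it is $i\frac\pi2(1-A)$, whose exponential is $A$ because $A$ has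
eigenvalues $\pm1$. -/
lemma rotations_eq_controlled {X A : Op ι} (hX : X * X = 1) (hA : A * A = 1)
    (hXA : Commute X A) :
    rotation (X * A) ^ 14 * (rotation A ^ 14 * (rotation X ^ 2 * rotation (1 : Op ι) ^ 2)) =
      controlled X A := by
  have hXA2 : X * A * (X * A) = 1 := by
    rw [mul_assoc, ← mul_assoc A, ← hXA.eq, mul_assoc, hA, mul_one, hX]
  rw [rotation_pow_two hX, rotation_pow_two (one_mul 1), rotation_pow_fourteen hA,
    rotation_pow_fourteen hXA2, controlled]
  simp only [smul_mul_smul_comm]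
  have h2 : ((√2 / 2 : ℝ) : ℂ) * ((√2 / 2 : ℝ) : ℂ) = 1 / 2 := by
    rw [← Complex.ofReal_mul]
    have : √2 / 2 * (√2 / 2) = (1 / 2 : ℝ) := by
      nlinarith [Real.mul_self_sqrt (show (0 : ℝ) ≤ 2 by norm_num)]
    rw [this]; norm_num
  have h4 : ((√2 / 2 : ℝ) : ℂ) * (((√2 / 2 : ℝ) : ℂ) * (((√2 / 2 : ℝ) : ℂ) *
      ((√2 / 2 : ℝ) : ℂ))) = 1 / 4 := by rw [h2, ← mul_assoc, h2]; norm_num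
  rw [h4]
  have hAX : A * X = X * A := hXA.eq.symm
  have hXXA : X * A * A = X := by rw [mul_assoc, hA, mul_one]
  have hXAX : X * A * X = A := by rw [mul_assoc, hAX, ← mul_assoc, hX, one_mul]
  have hI : Complex.I * Complex.I = -1 := Complex.I_mul_I
  have e1 : (1 - Complex.I • A) * ((1 + Complex.I • X) * (1 + Complex.I • (1 : Op ι))) =
      (1 + Complex.I) • (1 + Complex.I • X - Complex.I • A + X * A) := by
    simp only [mul_add, add_mul, sub_mul, one_mul, mul_one, hAX, hI,
      mul_smul_comm, smul_mul_assoc, smul_smul, smul_sub, smul_add]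
    module
  rw [e1, mul_smul_comm]
  have e2 : (1 - Complex.I • (X * A)) * (1 + Complex.I • X - Complex.I • A + X * A) =
      (1 - Complex.I) • (1 - X + (1 + X) * A) := by
    simp only [mul_add, mul_sub, add_mul, sub_mul, one_mul, mul_one,
      mul_smul_comm, smul_mul_assoc, hXXA, hXAX, hXA2]
    match_scalars <;> first | ring1 | linear_combination hI | linear_combination -hI
  rw [e2, smul_smul, smul_smul]
  congr 1
  linear_combination (-1 / 4 : ℂ) * hI

/-- Since $A$ preserves the eigenspaces of $X$, the products can be taken eigenspace by eigenspace.
This assembles controlled letters into a controlled word. -/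
lemma controlled_mul {X A B : Op ι} (hX : X * X = 1) (hA : Commute X A) :
    controlled X A * controlled X B = controlled X (A * B) := by
  have hAX : A * X = X * A := hA.eq.symm
  have h3 : A * (X * B) = X * (A * B) := by rw [← mul_assoc, hAX, mul_assoc]
  have h4 : X * (X * B) = B := by rw [← mul_assoc, hX, one_mul]
  have h5 : X * (X * (A * B)) = A * B := by rw [← mul_assoc, hX, one_mul]
  have h6 : X * (X * A) = A := by rw [← mul_assoc, hX, one_mul]
  simp only [controlled, smul_mul_smul_comm, mul_add, mul_sub, add_mul, sub_mul, one_mul, mul_one,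
    mul_assoc, hX, h3, h4, h5, h6, hAX]
  module

lemma controlled_one (X : Op ι) : controlled X 1 = 1 := by
  simp only [controlled, mul_one]; module

/-- An operator that anticommutes with $X$ exchanges its eigenspaces, so the control moves to the
opposite outcome. -/
lemma controlled_mul_anti {X A K : Op ι} (hK : Anti K X) (hKA : Commute K A) :
    K * controlled X A = controlled (-X) A * K := by
  unfold Anti at hK
  simp only [controlled, mul_add, mul_sub, add_mul, sub_mul, one_mul, mul_one,
    mul_assoc, mul_smul_comm, smul_mul_assoc, neg_mul]
  rw [← mul_assoc K X A, hK, ← hKA.eq]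
  simp [mul_assoc]

/-- Conjugating a rotation about `K` by a controlled Hermitian operator. -/
lemma controlled_rotation {X K M : Op ι} (hX : X * X = 1) (hK : Anti K X)
    (hXM : Commute X M) (hKM : Commute K M) (hM : M * M = 1) :
    controlled X M * (rotation K * controlled X M) = rotation (K * M) := by
  have h1 : controlled X M * controlled X M = 1 := by
    rw [controlled_mul hX hXM, hM, controlled_one]
  have h2 : controlled X M * (K * controlled X M) = K * M := by
    rw [controlled_mul_anti hK hKM, ← mul_assoc]
    -- The two controls act on complementary eigenspaces of $X$, so together $M$ is applied
    -- everywhere.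
    have : controlled X M * controlled (-X) M = M := by
      have c : M * (X * M) = X := by rw [← mul_assoc, ← hXM.eq, mul_assoc, hM, mul_one]
      have d : X * (X * M) = M := by rw [← mul_assoc, hX, one_mul]
      simp only [controlled, smul_mul_smul_comm, mul_add, mul_sub, add_mul, sub_mul, one_mul,
        mul_one, mul_assoc, neg_mul, mul_neg, hX, hM, c, d, ← hXM.eq]
      module
    rw [this, hKM.eq]
  simp only [rotation, add_mul, mul_add, smul_mul_assoc, mul_smul_comm, one_mul, h1, h2]

/-- Conjugating a rotation about `K` by a controlled anti-Hermitian operator. -/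
lemma controlled_rotation_anti {X K M : Op ι} (hX : X * X = 1) (hK : Anti K X)
    (hXM : Commute X M) (hKM : Commute K M) (hM : M * M = -1) :
    controlled X M * (rotation K * controlled X (-M)) = rotation (X * K * M) := by
  have h1 : controlled X M * controlled X (-M) = 1 := by
    rw [controlled_mul hX hXM, mul_neg, hM, neg_neg, controlled_one]
  have h2 : controlled X M * (K * controlled X (-M)) = X * K * M := by
    rw [controlled_mul_anti hK hKM.neg_right, ← mul_assoc]
    -- Here the two eigenspaces receive $M$ and $-M$, that is, $M$ multiplied by the eigenvalue of
    -- $X$.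
    have : controlled X M * controlled (-X) (-M) = X * M := by
      have c : M * (X * M) = -X := by rw [← mul_assoc, ← hXM.eq, mul_assoc, hM, mul_neg, mul_one]
      have d : X * (X * M) = M := by rw [← mul_assoc, hX, one_mul]
      simp only [controlled, smul_mul_smul_comm, mul_add, mul_sub, add_mul, sub_mul, one_mul,
        mul_one, mul_assoc, neg_mul, mul_neg, hX, hM, c, d, ← hXM.eq]
      module
    rw [this, mul_assoc, ← hKM.eq, mul_assoc]
  simp only [rotation, add_mul, mul_add, smul_mul_assoc, mul_smul_comm, one_mul, h1, h2]

end Pauli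


/-! ### The tree encoding of Majorana operators

The sites `0, …, N - 1` form a binary heap, the children of `v` being `2 v + 1` and `2 v + 2`. -/

/-- The letter at the parent of `v + 1`: it tells whether `v + 1` is a left or a right child. -/
def turn (v : ℕ) : Axis := if v % 2 = 0 then .X else .Y

/-- The letters of the proper ancestors of `v`. -/
def ancestors {N : ℕ} : (v : ℕ) → v < N → List (Fin N × Axis)
  | 0, _ => []
  | v + 1, h => (⟨v / 2, by omega⟩, turn v) :: ancestors (v / 2) (by omega)
decreasing_by omega

/-- The Pauli word that represents the Majorana operator number `v`. -/
def path {N : ℕ} (v : ℕ) (h : v < N) : List (Fin N × Axis) :=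
  (⟨v, h⟩, .Z) :: ancestors v h

section Family

variable {R : Type*} [Ring R] {N : ℕ}

/-- The relations between Pauli operators. -/
structure IsPauliFamily {ι : Type*} (σ : ι → Axis → R) : Prop where
  sq : ∀ s A, σ s A * σ s A = 1
  comm : ∀ s t, s ≠ t → ∀ A B, Commute (σ s A) (σ t B)
  anti : ∀ s A B, A ≠ B → Anti (σ s A) (σ s B)

/-- The product of the letters of a word. -/
def wordProd {ι : Type*} (σ : ι → Axis → R) (l : List (ι × Axis)) : R :=
  (l.map fun x => σ x.1 x.2).prod

@[simp] lemma wordProd_nil {ι : Type*} (σ : ι → Axis → R) : wordProd σ [] = 1 := rfl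

@[simp] lemma wordProd_cons {ι : Type*} (σ : ι → Axis → R) (x : ι × Axis) (l : List (ι × Axis)) :
    wordProd σ (x :: l) = σ x.1 x.2 * wordProd σ l := by simp [wordProd]

lemma wordProd_append {ι : Type*} (σ : ι → Axis → R) (l l' : List (ι × Axis)) :
    wordProd σ (l ++ l') = wordProd σ l * wordProd σ l' := by simp [wordProd]

lemma commute_wordProd {ι : Type*} {σ : ι → Axis → R} {a : R} {l : List (ι × Axis)}
    (h : ∀ x ∈ l, Commute a (σ x.1 x.2)) : Commute a (wordProd σ l) := by
  induction l with
  | nil => exact Commute.one_right a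
  | cons x l ih =>
    rw [wordProd_cons]
    exact (h x (by simp)).mul_right (ih fun y hy => h y (by simp [hy]))

/-- Letters at distinct sites commute, so their order is irrelevant. Together with the cancellation
against the reversed word, this makes such words involutions. -/
lemma IsPauliFamily.wordProd_reverse {ι : Type*} {σ : ι → Axis → R} (hσ : IsPauliFamily σ)
    {l : List (ι × Axis)} (h : (l.map Prod.fst).Nodup) :
    wordProd σ l.reverse = wordProd σ l := by
  induction l with
  | nil => rfl
  | cons x l ih =>
    rw [List.map_cons, List.nodup_cons] at h
    rw [List.reverse_cons, wordProd_append, wordProd_cons, wordProd_nil, mul_one, ih h.2,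
      wordProd_cons]
    refine (commute_wordProd fun y hy => hσ.comm _ _ ?_ _ _).eq.symm
    rintro e
    exact h.1 (e ▸ List.mem_map_of_mem hy)

lemma IsPauliFamily.wordProd_mul_reverse {ι : Type*} {σ : ι → Axis → R} (hσ : IsPauliFamily σ)
    (l : List (ι × Axis)) : wordProd σ l * wordProd σ l.reverse = 1 := by
  induction l with
  | nil => simp
  | cons x l ih =>
    rw [List.reverse_cons, wordProd_append, wordProd_cons, wordProd_cons, wordProd_nil, mul_one,
      mul_assoc, ← mul_assoc (wordProd σ l), ih, one_mul, hσ.sq]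

lemma lt_of_mem_ancestors {v : ℕ} {h : v < N} {x : Fin N × Axis} (hx : x ∈ ancestors v h) :
    (x.1 : ℕ) < v := by
  induction v using Nat.strong_induction_on with
  | _ v ih =>
    cases v with
    | zero => simp [ancestors] at hx
    | succ v =>
      rw [ancestors, List.mem_cons] at hx
      rcases hx with rfl | hx
      · simp; omega
      · have := ih (v / 2) (by omega) hx
        omega

lemma ancestors_nodup (v : ℕ) (h : v < N) : ((ancestors v h).map Prod.fst).Nodup := by
  induction v using Nat.strong_induction_on with
  | _ v ih =>
    cases v with
    | zero => simp [ancestors]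
    | succ v =>
      rw [ancestors, List.map_cons, List.nodup_cons]
      refine ⟨fun hm => ?_, ih (v / 2) (by omega) _⟩
      obtain ⟨x, hx, e⟩ := List.mem_map.1 hm
      have := lt_of_mem_ancestors hx
      rw [e] at this
      simp at this

lemma path_nodup (v : ℕ) (h : v < N) : ((path v h).map Prod.fst).Nodup := by
  rw [path, List.map_cons, List.nodup_cons]
  refine ⟨fun hm => ?_, ancestors_nodup v h⟩
  obtain ⟨x, hx, e⟩ := List.mem_map.1 hm
  have := lt_of_mem_ancestors hx
  rw [e] at this
  simp at this

lemma le_of_mem_path {v : ℕ} {h : v < N} {x : Fin N × Axis} (hx : x ∈ path v h) :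
    (x.1 : ℕ) ≤ v := by
  rw [path, List.mem_cons] at hx
  rcases hx with rfl | hx
  · exact le_rfl
  · exact (lt_of_mem_ancestors hx).le

/-- With nodes counted from one, passing to the parent is division by two. The logarithm in the
final access bound originates here. -/
lemma length_ancestors_le (v : ℕ) (h : v < N) : (ancestors v h).length ≤ Nat.log 2 (v + 1) := by
  induction v using Nat.strong_induction_on with
  | _ v ih =>
    cases v with
    | zero => simp [ancestors]
    | succ v =>
      rw [ancestors, List.length_cons]
      have := ih (v / 2) (by omega) (by omega)
      have e : Nat.log 2 (v + 1 + 1) = Nat.log 2 ((v + 1 + 1) / 2) + 1 :=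
        Nat.log_of_one_lt_of_le (by norm_num) (by omega)
      rw [e]
      have : (v + 1 + 1) / 2 = v / 2 + 1 := by omega
      rw [this]; omega

variable {σ : Fin N → Axis → R}

lemma IsPauliFamily.commute_ancestors (hσ : IsPauliFamily σ) {u v : ℕ} (hu : u < N) (hv : v < N)
    (h : v ≤ u) (A : Axis) : Commute (σ ⟨u, hu⟩ A) (wordProd σ (ancestors v hv)) :=
  commute_wordProd fun x hx => hσ.comm _ _ (by
    intro e
    have := lt_of_mem_ancestors hx
    rw [← e] at this
    simp at this; omega) _ _

lemma IsPauliFamily.commute_path (hσ : IsPauliFamily σ) {u v : ℕ} (hu : u < N) (hv : v < N)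
    (h : v < u) (A : Axis) : Commute (σ ⟨u, hu⟩ A) (wordProd σ (path v hv)) :=
  commute_wordProd fun x hx => hσ.comm _ _ (by
    intro e
    have := le_of_mem_path hx
    rw [← e] at this
    simp at this; omega) _ _

lemma wordProd_ancestors_succ (v : ℕ) (h : v + 1 < N) :
    wordProd σ (ancestors (v + 1) h) =
      σ ⟨v / 2, by omega⟩ (turn v) * wordProd σ (ancestors (v / 2) (by omega)) := by
  rw [ancestors, wordProd_cons]

lemma turn_ne {u v : ℕ} (h : u ≠ v) (h' : u / 2 = v / 2) : turn u ≠ turn v := by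
  unfold turn
  have : u % 2 ≠ v % 2 := by omega
  rcases Nat.mod_two_eq_zero_or_one u with a | a <;>
    rcases Nat.mod_two_eq_zero_or_one v with b | b <;> simp_all

lemma turn_ne_Z (v : ℕ) : turn v ≠ .Z := by
  unfold turn; split_ifs <;> simp

/-- Letters with a common site and different axes, multiplied by a common commuting involution. -/
lemma anti_mul_same {a b d : R} (h : Anti a b) (ha : Commute a d) (hb : Commute b d) :
    Anti (a * d) (b * d) := by
  have h1 : Anti a (b * d) := by
    rw [hb.eq]; exact h.mul_commute_right ha.symm
  rw [ha.eq]
  exact h1.mul_commute_left (hb.symm.mul_right (Commute.refl d))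

/-- The hypotheses place $u$ strictly between `v + 1` and its parent, so neither node is an ancestor
of the other. If the parents agree, the two letters there are $X$ and $Y$. Otherwise the deepest
letter of the larger node commutes with everything else; dropping it replaces that node by its
parent, which lies strictly between $u$ and the parent of $u$, so the hypotheses recur with the
roles exchanged. -/
lemma IsPauliFamily.ancestors_anti (hσ : IsPauliFamily σ) {u v : ℕ} (hu : u < N) (hv : v + 1 < N)
    (huv : u < v + 1) (h : v / 2 < u) :
    Anti (wordProd σ (ancestors u hu)) (wordProd σ (ancestors (v + 1) hv)) := by
  induction v using Nat.strong_induction_on generalizing u with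
  | _ v ih =>
    cases u with
    | zero => omega
    | succ u =>
      rw [wordProd_ancestors_succ v]
      by_cases e : u / 2 = v / 2
      · rw [wordProd_ancestors_succ u]
        simp only [e]
        exact anti_mul_same (hσ.anti _ _ _ (turn_ne (by omega) e))
          (hσ.commute_ancestors _ _ le_rfl _) (hσ.commute_ancestors _ _ le_rfl _)
      · refine Anti.mul_commute_right ?_ ?_
        · obtain ⟨w, hw⟩ : ∃ w, v / 2 = w + 1 := ⟨v / 2 - 1, by omega⟩
          simp only [hw]
          exact (ih u (by omega) _ _ (by omega) (by omega)).symm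
        · rw [wordProd_ancestors_succ u]
          exact (hσ.comm _ _ (by simp [Fin.ext_iff]; omega) _ _).mul_right
            (hσ.commute_ancestors _ _ (by omega) _)

/-- Climb from `v + 1` while its parent exceeds $u$; the dropped letters commute with the word of
$u$. If the climb meets $u$, the final $Z$ faces an $X$ or a $Y$. If it passes below $u$, then $u$
is no ancestor, its $Z$ commutes, and only the ancestors matter. -/
lemma IsPauliFamily.path_anti_ancestors (hσ : IsPauliFamily σ) {u v : ℕ} (hu : u < N)
    (hv : v + 1 < N) (huv : u < v + 1) :
    Anti (wordProd σ (path u hu)) (wordProd σ (ancestors (v + 1) hv)) := by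
  induction v using Nat.strong_induction_on with
  | _ v ih =>
    rcases lt_trichotomy u (v / 2) with h | h | h
    · rw [wordProd_ancestors_succ v]
      obtain ⟨w, hw⟩ : ∃ w, v / 2 = w + 1 := ⟨v / 2 - 1, by omega⟩
      refine Anti.mul_commute_right ?_ (hσ.commute_path _ _ h _)
      simp only [hw]
      exact ih w (by omega) _ (by omega)
    · subst h
      rw [wordProd_ancestors_succ v, path, wordProd_cons]
      exact anti_mul_same (hσ.anti _ _ _ (turn_ne_Z v).symm)
        (hσ.commute_ancestors _ _ le_rfl _) (hσ.commute_ancestors _ _ le_rfl _)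
    · rw [path, wordProd_cons]
      refine (hσ.ancestors_anti _ _ huv h).mul_commute_left ?_
      rw [wordProd_ancestors_succ v]
      exact (hσ.comm _ _ (by simp [Fin.ext_iff]; omega) _ _).mul_right
        (hσ.commute_ancestors _ _ h.le _)

/-- The words of different paths anticommute. -/
lemma IsPauliFamily.path_anti (hσ : IsPauliFamily σ) {u v : ℕ} (hu : u < N) (hv : v < N)
    (huv : u ≠ v) : Anti (wordProd σ (path u hu)) (wordProd σ (path v hv)) := by
  wlog h : u < v generalizing u v
  · exact (this hv hu huv.symm (by omega)).symm
  obtain ⟨v, rfl⟩ : ∃ w, v = w + 1 := ⟨v - 1, by omega⟩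
  conv => arg 2; rw [path, wordProd_cons]
  exact (hσ.path_anti_ancestors hu hv h).mul_commute_right (hσ.commute_path _ _ h _)

lemma IsPauliFamily.path_sq (hσ : IsPauliFamily σ) {u : ℕ} (hu : u < N) :
    wordProd σ (path u hu) * wordProd σ (path u hu) = 1 := by
  have := hσ.wordProd_mul_reverse (path u hu)
  rwa [hσ.wordProd_reverse (path_nodup u hu)] at this

end Family

section Operators

variable {ι κ : Type} [Fintype ι] [DecidableEq ι] [Fintype κ] [DecidableEq κ]

lemma isPauliFamily_pauli {f : κ → ι} (hf : Function.Injective f) :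
    IsPauliFamily (fun s A => pauli (f s) A) where
  sq _ _ := pauli_mul_self _ _
  comm _ _ h _ _ := pauli_comm (hf.ne h) _ _
  anti _ _ _ h := pauli_anti _ h

lemma wordProd_conjTranspose (f : κ → ι) (l : List (κ × Axis)) :
    (wordProd (fun s A => pauli (f s) A) l)ᴴ = wordProd (fun s A => pauli (f s) A) l.reverse := by
  induction l with
  | nil => simp
  | cons x l ih =>
    rw [List.reverse_cons, wordProd_append, wordProd_cons, wordProd_cons, wordProd_nil, mul_one,
      Matrix.conjTranspose_mul, ih, pauli_conjTranspose]

end Operators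


/-! ### Representations of the canonical anticommutation relations -/

/-- Anticommuting involutions. -/
structure IsMajoranaFamily {R I : Type*} [Ring R] (c : I → R) : Prop where
  sq : ∀ i, c i * c i = 1
  anti : ∀ i j, i ≠ j → Anti (c i) (c j)

section CAR

variable {R I : Type*} [Ring R] [Algebra ℂ R] {c : I → R}

lemma IsMajoranaFamily.mul_prod_of_notMem (hc : IsMajoranaFamily c) {i : I} {l : List I}
    (h : i ∉ l) : c i * (l.map c).prod = (-1 : ℂ) ^ l.length • ((l.map c).prod * c i) := by
  induction l with
  | nil => simp
  | cons j l ih =>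
    rw [List.mem_cons, not_or] at h
    have := hc.anti i j h.1
    unfold Anti at this
    rw [List.map_cons, List.prod_cons, ← mul_assoc, this, neg_mul, mul_assoc, ih h.2,
      List.length_cons, pow_succ, mul_smul_comm, mul_assoc]
    simp

/-- Two equal letters with no such letter between them cancel, up to a sign. -/
lemma IsMajoranaFamily.prod_cancel (hc : IsMajoranaFamily c) {i : I} {a b d : List I}
    (h : i ∉ b) : ((a ++ i :: (b ++ i :: d)).map c).prod =
      (-1 : ℂ) ^ b.length • ((a ++ (b ++ d)).map c).prod := by
  simp only [List.map_append, List.map_cons, List.prod_append, List.prod_cons]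
  rw [← mul_assoc (c i), hc.mul_prod_of_notMem h, smul_mul_assoc, mul_smul_comm,
    mul_assoc _ (c i), ← mul_assoc (c i), hc.sq, one_mul]

end CAR

lemma exists_repeat_of_not_nodup {I : Type*} [DecidableEq I] {l : List I} (h : ¬ l.Nodup) :
    ∃ (i : I) (a b d : List I), l = a ++ i :: (b ++ i :: d) ∧ i ∉ b := by
  induction l with
  | nil => simp at h
  | cons j l ih =>
    by_cases hl : l.Nodup
    · have hj : j ∈ l := by by_contra hj; exact h (List.nodup_cons.2 ⟨hj, hl⟩)
      obtain ⟨b, d, e, hb⟩ := List.eq_append_cons_of_mem hj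
      exact ⟨j, [], b, d, by simp [e], hb⟩
    · obtain ⟨i, a, b, d, e, hb⟩ := ih hl
      exact ⟨i, j :: a, b, d, by simp [e], hb⟩

section Trace

variable {ι κ : Type} [Fintype ι] [DecidableEq ι] [Fintype κ] [DecidableEq κ]

/-- Conjugation by $g$ preserves the trace and changes the sign of $M$. -/
lemma trace_eq_zero_of_anti {g M : Op ι} (hg : g * g = 1) (h : Anti g M) : M.trace = 0 := by
  have h1 : M.trace = -M.trace := by
    calc M.trace = (g * (g * M)).trace := by rw [← mul_assoc, hg, one_mul]
      _ = -(g * (M * g)).trace := by rw [h, mul_neg, Matrix.trace_neg]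
      _ = -M.trace := by rw [Matrix.trace_mul_comm, mul_assoc, hg, mul_one]
  exact self_eq_neg.1 h1

/-- A word of even length anticommutes with its own first letter. A word of odd length misses some
letter, because the number $2p$ of letters is even, and anticommutes with that one. -/
lemma IsMajoranaFamily.trace_prod_of_nodup {p : ℕ} {c : Fin p × Bool → Op ι}
    (hc : IsMajoranaFamily c) {l : List (Fin p × Bool)} (hl : l.Nodup) (hne : l ≠ []) :
    (l.map c).prod.trace = 0 := by
  rcases Nat.even_or_odd l.length with he | ho
  · obtain ⟨i, l, rfl⟩ := List.exists_cons_of_ne_nil hne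
    rw [List.nodup_cons] at hl
    refine trace_eq_zero_of_anti (hc.sq i) ?_
    rw [List.map_cons, List.prod_cons]
    refine Anti.mul_commute_right ?_ (Commute.refl _)
    have hodd : Odd l.length := by
      rw [List.length_cons, Nat.even_add_one, Nat.not_even_iff_odd] at he; exact he
    unfold Anti
    rw [hc.mul_prod_of_notMem hl.1, hodd.neg_one_pow, neg_smul, one_smul]
  · obtain ⟨i, hi⟩ : ∃ i, i ∉ l := by
      by_contra! h
      have h1 : l.toFinset = Finset.univ := by ext i; simp [h i]
      have h2 := List.toFinset_card_of_nodup hl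
      rw [h1, Finset.card_univ, Fintype.card_prod, Fintype.card_bool] at h2
      rw [← h2] at ho
      exact (Nat.not_even_iff_odd.2 ho) (even_two.mul_left _)
    refine trace_eq_zero_of_anti (hc.sq i) ?_
    unfold Anti
    rw [hc.mul_prod_of_notMem hi, ho.neg_one_pow, neg_smul, one_smul]

/-- Normalized traces of words do not depend on the representation. -/
lemma IsMajoranaFamily.trace_prod_eq {p : ℕ} {c : Fin p × Bool → Op ι} {γ : Fin p × Bool → Op κ}
    (hc : IsMajoranaFamily c) (hγ : IsMajoranaFamily γ) (l : List (Fin p × Bool)) :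
    (2 : ℂ) ^ Fintype.card κ * (l.map c).prod.trace =
      2 ^ Fintype.card ι * (l.map γ).prod.trace := by
  induction hn : l.length using Nat.strong_induction_on generalizing l with
  | _ n ih =>
    by_cases hl : l.Nodup
    · by_cases hne : l = []
      · subst hne
        simp [mul_comm]
      · rw [hc.trace_prod_of_nodup hl hne, hγ.trace_prod_of_nodup hl hne]; simp
    · obtain ⟨i, a, b, d, rfl, hi⟩ := exists_repeat_of_not_nodup hl
      rw [hc.prod_cancel hi, hγ.prod_cancel hi, Matrix.trace_smul, Matrix.trace_smul]
      have := ih _ (by rw [← hn]; simp) (a ++ (b ++ d)) rfl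
      simp only [smul_eq_mul]
      linear_combination (-1 : ℂ) ^ b.length * this

end Trace

/-! ### The Majorana operators on Fock space -/

section Fock

variable {p : ℕ}

/-- The sign `(-1)^b`. -/
def sgn (b : Bool) : ℂ := if b then -1 else 1

@[simp] lemma sgn_not (b : Bool) : sgn (!b) = -sgn b := by cases b <;> simp [sgn]

@[simp] lemma sgn_mul_self (b : Bool) : sgn b * sgn b = 1 := by cases b <;> simp [sgn]

/-- The diagonal part of a Majorana operator. -/
noncomputable def majDiag (c : Fin p × Bool) (u : Fin p → Bool) : ℂ :=
  (∏ k ∈ Finset.Iio c.1, sgn (u k)) * if c.2 then Complex.I * sgn (u c.1) else 1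

lemma majDiag_flip_of_lt {c : Fin p × Bool} {j : Fin p} (h : j < c.1) (u : Fin p → Bool) :
    majDiag c (flip j u) = -majDiag c u := by
  have h1 : ∏ k ∈ Finset.Iio c.1, sgn (flip j u k) = -∏ k ∈ Finset.Iio c.1, sgn (u k) := by
    have hj : j ∈ Finset.Iio c.1 := Finset.mem_Iio.2 h
    rw [← Finset.mul_prod_erase _ _ hj, ← Finset.mul_prod_erase _ (fun k => sgn (u k)) hj,
      flip_same, sgn_not, neg_mul]
    congr 2
    refine Finset.prod_congr rfl fun k hk => ?_
    rw [flip_of_ne (Finset.ne_of_mem_erase hk)]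
  rw [majDiag, majDiag, h1, flip_of_ne h.ne', neg_mul]

lemma majDiag_flip_of_gt {c : Fin p × Bool} {j : Fin p} (h : c.1 < j) (u : Fin p → Bool) :
    majDiag c (flip j u) = majDiag c u := by
  rw [majDiag, majDiag, flip_of_ne h.ne]
  congr 1
  refine Finset.prod_congr rfl fun k hk => ?_
  rw [flip_of_ne ((Finset.mem_Iio.1 hk).trans h).ne]

lemma majDiag_flip_self (c : Fin p × Bool) (u : Fin p → Bool) :
    majDiag c (flip c.1 u) = (if c.2 then -1 else 1) * majDiag c u := by
  have h : ∏ k ∈ Finset.Iio c.1, sgn (flip c.1 u k) = ∏ k ∈ Finset.Iio c.1, sgn (u k) :=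
    Finset.prod_congr rfl fun k hk => by rw [flip_of_ne (Finset.mem_Iio.1 hk).ne]
  rw [majDiag, majDiag, h, flip_same, sgn_not]
  split_ifs <;> ring

lemma majDiag_mul_self (c : Fin p × Bool) (u : Fin p → Bool) :
    majDiag c u * majDiag c u = if c.2 then -1 else 1 := by
  have h : (∏ k ∈ Finset.Iio c.1, sgn (u k)) * ∏ k ∈ Finset.Iio c.1, sgn (u k) = 1 := by
    rw [← Finset.prod_mul_distrib]; simp
  have hs := sgn_mul_self (u c.1)
  rw [majDiag]
  split_ifs
  · linear_combination (Complex.I * Complex.I * sgn (u c.1) * sgn (u c.1)) * h +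
      Complex.I * Complex.I * hs + Complex.I_mul_I
  · linear_combination h

/-- In the normal form "bit flip times diagonal", relations between Majorana operators reduce to the
effect of one flip on the diagonal functions. -/
lemma majorana_eq (c : Fin p × Bool) :
    majorana (fun k => k) c = pauliX c.1 * Matrix.diagonal (majDiag c) := by
  obtain ⟨j, b⟩ := c
  have h : ∀ u : Fin p → Bool, (∏ k ∈ Finset.Iio j, if flip j u k then (-1 : ℂ) else 1) =
      ∏ k ∈ Finset.Iio j, sgn (u k) := fun u =>
    Finset.prod_congr rfl fun k hk => by rw [flip_of_ne (Finset.mem_Iio.1 hk).ne]; rfl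
  cases b
  · simp only [majorana, pauli, diagonal_mul_pauliX, h, Bool.false_eq_true, if_false]
    congr 2
    ext u
    simp [majDiag]
  · simp only [majorana, pauli, if_true]
    rw [mul_smul_comm, ← mul_assoc, diagonal_mul_pauliX, mul_assoc, pauliZ,
      Matrix.diagonal_mul_diagonal, ← mul_smul_comm, ← Matrix.diagonal_smul]
    congr 2
    ext u
    simp only [h, majDiag, if_true, Pi.smul_apply, smul_eq_mul, sgn]
    ring

lemma pauliX_diagonal_mul {ι : Type} [Fintype ι] [DecidableEq ι] (s t : ι)
    (f g : (ι → Bool) → ℂ) :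
    pauliX s * Matrix.diagonal f * (pauliX t * Matrix.diagonal g) =
      pauliX s * pauliX t * Matrix.diagonal (fun u => f (flip t u) * g u) := by
  rw [mul_assoc, ← mul_assoc (Matrix.diagonal f), diagonal_mul_pauliX, mul_assoc (pauliX t),
    Matrix.diagonal_mul_diagonal, mul_assoc]

lemma isMajoranaFamily_majorana :
    IsMajoranaFamily (fun c : Fin p × Bool => majorana (fun k => k) c) where
  sq c := by
    simp only [majorana_eq, pauliX_diagonal_mul, pauliX_mul_self, one_mul, majDiag_flip_self]
    rw [← Matrix.diagonal_one]
    congr 1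
    ext u
    rw [mul_assoc, majDiag_mul_self]
    split_ifs <;> simp
  anti c d h := by
    unfold Anti
    simp only [majorana_eq, pauliX_diagonal_mul]
    rw [pauliX_comm d.1 c.1, ← mul_neg, Matrix.diagonal_neg]
    congr 2
    ext u
    rcases lt_trichotomy c.1 d.1 with hlt | heq | hgt
    · simp only [majDiag_flip_of_gt hlt, majDiag_flip_of_lt hlt]; ring
    · have hc := majDiag_flip_self c u
      have hd := majDiag_flip_self d u
      rw [← heq] at hd
      simp only [← heq, hc, hd]
      have : c.2 = !d.2 := by
        rcases c with ⟨c, b⟩; rcases d with ⟨d, b'⟩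
        cases b <;> cases b' <;> simp_all
      rw [this]
      cases d.2 <;> simp <;> ring
    · simp only [majDiag_flip_of_gt hgt, majDiag_flip_of_lt hgt]; ring

lemma majorana_conjTranspose (c : Fin p × Bool) :
    (majorana (fun k => k) c)ᴴ = majorana (fun k => k) c := by
  rw [majorana_eq, Matrix.conjTranspose_mul, pauliX_conjTranspose, Matrix.diagonal_conjTranspose,
    diagonal_mul_pauliX]
  congr 2
  ext u
  rw [Pi.star_apply, majDiag_flip_self]
  have hs : ∀ b, star (sgn b) = sgn b := fun b => by cases b <;> simp [sgn]
  simp only [majDiag, star_mul', star_prod, hs]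
  split_ifs <;> simp [hs]

/-- The Majorana operators generate all operators on Fock space. -/
lemma adjoin_majorana :
    Algebra.adjoin ℂ (Set.range fun c : Fin p × Bool => majorana (fun k => k) c) = ⊤ := by
  set A := Algebra.adjoin ℂ (Set.range fun c : Fin p × Bool => majorana (fun k => k) c) with hA
  have hc : ∀ c : Fin p × Bool, majorana (fun k => k) c ∈ A := fun c =>
    Algebra.subset_adjoin ⟨c, rfl⟩
  -- The strings of the two Majorana operators of a mode cancel in their product:
  -- $Z_k=-i\,c_{2k-1}c_{2k}$.
  have hZ : ∀ k : Fin p, Matrix.diagonal (fun u : Fin p → Bool => sgn (u k)) ∈ A := by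
    intro k
    have h := A.smul_mem (A.mul_mem (hc (k, false)) (hc (k, true))) (-Complex.I)
    convert h using 1
    rw [majorana_eq, majorana_eq, pauliX_diagonal_mul, pauliX_mul_self, one_mul,
      ← Matrix.diagonal_smul]
    congr 1
    ext u
    have h1 := majDiag_flip_self (k, false) u
    have h2 := majDiag_mul_self (k, false) u
    have h3 : majDiag (k, true) u = Complex.I * sgn (u k) * majDiag (k, false) u := by
      simp [majDiag]; ring
    simp only [Bool.false_eq_true, if_false, one_mul] at h1 h2
    simp only [Pi.smul_apply, smul_eq_mul, h1, h3]
    linear_combination (Complex.I * Complex.I * sgn (u k)) * h2 + sgn (u k) * Complex.I_mul_I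
  have hprod : ∀ (s : Finset (Fin p)) (f : Fin p → (Fin p → Bool) → ℂ),
      (∀ k, Matrix.diagonal (f k) ∈ A) → Matrix.diagonal (fun u => ∏ k ∈ s, f k u) ∈ A := by
    intro s f hf
    induction s using Finset.induction_on with
    | empty => simp
    | insert k s hk ih =>
      simp only [Finset.prod_insert hk]
      rw [← Matrix.diagonal_mul_diagonal]
      exact A.mul_mem (hf k) ih
  -- With all $Z_j$ available, the string in front of $X_k$ can be removed.
  have hX : ∀ k : Fin p, pauliX k ∈ A := by
    intro k
    have h := A.mul_mem (hc (k, false)) (hprod (Finset.Iio k) (fun j u => sgn (u j)) hZ)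
    rw [majorana_eq, mul_assoc, Matrix.diagonal_mul_diagonal] at h
    convert h using 1
    have : (fun u : Fin p → Bool => majDiag (k, false) u * ∏ j ∈ Finset.Iio k, sgn (u j)) =
        fun _ => 1 := by
      ext u
      have := majDiag_mul_self (k, false) u
      simpa [majDiag] using this
    rw [this, Matrix.diagonal_one, mul_one]
  -- The projector on a basis state is the product of the one-mode projectors $(1\pm Z_k)/2$; bit
  -- flips then produce the remaining matrix units.
  have hdiag : ∀ v : Fin p → Bool, Matrix.single v v (1 : ℂ) ∈ A := by
    intro v
    have h := hprod Finset.univ (fun k u => (1 / 2 : ℂ) * (1 + sgn (v k) * sgn (u k))) fun k => by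
      have : Matrix.diagonal (fun u : Fin p → Bool => (1 / 2 : ℂ) * (1 + sgn (v k) * sgn (u k))) =
          (1 / 2 : ℂ) • (1 + sgn (v k) • Matrix.diagonal (fun u : Fin p → Bool => sgn (u k))) := by
        rw [← Matrix.diagonal_one, ← Matrix.diagonal_smul, Matrix.diagonal_add,
          ← Matrix.diagonal_smul]
        rfl
      rw [this]
      exact A.smul_mem (A.add_mem A.one_mem (A.smul_mem (hZ k) _)) _
    convert h using 1
    rw [← Matrix.diagonal_single]
    congr 1
    ext u
    by_cases huv : u = v
    · subst huv
      simp
      norm_num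
    · obtain ⟨k, hk⟩ := Function.ne_iff.1 huv
      rw [Pi.single_eq_of_ne huv]
      symm
      refine Finset.prod_eq_zero (Finset.mem_univ k) ?_
      revert hk
      cases u k <;> cases v k <;> simp [sgn]
  have hflip : ∀ (s : Fin p) (u v : Fin p → Bool), Matrix.single u v (1 : ℂ) ∈ A →
      Matrix.single (flip s u) v (1 : ℂ) ∈ A := by
    intro s u v h
    convert A.mul_mem (hX s) h using 1
    ext a b
    rw [pauliX_mul_apply]
    simp only [Matrix.single_apply, eq_comm (b := a), eq_comm (b := flip s a), eq_flip_iff]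
  have hsingle : ∀ u v : Fin p → Bool, Matrix.single u v (1 : ℂ) ∈ A := by
    intro u v
    have h : ∀ s : Finset (Fin p),
        Matrix.single (fun k => if k ∈ s then u k else v k) v (1 : ℂ) ∈ A := by
      intro s
      induction s using Finset.induction_on with
      | empty => simpa using hdiag v
      | insert k s hk ih =>
        by_cases huv : u k = v k
        · convert ih using 2
          ext j
          by_cases hj : j = k
          · subst hj; simp [hk, huv]
          · simp [hj]
        · convert hflip k _ _ ih using 2
          ext j
          by_cases hj : j = k
          · subst hj
            rw [flip_same]
            simp only [Finset.mem_insert_self, if_true, hk, if_false]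
            revert huv
            cases u j <;> cases v j <;> simp
          · rw [flip_of_ne hj]; simp [hj]
    simpa using h Finset.univ
  rw [eq_top_iff]
  intro M _
  rw [Matrix.matrix_eq_sum_single M]
  refine A.sum_mem fun u _ => A.sum_mem fun v _ => ?_
  have := A.smul_mem (hsingle u v) (M u v)
  rwa [Matrix.smul_single, smul_eq_mul, mul_one] at this

end Fock


/-! ### The star homomorphism given by a second family of Majorana operators -/

lemma mem_span_words_of_mem_adjoin {A I : Type*} [Ring A] [Algebra ℂ A] (f : I → A) {x : A}
    (hx : x ∈ Algebra.adjoin ℂ (Set.range f)) :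
    x ∈ Submodule.span ℂ (Set.range fun l : List I => (l.map f).prod) := by
  have h : x ∈ (Algebra.adjoin ℂ (Set.range f)).toSubmodule := hx
  rw [Algebra.adjoin_eq_span] at h
  refine Submodule.span_mono ?_ h
  intro y hy
  induction hy using Submonoid.closure_induction with
  | mem y hy => obtain ⟨i, rfl⟩ := hy; exact ⟨[i], by simp⟩
  | one => exact ⟨[], by simp⟩
  | mul y z _ _ hy hz =>
    obtain ⟨l, rfl⟩ := hy
    obtain ⟨l', rfl⟩ := hz
    exact ⟨l ++ l', by simp⟩

section Representation

variable {p : ℕ} {κ : Type} [Fintype κ] [DecidableEq κ]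

/-- The algebra generated by the pairs of corresponding Majorana operators. -/
noncomputable def pairAlgebra (γ : Fin p × Bool → Op κ) : Subalgebra ℂ (Op (Fin p) × Op κ) :=
  Algebra.adjoin ℂ (Set.range fun c => (majorana (fun k => k) c, γ c))

variable {γ : Fin p × Bool → Op κ}

lemma trace_of_mem_pairAlgebra (hγ : IsMajoranaFamily γ) {x : Op (Fin p) × Op κ}
    (hx : x ∈ pairAlgebra γ) :
    (2 : ℂ) ^ Fintype.card κ * x.1.trace = 2 ^ p * x.2.trace := by
  have h := mem_span_words_of_mem_adjoin _ hx
  clear hx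
  induction h using Submodule.span_induction with
  | mem x h =>
    obtain ⟨l, rfl⟩ := h
    have := isMajoranaFamily_majorana.trace_prod_eq hγ l
    rw [Fintype.card_fin] at this
    dsimp only
    have e1 : (l.map fun c => (majorana (fun k => k) c, γ c)).prod.1 =
        (l.map fun c => majorana (fun k => k) c).prod := by
      clear this
      induction l with
      | nil => rfl
      | cons i l ih => rw [List.map_cons, List.map_cons, List.prod_cons, List.prod_cons, ← ih]; rfl
    have e2 : (l.map fun c => (majorana (fun k => k) c, γ c)).prod.2 = (l.map γ).prod := by
      clear this e1
      induction l with
      | nil => rfl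
      | cons i l ih => rw [List.map_cons, List.map_cons, List.prod_cons, List.prod_cons, ← ih]; rfl
    rw [e1, e2]
    exact this
  | zero => simp
  | add x y _ _ hx hy => simp only [Prod.fst_add, Prod.snd_add, Matrix.trace_add, mul_add, hx, hy]
  | smul z x _ hx =>
    simp only [Prod.smul_fst, Prod.smul_snd, Matrix.trace_smul, smul_eq_mul]
    linear_combination z * hx

lemma conjTranspose_mem_pairAlgebra (hH : ∀ c, (γ c)ᴴ = γ c) {x : Op (Fin p) × Op κ}
    (hx : x ∈ pairAlgebra γ) : (x.1ᴴ, x.2ᴴ) ∈ pairAlgebra γ := by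
  induction hx using Algebra.adjoin_induction with
  | mem x hx =>
    obtain ⟨c, rfl⟩ := hx
    simp only [majorana_conjTranspose, hH]
    exact Algebra.subset_adjoin ⟨c, rfl⟩
  | algebraMap z =>
    convert (pairAlgebra γ).smul_mem (pairAlgebra γ).one_mem (star z) using 1
    simp [Algebra.algebraMap_eq_smul_one, Prod.ext_iff]
  | add x y _ _ hx hy =>
    convert (pairAlgebra γ).add_mem hx hy using 1
    simp
  | mul x y _ _ hx hy =>
    convert (pairAlgebra γ).mul_mem hy hx using 1
    simp

/-- Compare the traces of the two components of $x^*x$: if the first component of $x$ vanishes, the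
second has Hilbert-Schmidt norm zero. Hermiticity of the family keeps $x^*$ in the algebra. -/
lemma snd_eq_zero_of_mem_pairAlgebra (hγ : IsMajoranaFamily γ) (hH : ∀ c, (γ c)ᴴ = γ c)
    {x : Op (Fin p) × Op κ} (hx : x ∈ pairAlgebra γ) (h0 : x.1 = 0) : x.2 = 0 := by
  have h := trace_of_mem_pairAlgebra hγ
    ((pairAlgebra γ).mul_mem (conjTranspose_mem_pairAlgebra hH hx) hx)
  simp only [Prod.fst_mul, Prod.snd_mul, h0, mul_zero, Matrix.trace_zero] at h
  have h' : (x.2ᴴ * x.2).trace = 0 := by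
    rcases mul_eq_zero.1 h.symm with h | h
    · exact absurd h (by positivity)
    · exact h
  exact Matrix.trace_conjTranspose_mul_self_eq_zero_iff.1 h'

/-- A star homomorphism that preserves normalized traces. -/
structure IsRepresentation (γ : Fin p × Bool → Op κ) (Φ : Op (Fin p) →ₐ[ℂ] Op κ) : Prop where
  map_majorana : ∀ c, Φ (majorana (fun k => k) c) = γ c
  map_conjTranspose : ∀ M, Φ Mᴴ = (Φ M)ᴴ
  trace_map : ∀ M, (2 : ℂ) ^ Fintype.card κ * M.trace = 2 ^ p * (Φ M).trace

/-- The pair algebra is the graph of the desired map. Its first projection is injective by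
faithfulness of the trace and surjective because the Majorana operators generate all matrices;
inverting it and projecting to the second component gives $\Phi$. -/
theorem exists_isRepresentation (hγ : IsMajoranaFamily γ) (hH : ∀ c, (γ c)ᴴ = γ c) :
    ∃ Φ : Op (Fin p) →ₐ[ℂ] Op κ, IsRepresentation γ Φ := by
  set π : pairAlgebra γ →ₐ[ℂ] Op (Fin p) := (AlgHom.fst ℂ _ _).comp (pairAlgebra γ).val with hπ
  have hinj : Function.Injective π := by
    rw [injective_iff_map_eq_zero]
    rintro ⟨x, hx⟩ h
    exact Subtype.ext (Prod.ext h (snd_eq_zero_of_mem_pairAlgebra hγ hH hx h))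
  have hsurj : Function.Surjective π := by
    rw [← AlgHom.range_eq_top, eq_top_iff, ← adjoin_majorana, Algebra.adjoin_le_iff]
    rintro _ ⟨c, rfl⟩
    exact ⟨⟨_, Algebra.subset_adjoin ⟨c, rfl⟩⟩, rfl⟩
  set e := AlgEquiv.ofBijective π ⟨hinj, hsurj⟩ with he
  set Φ : Op (Fin p) →ₐ[ℂ] Op κ :=
    ((AlgHom.snd ℂ _ _).comp (pairAlgebra γ).val).comp (e.symm : Op (Fin p) →ₐ[ℂ] pairAlgebra γ)
    with hΦ
  have hgraph : ∀ x : pairAlgebra γ, Φ x.1.1 = x.1.2 := by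
    intro x
    have : e.symm x.1.1 = x := e.symm_apply_eq.2 rfl
    change (e.symm x.1.1).1.2 = x.1.2
    rw [this]
  have hpair : ∀ M, ∃ x : pairAlgebra γ, x.1.1 = M := hsurj
  refine ⟨Φ, fun c => hgraph ⟨_, Algebra.subset_adjoin ⟨c, rfl⟩⟩, fun M => ?_, fun M => ?_⟩
  · obtain ⟨x, rfl⟩ := hpair M
    rw [hgraph, hgraph ⟨_, conjTranspose_mem_pairAlgebra hH x.2⟩]
  · obtain ⟨x, rfl⟩ := hpair M
    rw [hgraph]
    exact trace_of_mem_pairAlgebra hγ x.2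

end Representation

/-! ### Blocks of operators on a bipartite register -/

section Blocks

variable {α β : Type} [Fintype α] [DecidableEq α] [Fintype β] [DecidableEq β]

/-- The block of an operator between two configurations of the second register. -/
def blk (M : Op (α ⊕ β)) (x y : β → Bool) : Op α :=
  Matrix.of fun u v => M (Sum.elim u x) (Sum.elim v y)

lemma blk_apply (M : Op (α ⊕ β)) (x y : β → Bool) (u v : α → Bool) :
    blk M x y u v = M (Sum.elim u x) (Sum.elim v y) := rfl

lemma sum_sumElim {R : Type*} [AddCommMonoid R] (f : (α ⊕ β → Bool) → R) :
    ∑ w, f w = ∑ z : β → Bool, ∑ u : α → Bool, f (Sum.elim u z) := by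
  rw [← (Equiv.sumArrowEquivProdArrow α β Bool).symm.sum_comp, Fintype.sum_prod_type_right]
  rfl

lemma blk_mul (M M' : Op (α ⊕ β)) (x y : β → Bool) :
    blk (M * M') x y = ∑ z, blk M x z * blk M' z y := by
  ext u v
  rw [Matrix.sum_apply, blk_apply, Matrix.mul_apply, sum_sumElim]
  rfl

lemma blk_conjTranspose (M : Op (α ⊕ β)) (x y : β → Bool) : blk Mᴴ x y = (blk M y x)ᴴ := rfl

lemma blk_add (M M' : Op (α ⊕ β)) (x y : β → Bool) : blk (M + M') x y = blk M x y + blk M' x y :=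
  rfl

lemma blk_smul (z : ℂ) (M : Op (α ⊕ β)) (x y : β → Bool) : blk (z • M) x y = z • blk M x y :=
  rfl

lemma sumElim_inj {u v : α → Bool} {x y : β → Bool} :
    Sum.elim u x = Sum.elim v y ↔ u = v ∧ x = y := by
  refine ⟨fun h => ⟨funext fun i => congrFun h (.inl i), funext fun i => congrFun h (.inr i)⟩, ?_⟩
  rintro ⟨rfl, rfl⟩; rfl

lemma flip_inl (s : α) (u : α → Bool) (x : β → Bool) :
    flip (.inl s) (Sum.elim u x) = Sum.elim (flip s u) x :=
  Sum.update_elim_inl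

lemma flip_inr (s : β) (u : α → Bool) (x : β → Bool) :
    flip (.inr s) (Sum.elim u x) = Sum.elim u (flip s x) :=
  Sum.update_elim_inr

/-- `M` is `A ⊗ 1`. -/
def IsLeft (A : Op α) (M : Op (α ⊕ β)) : Prop := ∀ x y, blk M x y = if x = y then A else 0

/-- `M` is `1 ⊗ B`. -/
def IsRight (B : Op β) (M : Op (α ⊕ β)) : Prop := ∀ x y, blk M x y = B x y • 1

lemma IsLeft.mul {A A' : Op α} {M M' : Op (α ⊕ β)} (h : IsLeft A M) (h' : IsLeft A' M') :
    IsLeft (A * A') (M * M') := by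
  intro x y
  rw [blk_mul]
  simp only [h _ _, h' _ _, mul_ite, mul_zero, Finset.sum_ite_eq', Finset.mem_univ, if_true,
    ite_mul, zero_mul]

lemma IsLeft.smul {A : Op α} {M : Op (α ⊕ β)} (h : IsLeft A M) (z : ℂ) :
    IsLeft (z • A) (z • M) := by
  intro x y
  rw [blk_smul, h x y, smul_ite, smul_zero]

lemma isLeft_one : IsLeft (1 : Op α) (1 : Op (α ⊕ β)) := by
  intro x y
  ext u v
  rw [blk_apply, Matrix.one_apply]
  by_cases h : x = y <;> simp [sumElim_inj, h, Matrix.one_apply]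

lemma isLeft_diagonal (f : (α → Bool) → ℂ) :
    IsLeft (Matrix.diagonal f)
      (Matrix.diagonal fun w : α ⊕ β → Bool => f fun k => w (.inl k)) := by
  intro x y
  ext u v
  rw [blk_apply, Matrix.diagonal_apply]
  by_cases h : x = y <;> simp [sumElim_inj, h, Matrix.diagonal_apply]

lemma isLeft_pauli (s : α) (A : Axis) :
    IsLeft (pauli s A) (pauli (.inl s) A : Op (α ⊕ β)) := by
  have hX : IsLeft (pauliX s) (pauliX (.inl s) : Op (α ⊕ β)) := by
    intro x y
    ext u v
    rw [blk_apply, pauliX_apply, flip_inl]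
    by_cases h : x = y <;> simp [sumElim_inj, h, pauliX_apply]
  have hZ : IsLeft (pauliZ s) (pauliZ (.inl s) : Op (α ⊕ β)) := isLeft_diagonal _
  cases A
  · exact hX
  · exact (hX.mul hZ).smul _
  · exact hZ

lemma isLeft_wordProd (l : List (α × Axis)) :
    IsLeft (wordProd pauli l) (wordProd (fun s A => pauli (.inl s) A) l : Op (α ⊕ β)) := by
  induction l with
  | nil => exact isLeft_one
  | cons x l ih => rw [wordProd_cons, wordProd_cons]; exact (isLeft_pauli _ _).mul ih

lemma isLeft_majorana {p : ℕ} (c : Fin p × Bool) :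
    IsLeft (majorana (fun k => k) c) (majorana Sum.inl c : Op (Fin p ⊕ β)) :=
  (isLeft_diagonal fun u => ∏ k ∈ Finset.Iio c.1, if u k then (-1 : ℂ) else 1).mul
    (isLeft_pauli _ _)

lemma IsRight.mul {B B' : Op β} {M M' : Op (α ⊕ β)} (h : IsRight B M) (h' : IsRight B' M') :
    IsRight (B * B') (M * M') := by
  intro x y
  rw [blk_mul, Matrix.mul_apply, Finset.sum_smul]
  simp only [h _ _, h' _ _, smul_mul_smul_comm, mul_one]

lemma IsRight.smul {B : Op β} {M : Op (α ⊕ β)} (h : IsRight B M) (z : ℂ) :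
    IsRight (z • B) (z • M) := by
  intro x y
  rw [blk_smul, h x y, Matrix.smul_apply, smul_assoc]

lemma isRight_diagonal (f : (β → Bool) → ℂ) :
    IsRight (Matrix.diagonal f)
      (Matrix.diagonal fun w : α ⊕ β → Bool => f fun k => w (.inr k)) := by
  intro x y
  ext u v
  rw [blk_apply, Matrix.diagonal_apply]
  by_cases h : u = v <;> simp [sumElim_inj, h, Matrix.diagonal_apply]

lemma isRight_pauli (s : β) (A : Axis) :
    IsRight (pauli s A) (pauli (.inr s) A : Op (α ⊕ β)) := by
  have hX : IsRight (pauliX s) (pauliX (.inr s) : Op (α ⊕ β)) := by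
    intro x y
    ext u v
    rw [blk_apply, pauliX_apply, flip_inr]
    by_cases h : u = v <;> simp [sumElim_inj, h, pauliX_apply]
  have hZ : IsRight (pauliZ s) (pauliZ (.inr s) : Op (α ⊕ β)) := isRight_diagonal _
  cases A
  · exact hX
  · exact (hX.mul hZ).smul _
  · exact hZ

/-! ### Adding an idle ancilla qubit. -/

/-- `B'` is `B ⊗ 1`, the additional qubit having the number `1`. -/
def IsPadded {a : ℕ} (B : Op (Fin (a + 1))) (B' : Op (Fin (a + 2))) : Prop :=
  ∀ (s t : Bool) (x y : Fin (a + 1) → Bool),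
    B' (Fin.insertNth 1 s x) (Fin.insertNth 1 t y) = if s = t then B x y else 0

lemma sum_insertNth {R : Type*} [AddCommMonoid R] {a : ℕ} (f : (Fin (a + 2) → Bool) → R) :
    ∑ z, f z = ∑ s : Bool, ∑ x : Fin (a + 1) → Bool,
      f (Fin.insertNth (α := fun _ => Bool) 1 s x) := by
  rw [← (Fin.insertNthEquiv (fun _ : Fin (a + 2) => Bool) 1).sum_comp, Fintype.sum_prod_type]
  rfl

lemma insertNth_inj {a : ℕ} {s t : Bool} {x y : Fin (a + 1) → Bool} :
    (Fin.insertNth 1 s x : Fin (a + 2) → Bool) = Fin.insertNth 1 t y ↔ s = t ∧ x = y := by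
  rw [← Prod.mk.injEq]
  exact (Fin.insertNthEquiv (fun _ : Fin (a + 2) => Bool) 1).injective.eq_iff
    (a := (s, x)) (b := (t, y))

lemma IsPadded.mul {a : ℕ} {B C : Op (Fin (a + 1))} {B' C' : Op (Fin (a + 2))}
    (h : IsPadded B B') (h' : IsPadded C C') : IsPadded (B * C) (B' * C') := by
  intro s t x y
  rw [Matrix.mul_apply, sum_insertNth]
  simp only [h _ _, h' _ _, ite_mul, zero_mul, mul_ite, mul_zero]
  rw [Matrix.mul_apply]
  cases s <;> cases t <;> simp

lemma IsPadded.smul {a : ℕ} {B : Op (Fin (a + 1))} {B' : Op (Fin (a + 2))}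
    (h : IsPadded B B') (z : ℂ) : IsPadded (z • B) (z • B') := by
  intro s t x y
  rw [Matrix.smul_apply, h s t x y, smul_ite, smul_zero]; rfl

lemma flip_succAbove {a : ℕ} (k : Fin (a + 1)) (s : Bool) (x : Fin (a + 1) → Bool) :
    flip (Fin.succAbove 1 k) (Fin.insertNth 1 s x : Fin (a + 2) → Bool) =
      Fin.insertNth 1 s (flip k x) := by
  ext j
  rcases Fin.eq_self_or_eq_succAbove 1 j with rfl | ⟨j, rfl⟩
  · rw [flip_of_ne (Fin.succAbove_ne 1 k).symm]; simp
  · by_cases h : j = k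
    · subst h; simp
    · rw [flip_of_ne (fun e => h (Fin.succAbove_right_injective e))]
      simp [flip_of_ne h]

lemma isPadded_pauli {a : ℕ} (k : Fin (a + 1)) (A : Axis) :
    IsPadded (pauli k A) (pauli (Fin.succAbove 1 k) A : Op (Fin (a + 2))) := by
  have hX : IsPadded (pauliX k) (pauliX (Fin.succAbove 1 k) : Op (Fin (a + 2))) := by
    intro s t x y
    rw [pauliX_apply, flip_succAbove]
    by_cases h : s = t <;> simp [h, pauliX_apply]
  have hZ : IsPadded (pauliZ k) (pauliZ (Fin.succAbove 1 k) : Op (Fin (a + 2))) := by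
    intro s t x y
    rw [pauliZ, pauliZ, Matrix.diagonal_apply, Matrix.diagonal_apply]
    by_cases h : s = t <;> simp [h]
  cases A
  · exact hX
  · exact (hX.mul hZ).smul _
  · exact hZ

end Blocks

/-! ### Corresponding operators of the fermionic and the qubit verifier -/

section Sim

variable {p a : ℕ} {κ : Type} [Fintype κ] [DecidableEq κ]

/-- `M'` is the image of `M` under `Φ ⊗ 1`, padded with an additional ancilla qubit. -/
def Sim (Φ : Op (Fin p) →ₐ[ℂ] Op κ) (M : Op (Fin p ⊕ Fin (a + 1)))
    (M' : Op (κ ⊕ Fin (a + 2))) : Prop :=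
  ∀ (s t : Bool) (x y : Fin (a + 1) → Bool),
    blk M' (Fin.insertNth 1 s x) (Fin.insertNth 1 t y) = if s = t then Φ (blk M x y) else 0

variable {Φ : Op (Fin p) →ₐ[ℂ] Op κ} {M N : Op (Fin p ⊕ Fin (a + 1))}
  {M' N' : Op (κ ⊕ Fin (a + 2))}

/-- In the block product the intermediate value of the additional qubit must equal both outer
values, so only one copy of the original sum survives, and $\Phi$ is multiplicative on it. -/
lemma Sim.mul (h : Sim Φ M M') (h' : Sim Φ N N') : Sim Φ (M * N) (M' * N') := by
  intro s t x y
  rw [blk_mul, blk_mul, sum_insertNth, map_sum]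
  simp only [h _ _ _ _, h' _ _ _ _, ite_mul, zero_mul, mul_ite, mul_zero, map_mul]
  cases s <;> cases t <;> simp

lemma Sim.add (h : Sim Φ M M') (h' : Sim Φ N N') : Sim Φ (M + N) (M' + N') := by
  intro s t x y
  rw [blk_add, blk_add, h s t x y, h' s t x y, map_add]
  split_ifs <;> simp

lemma Sim.smul (h : Sim Φ M M') (z : ℂ) : Sim Φ (z • M) (z • M') := by
  intro s t x y
  rw [blk_smul, blk_smul, h s t x y, map_smul]
  split_ifs <;> simp

lemma Sim.conjTranspose (hΦ : ∀ M, Φ Mᴴ = (Φ M)ᴴ) (h : Sim Φ M M') : Sim Φ Mᴴ M'ᴴ := by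
  intro s t x y
  rw [blk_conjTranspose, blk_conjTranspose, h t s y x, hΦ]
  by_cases e : s = t
  · simp [e]
  · simp [e, Ne.symm e]

lemma IsLeft.sim {A : Op (Fin p)} (h : IsLeft A M) (h' : IsLeft (Φ A) M') : Sim Φ M M' := by
  intro s t x y
  rw [h, h']
  by_cases e : s = t <;> by_cases f : x = y <;> simp [e, f]

lemma IsRight.sim {B : Op (Fin (a + 1))} {B' : Op (Fin (a + 2))} (h : IsRight B M)
    (h' : IsRight B' M') (hB : IsPadded B B') : Sim Φ M M' := by
  intro s t x y
  rw [h, h', hB s t x y]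
  split_ifs <;> simp

lemma sim_one : Sim Φ (1 : Op (Fin p ⊕ Fin (a + 1))) 1 :=
  isLeft_one.sim (by rw [map_one]; exact isLeft_one)

lemma Sim.prod {I : Type*} {f : I → Op (Fin p ⊕ Fin (a + 1))} {g : I → Op (κ ⊕ Fin (a + 2))}
    {l : List I} (h : ∀ i ∈ l, Sim Φ (f i) (g i)) : Sim Φ (l.map f).prod (l.map g).prod := by
  induction l with
  | nil => exact sim_one
  | cons i l ih =>
    rw [List.map_cons, List.map_cons, List.prod_cons, List.prod_cons]
    exact (h i (by simp)).mul (ih fun j hj => h j (by simp [hj]))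

lemma Sim.rotation (h : Sim Φ M M') : Sim Φ (rotation M) (rotation M') :=
  (sim_one.smul _).add (h.smul _)

end Sim


/-! ### Compiling fermionic gates to qubit gates -/

section Compile

variable {p a : ℕ}

/-- The number of a Majorana operator. -/
def majIndex (c : Fin p × Bool) : ℕ := 2 * c.1 + c.2.toNat

lemma majIndex_lt (c : Fin p × Bool) : majIndex c < 2 * p := by
  have := c.1.2
  have := Bool.toNat_le c.2
  unfold majIndex; omega

lemma majIndex_injective : Function.Injective (majIndex (p := p)) := by
  rintro ⟨⟨j, hj⟩, b⟩ ⟨⟨k, hk⟩, b'⟩ h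
  cases b <;> cases b' <;> simp [majIndex] at h ⊢ <;> omega

/-- The place of a site of the proof or of an ancilla of the fermionic verifier. The qubit verifier
has an additional ancilla, with the number `1`. -/
def place {N : ℕ} : Fin N ⊕ Fin (a + 1) → Site N (a + 1) := Sum.map id (Fin.succAbove 1)

/-- The additional ancilla. -/
def work {N : ℕ} : Site N (a + 1) := .inr 1

lemma place_injective {N : ℕ} : Function.Injective (place (N := N) (a := a)) :=
  Sum.map_injective.2 ⟨Function.injective_id, Fin.succAbove_right_injective⟩

lemma work_ne_place {N : ℕ} (s : Fin N ⊕ Fin (a + 1)) : work ≠ place s := by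
  rcases s with s | s
  · simp [work, place]
  · simp [work, place]

/-- The letters on the proof of the word that represents a Majorana operator. -/
def majLetters (c : Fin p × Bool) : List ((Fin (2 * p) ⊕ Fin (a + 1)) × Axis) :=
  (path (majIndex c) (majIndex_lt c)).map fun x => (.inl x.1, x.2)

/-- The letters of a fermionic gate. -/
def FermionGate.letters (g : FermionGate p a) : List ((Fin (2 * p) ⊕ Fin (a + 1)) × Axis) :=
  g.maj.flatMap majLetters ++ g.word.letters.map fun x => (.inr x.1, x.2)

/-- A global phase. -/
def phaseGate (N a : ℕ) : QubitGate N a := ⟨⟨[], by simp, by simp⟩⟩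

/-- A rotation about a Pauli operator of one qubit. -/
def singleGate {N a : ℕ} (s : Site N a) (A : Axis) : QubitGate N a :=
  ⟨⟨[(s, A)], by simp, by simp⟩⟩

/-- A rotation about the product of `X` at the additional ancilla and a letter. -/
def coupledGate {N : ℕ} (x : (Fin N ⊕ Fin (a + 1)) × Axis) : QubitGate N (a + 1) :=
  ⟨⟨[(work, .X), (place x.1, x.2)], by simpa using work_ne_place x.1, by simp⟩⟩

/-- The circuit of a letter controlled by the additional ancilla. -/
def controlGates {N : ℕ} (x : (Fin N ⊕ Fin (a + 1)) × Axis) : List (QubitGate N (a + 1)) :=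
  List.replicate 2 (phaseGate N (a + 1)) ++ List.replicate 2 (singleGate work .X) ++
    List.replicate 14 (singleGate (place x.1) x.2) ++ List.replicate 14 (coupledGate x)

/-- The circuit for a fermionic gate. -/
def compileGate (g : FermionGate p a) : List (QubitGate (2 * p) (a + 1)) :=
  g.letters.flatMap controlGates ++
    singleGate work (if g.maj.length = 2 then .Y else .Z) :: g.letters.reverse.flatMap controlGates

lemma circuitOp_append (M : Model) (C C' : List (M.Gate p a)) :
    circuitOp M (C ++ C') = circuitOp M C' * circuitOp M C := by
  induction C with
  | nil => simp [circuitOp]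
  | cons g C ih => rw [List.cons_append, circuitOp, circuitOp, ih, mul_assoc]

lemma circuitOp_replicate (M : Model) (g : M.Gate p a) (n : ℕ) :
    circuitOp M (List.replicate n g) = M.op g ^ n := by
  induction n with
  | zero => simp [circuitOp]
  | succ n ih => rw [List.replicate_succ, circuitOp, ih, pow_succ]

/-- The unitary of a circuit of qubit gates. -/
noncomputable def qubitCircuitOp (C : List (QubitGate p a)) : Op (Site p a) :=
  circuitOp qubitModel C

lemma qubitCircuitOp_nil : qubitCircuitOp ([] : List (QubitGate p a)) = 1 := rfl

lemma qubitCircuitOp_append (C C' : List (QubitGate p a)) :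
    qubitCircuitOp (C ++ C') = qubitCircuitOp C' * qubitCircuitOp C :=
  circuitOp_append qubitModel C C'

lemma qubitCircuitOp_replicate (g : QubitGate p a) (n : ℕ) :
    qubitCircuitOp (List.replicate n g) = g.op ^ n :=
  circuitOp_replicate qubitModel g n

lemma op_phaseGate {N : ℕ} : (phaseGate N a).op = rotation 1 := rfl

lemma op_singleGate {N : ℕ} (s : Site N a) (A : Axis) :
    (singleGate s A).op = rotation (pauli s A) := by
  change rotation (pauli s A * 1) = _
  rw [mul_one]

lemma op_coupledGate {N : ℕ} (x : (Fin N ⊕ Fin (a + 1)) × Axis) :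
    (coupledGate x).op = rotation (pauli work .X * pauli (place x.1) x.2) := by
  change rotation (_ * (_ * 1)) = _
  rw [mul_one]

/-- The Pauli operators at the places of the fermionic verifier. -/
def placed (N a : ℕ) (s : Fin N ⊕ Fin (a + 1)) (A : Axis) : Op (Site N (a + 1)) :=
  pauli (place s) A

lemma isPauliFamily_placed (N a : ℕ) : IsPauliFamily (placed N a) :=
  isPauliFamily_pauli place_injective

lemma commute_work_wordProd {N : ℕ} (A : Axis) (l : List ((Fin N ⊕ Fin (a + 1)) × Axis)) :
    Commute (pauli work A) (wordProd (placed N a) l) :=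
  commute_wordProd fun x _ => pauli_comm (work_ne_place x.1) _ _

lemma qubitCircuitOp_controlGates {N : ℕ} (x : (Fin N ⊕ Fin (a + 1)) × Axis) :
    qubitCircuitOp (controlGates x) = controlled (pauli work .X) (placed N a x.1 x.2) := by
  simp only [controlGates, qubitCircuitOp_append, qubitCircuitOp_replicate, op_phaseGate,
    op_singleGate, op_coupledGate]
  exact rotations_eq_controlled (pauli_mul_self _ _) (pauli_mul_self _ _)
    (pauli_comm (work_ne_place x.1) _ _)

/-- The first gate of a circuit is the rightmost factor of its unitary, which reverses the word. -/
lemma qubitCircuitOp_flatMap_controlGates {N : ℕ}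
    (l : List ((Fin N ⊕ Fin (a + 1)) × Axis)) :
    qubitCircuitOp (l.flatMap controlGates) =
      controlled (pauli work .X) (wordProd (placed N a) l.reverse) := by
  induction l with
  | nil => simp [qubitCircuitOp_nil, controlled_one]
  | cons x l ih =>
    rw [List.flatMap_cons, qubitCircuitOp_append, ih, qubitCircuitOp_controlGates,
      controlled_mul (pauli_mul_self _ _) (commute_work_wordProd _ _), List.reverse_cons,
      wordProd_append, wordProd_cons, wordProd_nil, mul_one]

/-- The words that represent the Majorana operators. -/
def placedMaj (p a : ℕ) (c : Fin p × Bool) : Op (Site (2 * p) (a + 1)) :=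
  wordProd (fun s A => pauli (.inl s) A) (path (majIndex c) (majIndex_lt c))

lemma isMajoranaFamily_path {ι : Type} [Fintype ι] [DecidableEq ι] {f : Fin (2 * p) → ι}
    (hf : Function.Injective f) :
    IsMajoranaFamily fun c : Fin p × Bool =>
      wordProd (fun s A => pauli (f s) A) (path (majIndex c) (majIndex_lt c)) where
  sq _ := (isPauliFamily_pauli hf).path_sq _
  anti _ _ h := (isPauliFamily_pauli hf).path_anti _ _ (majIndex_injective.ne h)

lemma isMajoranaFamily_placedMaj : IsMajoranaFamily (placedMaj p a) :=
  isMajoranaFamily_path Sum.inl_injective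

lemma wordProd_majLetters (c : Fin p × Bool) :
    wordProd (placed (2 * p) a) (majLetters c) = placedMaj p a c := by
  simp [wordProd, majLetters, placedMaj, placed, place, Function.comp_def]

lemma wordProd_flatMap_majLetters (l : List (Fin p × Bool)) :
    wordProd (placed (2 * p) a) (l.flatMap majLetters) = (l.map (placedMaj p a)).prod := by
  induction l with
  | nil => rfl
  | cons c l ih =>
    rw [List.flatMap_cons, wordProd_append, ih, wordProd_majLetters, List.map_cons, List.prod_cons]

lemma majLetters_reverse_wordProd (c : Fin p × Bool) :
    wordProd (placed (2 * p) a) (majLetters c).reverse = placedMaj p a c := by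
  rw [(isPauliFamily_placed _ _).wordProd_reverse, wordProd_majLetters]
  rw [majLetters, List.map_map]
  have := (path_nodup (majIndex c) (majIndex_lt c)).map
    (Sum.inl_injective (α := Fin (2 * p)) (β := Fin (a + 1)))
  rwa [List.map_map] at this

lemma wordProd_flatMap_majLetters_reverse (l : List (Fin p × Bool)) :
    wordProd (placed (2 * p) a) (l.flatMap majLetters).reverse =
      (l.reverse.map (placedMaj p a)).prod := by
  induction l with
  | nil => rfl
  | cons c l ih =>
    rw [List.flatMap_cons, List.reverse_append, wordProd_append, ih, majLetters_reverse_wordProd,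
      List.reverse_cons, List.map_append, List.prod_append, List.map_singleton, List.prod_singleton]

/-- Reversing a word interchanges every pair of its letters once, each at the price of a sign. -/
lemma IsMajoranaFamily.prod_reverse {R I : Type*} [Ring R] [Algebra ℂ R] {c : I → R}
    (hc : IsMajoranaFamily c) {l : List I} (hl : l.Nodup) :
    (l.reverse.map c).prod = (-1 : ℂ) ^ (∑ i ∈ Finset.range l.length, i) • (l.map c).prod := by
  induction l with
  | nil => simp
  | cons i l ih =>
    rw [List.nodup_cons] at hl
    rw [List.reverse_cons, List.map_append, List.prod_append, ih hl.2, List.map_singleton,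
      List.prod_singleton, List.map_cons, List.prod_cons, hc.mul_prod_of_notMem hl.1,
      List.length_cons, Finset.sum_range_succ, smul_smul, pow_add, mul_assoc, ← pow_add,
      Even.neg_one_pow ⟨_, rfl⟩, mul_one, smul_mul_assoc]

/-- For zero, two and four letters the number of interchanges is 0, 1 and 6, so only the quadratic
words change sign. -/
lemma FermionGate.prod_reverse {R : Type*} [Ring R] [Algebra ℂ R] {c : Fin p × Bool → R}
    (hc : IsMajoranaFamily c) (g : FermionGate p a) :
    (g.maj.reverse.map c).prod = (if g.maj.length = 2 then -1 else 1) * (g.maj.map c).prod := by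
  rw [hc.prod_reverse g.nodup]
  have h1 := g.even
  have h2 := g.length_le
  generalize g.maj.length = n at h1 h2
  interval_cases n
  · simp
  · exact absurd h1 (by decide)
  · simp [Finset.sum_range_succ]
  · exact absurd h1 (by decide)
  · simp [Finset.sum_range_succ, Even.neg_one_pow (show Even 6 by decide)]

/-- The Pauli word of a fermionic gate on the proof and the ancilla qubits. -/
def FermionGate.placedWord (g : FermionGate p a) : Op (Site (2 * p) (a + 1)) :=
  wordProd (placed (2 * p) a) g.letters

lemma FermionGate.placedWord_eq (g : FermionGate p a) :
    g.placedWord = (g.maj.map (placedMaj p a)).prod *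
      (g.word.letters.map fun l => pauli (.inr (Fin.succAbove 1 l.1)) l.2).prod := by
  rw [placedWord, letters, wordProd_append, wordProd_flatMap_majLetters]
  simp [wordProd, placed, place, Function.comp_def]

/-- The reversed word is the inverse, so the sign tells whether the word squares to $1$ or to $-1$.
This decides the axis of the middle gate of the compiled circuit. -/
lemma FermionGate.wordProd_reverse (g : FermionGate p a) :
    wordProd (placed (2 * p) a) g.letters.reverse =
      (if g.maj.length = 2 then -1 else 1) * g.placedWord := by
  have h1 := g.prod_reverse (isMajoranaFamily_placedMaj (a := a))
  have hn : ((g.word.letters.map fun x => ((.inr x.1 : Fin (2 * p) ⊕ Fin (a + 1)), x.2)).map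
      Prod.fst).Nodup := by
    have := g.word.nodup.map (Sum.inr_injective (α := Fin (2 * p)) (β := Fin (a + 1)))
    rw [List.map_map] at this ⊢
    exact this
  rw [placedWord, letters, List.reverse_append, wordProd_append, wordProd_append,
    (isPauliFamily_placed _ _).wordProd_reverse hn, wordProd_flatMap_majLetters_reverse,
    wordProd_flatMap_majLetters, h1, ← mul_assoc]
  have hsign : ∀ M : Op (Site (2 * p) (a + 1)),
      Commute M (if g.maj.length = 2 then -1 else 1) := by
    intro M; split_ifs
    · exact (Commute.one_right M).neg_right
    · exact Commute.one_right M
  rw [(hsign _).eq, mul_assoc]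
  congr 1
  refine Commute.eq ?_
  rw [← wordProd_flatMap_majLetters]
  refine commute_wordProd fun x hx => (commute_wordProd fun y hy => ?_).symm
  refine (isPauliFamily_placed _ _).comm _ _ ?_ _ _
  obtain ⟨c, _, hx⟩ := List.mem_flatMap.1 hx
  obtain ⟨z, _, rfl⟩ := List.mem_map.1 hx
  obtain ⟨w, _, rfl⟩ := List.mem_map.1 hy
  simp

/-- The compiled circuit is the rotation about the represented operator, multiplied by `Z` at the
additional ancilla. -/
theorem qubitCircuitOp_compileGate (g : FermionGate p a) :
    qubitCircuitOp (compileGate g) =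
      rotation (pauli work .Z * ((if g.maj.length = 2 then Complex.I else 1) • g.placedWord)) := by
  have h0 : qubitCircuitOp (compileGate g) =
      qubitCircuitOp (g.letters.reverse.flatMap controlGates) *
        (singleGate work (if g.maj.length = 2 then .Y else .Z)).op *
          qubitCircuitOp (g.letters.flatMap controlGates) :=
    qubitCircuitOp_append (g.letters.flatMap controlGates) _
  have hM := (isPauliFamily_placed (2 * p) a).wordProd_mul_reverse g.letters
  have hX : pauli (work (a := a) (N := 2 * p)) .X * pauli work .X = 1 := pauli_mul_self _ _
  have hc : ∀ A, Commute (pauli work A) g.placedWord := fun A => commute_work_wordProd A _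
  rw [h0, qubitCircuitOp_flatMap_controlGates, qubitCircuitOp_flatMap_controlGates, List.reverse_reverse,
    op_singleGate, mul_assoc]
  rw [g.wordProd_reverse] at hM ⊢
  change g.placedWord * _ = 1 at hM
  change controlled _ g.placedWord * _ = _
  by_cases h : g.maj.length = 2
  -- A quadratic word squares to $-1$. With $Y$ as the middle axis, the product $XY=iZ$ supplies the
  -- factor $i$ that makes the generator Hermitian.
  · simp only [h, if_true, neg_mul, one_mul, mul_neg] at hM ⊢
    rw [controlled_rotation_anti hX (pauli_anti _ (by simp)) (hc _) (hc _)
      (by rw [← hM, neg_neg]), pauliX_mul_pauliY, mul_smul_comm, smul_mul_assoc]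
  · simp only [h, if_false, one_mul, one_smul] at hM ⊢
    rw [controlled_rotation hX (pauli_anti _ (by simp)) (hc _) (hc _) hM]

end Compile


/-! ### Acceptance probabilities -/

section Accept

variable {p a : ℕ}

lemma commute_rotation {ι : Type} [Fintype ι] [DecidableEq ι] {M P : Op ι} (h : Commute M P) :
    Commute M (rotation P) :=
  ((Commute.one_right _).smul_right _).add_right (h.smul_right _)

/-- The configuration of ancilla qubits that are all in the state `|0⟩`. -/
def zeros (a : ℕ) : Fin a → Bool := fun _ => false

lemma zeros_eq_insertNth (a : ℕ) :
    zeros (a + 2) = (Fin.insertNth 1 false (zeros (a + 1)) : Fin (a + 2) → Bool) := by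
  ext j
  rcases Fin.eq_self_or_eq_succAbove 1 j with rfl | ⟨j, rfl⟩ <;> simp [zeros]

lemma blk_withAncillas (ρ : Op (Fin p)) (x y : Fin (a + 1) → Bool) :
    blk (withAncillas ρ) x y = if x = zeros _ ∧ y = zeros _ then ρ else 0 := by
  ext u v
  simp only [blk_apply, withAncillas, Matrix.of_apply, Sum.elim_inr, Sum.elim_inl, zeros,
    funext_iff]
  split_ifs with h
  · exact if_pos h
  · exact if_neg h

lemma trace_eq_sum_blk {α β : Type} [Fintype α] [DecidableEq α] [Fintype β] [DecidableEq β]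
    (M : Op (α ⊕ β)) : M.trace = ∑ z, (blk M z z).trace := by
  rw [Matrix.trace, sum_sumElim]; rfl

lemma trace_withAncillas_mul (ρ : Op (Fin p)) (E : Op (Site p a)) :
    (withAncillas ρ * E).trace = (ρ * blk E (zeros _) (zeros _)).trace := by
  rw [trace_eq_sum_blk, Finset.sum_eq_single (zeros _)]
  · rw [blk_mul, Finset.sum_eq_single (zeros _)]
    · rw [blk_withAncillas, if_pos ⟨rfl, rfl⟩]
    · intro z _ hz
      rw [blk_withAncillas, if_neg (fun h => hz h.2), zero_mul]
    · simp
  · intro z _ hz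
    rw [blk_mul, Finset.sum_eq_zero, Matrix.trace_zero]
    intro y _
    rw [blk_withAncillas, if_neg (fun h => hz h.1), zero_mul]
  · simp

/-- The operator whose expectation is the acceptance probability. -/
def effect (U : Op (Site p a)) : Op (Fin p) :=
  blk (Uᴴ * (acceptProjector p a * U)) (zeros _) (zeros _)

/-- Cyclicity of the trace moves the circuit from the state to the measurement, and the ancillas
select the block at $|0\cdots0\rangle$. -/
lemma trace_accept (U : Op (Site p a)) (ρ : Op (Fin p)) :
    (acceptProjector p a * (U * withAncillas ρ * Uᴴ)).trace = (ρ * effect U).trace := by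
  rw [effect, ← trace_withAncillas_mul, Matrix.trace_mul_comm, mul_assoc, mul_assoc,
    Matrix.trace_mul_comm, mul_assoc, mul_assoc]

/-! ### The additional ancilla in the state $|0\rangle$. -/

/-- The projector on the state `|0⟩` of the additional ancilla. -/
def workProjector (N a : ℕ) : Op (Site N (a + 1)) :=
  Matrix.diagonal fun u => if u work = false then 1 else 0

lemma workProjector_eq (N a : ℕ) :
    workProjector N a = (1 / 2 : ℂ) • (1 + pauli work .Z) := by
  rw [workProjector, pauli, pauliZ, ← Matrix.diagonal_one, Matrix.diagonal_add,
    ← Matrix.diagonal_smul]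
  congr 1; ext u
  cases h : u work <;> simp [h]; norm_num

lemma workProjector_mul_withAncillas {N : ℕ} (ρ : Op (Fin N)) :
    workProjector N a * withAncillas ρ = withAncillas ρ := by
  ext u v
  rw [workProjector, Matrix.diagonal_mul, withAncillas, Matrix.of_apply]
  split_ifs with h1 h2 h2
  · rw [one_mul]
  · rw [mul_zero]
  · exact absurd (h2.1 1) h1
  · rw [mul_zero]

lemma withAncillas_mul_workProjector {N : ℕ} (ρ : Op (Fin N)) :
    withAncillas ρ * workProjector N a = withAncillas ρ := by
  ext u v
  rw [workProjector, Matrix.mul_diagonal, withAncillas, Matrix.of_apply]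
  split_ifs with h1 h2 h2
  · rw [mul_one]
  · exact absurd (h1.2 1) h2
  · rw [zero_mul]
  · rw [zero_mul]

lemma workProjector_conjTranspose (N a : ℕ) : (workProjector N a)ᴴ = workProjector N a := by
  rw [workProjector, Matrix.diagonal_conjTranspose]
  congr 1; ext u; simp only [Pi.star_apply]; split_ifs <;> simp

/-- The operator on qubits that represents the unitary of a fermionic gate. -/
noncomputable def FermionGate.lift (g : FermionGate p a) : Op (Site (2 * p) (a + 1)) :=
  rotation ((if g.maj.length = 2 then Complex.I else 1) • g.placedWord)

/-- The operator on qubits that represents the unitary of a fermionic circuit. -/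
noncomputable def liftOp : List (FermionGate p a) → Op (Site (2 * p) (a + 1))
  | [] => 1
  | g :: C => liftOp C * g.lift

/-- The qubit circuit for a fermionic circuit. -/
def compile (C : List (FermionGate p a)) : List (QubitGate (2 * p) (a + 1)) :=
  C.flatMap compileGate

lemma FermionGate.commute_placedWord (g : FermionGate p a) :
    Commute (workProjector (2 * p) a) g.placedWord := by
  rw [workProjector_eq]
  exact ((Commute.one_left _).add_left (commute_work_wordProd _ _)).smul_left _

/-- The factor $Z$ at the additional ancilla, the only difference between the two generators, acts
as $1$ on $|0\rangle$. -/
lemma FermionGate.compile_mul_workProjector (g : FermionGate p a) :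
    qubitCircuitOp (compileGate g) * workProjector (2 * p) a =
      workProjector (2 * p) a * g.lift := by
  have hZZ : pauli work .Z * workProjector (2 * p) a = workProjector (2 * p) a := by
    rw [workProjector_eq, mul_smul_comm, mul_add, mul_one, pauli_mul_self,
      add_comm (pauli work Axis.Z)]
  rw [qubitCircuitOp_compileGate, lift, rotation, rotation, mul_smul_comm, add_mul, mul_add,
    smul_mul_assoc, smul_mul_assoc, smul_mul_assoc, mul_smul_comm, mul_smul_comm, mul_smul_comm,
    one_mul, mul_one, mul_assoc, ← g.commute_placedWord.eq, ← mul_assoc, hZZ]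

/-- The lifted gates commute with the projector, so each compiled gate leaves the ancilla in
$|0\rangle$ and the next one can reuse it. -/
lemma compile_mul_workProjector (C : List (FermionGate p a)) :
    qubitCircuitOp (compile C) * workProjector (2 * p) a =
      liftOp C * workProjector (2 * p) a := by
  induction C with
  | nil => simp [compile, liftOp, qubitCircuitOp_nil]
  | cons g C ih =>
    have h : compile (g :: C) = compileGate g ++ compile C := rfl
    have hg : Commute (workProjector (2 * p) a) g.lift :=
      commute_rotation (g.commute_placedWord.smul_right _)
    rw [h, qubitCircuitOp_append, mul_assoc, g.compile_mul_workProjector, ← mul_assoc, ih, liftOp,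
      mul_assoc, hg.eq, mul_assoc]

/-- The words of Pauli operators on the proof that represent the Majorana operators. -/
def pathMaj (p : ℕ) (c : Fin p × Bool) : Op (Fin (2 * p)) :=
  wordProd pauli (path (majIndex c) (majIndex_lt c))

lemma isMajoranaFamily_pathMaj (p : ℕ) : IsMajoranaFamily (pathMaj p) :=
  isMajoranaFamily_path (f := fun k => k) fun _ _ h => h

lemma pathMaj_conjTranspose (c : Fin p × Bool) : (pathMaj p c)ᴴ = pathMaj p c := by
  have h := (isPauliFamily_pauli (f := fun k : Fin (2 * p) => k) fun _ _ h => h).wordProd_reverse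
    (path_nodup (majIndex c) (majIndex_lt c))
  exact (wordProd_conjTranspose (fun k => k) _).trans h

variable {Φ : Op (Fin p) →ₐ[ℂ] Op (Fin (2 * p))}

lemma FermionGate.sim (hΦ : IsRepresentation (pathMaj p) Φ) (g : FermionGate p a) :
    Sim Φ g.op g.lift := by
  rw [FermionGate.op, FermionGate.lift, g.placedWord_eq]
  refine (((Sim.prod fun c _ => ?_).mul (Sim.prod fun l _ => ?_)).smul _).rotation
  · refine (isLeft_majorana c).sim ?_
    rw [hΦ.map_majorana]
    exact isLeft_wordProd _
  · exact (isRight_pauli _ _).sim (isRight_pauli _ _) (isPadded_pauli _ _)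

lemma sim_liftOp (hΦ : IsRepresentation (pathMaj p) Φ) (C : List (FermionGate p a)) :
    Sim Φ (circuitOp fermionModel C) (liftOp C) := by
  induction C with
  | nil => exact sim_one
  | cons g C ih => exact ih.mul (g.sim hΦ)

lemma sim_acceptProjector : Sim Φ (acceptProjector p a) (acceptProjector (2 * p) (a + 1)) := by
  refine (isRight_diagonal fun x => if x 0 = false then 1 else 0).sim
    (isRight_diagonal fun x => if x 0 = false then 1 else 0) ?_
  intro s t x y
  simp only [Matrix.diagonal_apply, insertNth_inj]
  have : (Fin.insertNth 1 s x : Fin (a + 2) → Bool) 0 = x 0 := by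
    -- The new qubit is inserted at position 1, not 0, so that the measured ancilla keeps its
    -- number.
    have h : (0 : Fin (a + 2)) = Fin.succAbove 1 0 := by simp
    rw [h, Fin.insertNth_apply_succAbove]
  rw [this]
  by_cases h : s = t <;> simp [h]

/-- Two proofs with corresponding expectations are accepted with the same probability. -/
theorem circuitAccept_compile (hΦ : IsRepresentation (pathMaj p) Φ) (C : List (FermionGate p a))
    {ρ : Op (Fin p)} {ρ' : Op (Fin (2 * p))} (h : ∀ A, (ρ' * Φ A).trace = (ρ * A).trace) :
    circuitAccept qubitModel (compile C) ρ' = circuitAccept fermionModel C ρ := by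
  have hW : circuitOp qubitModel (compile C) * withAncillas ρ' *
        (circuitOp qubitModel (compile C))ᴴ =
      liftOp C * withAncillas ρ' * (liftOp C)ᴴ := by
    have h1 := compile_mul_workProjector C
    have h2 := congrArg Matrix.conjTranspose h1
    rw [Matrix.conjTranspose_mul, Matrix.conjTranspose_mul, workProjector_conjTranspose] at h2
    change qubitCircuitOp (compile C) * _ * (qubitCircuitOp (compile C))ᴴ = _
    have h3 : withAncillas ρ' = workProjector (2 * p) a * withAncillas ρ' *
        workProjector (2 * p) a := by
      rw [workProjector_mul_withAncillas, withAncillas_mul_workProjector]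
    rw [h3, ← mul_assoc, ← mul_assoc, h1, mul_assoc, h2, ← mul_assoc, ← mul_assoc, ← mul_assoc]
  -- Both effects are blocks of corresponding products; the configuration of all zeros includes the
  -- zero of the additional ancilla.
  have hE : effect (liftOp C) = Φ (effect (circuitOp fermionModel C)) := by
    have hS := sim_liftOp hΦ C
    have := ((hS.conjTranspose hΦ.map_conjTranspose).mul (sim_acceptProjector.mul hS)) false false
      (zeros _) (zeros _)
    rw [if_pos rfl, ← zeros_eq_insertNth] at this
    exact this
  unfold circuitAccept
  rw [hW, trace_accept, hE, h]
  exact congrArg _ (trace_accept _ _).symm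

/-! ### Translating proofs -/

open scoped MatrixOrder in
lemma exists_conjTranspose_mul_self {ι : Type} [Fintype ι] [DecidableEq ι] {ρ : Op ι}
    (h : ρ.PosSemidef) : ∃ B : Op ι, ρ = Bᴴ * B := by
  obtain ⟨B, hB⟩ := CStarAlgebra.nonneg_iff_eq_star_mul_self.1 h.nonneg
  exact ⟨B, hB⟩

/-- Every density matrix on Fock space is represented by a density matrix on qubits. -/
lemma exists_isDensity_of_isDensity (hΦ : IsRepresentation (pathMaj p) Φ) {ρ : Op (Fin p)}
    (hρ : IsDensity ρ) : ∃ ρ' : Op (Fin (2 * p)), IsDensity ρ' ∧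
      ∀ A, (ρ' * Φ A).trace = (ρ * A).trace := by
  -- On $2p$ qubits $\Phi$ multiplies traces by $2^{2p}/2^p$, which the scalar compensates.
  have h : ∀ A, (((2 : ℂ) ^ p)⁻¹ • Φ ρ * Φ A).trace = (ρ * A).trace := by
    intro A
    have h2 : (2 : ℂ) ^ (2 * p) = 2 ^ p * 2 ^ p := by rw [two_mul, pow_add]
    have h1 := hΦ.trace_map (ρ * A)
    rw [Fintype.card_fin, h2, mul_assoc] at h1
    have := mul_left_cancel₀ (by positivity) h1
    rw [smul_mul_assoc, Matrix.trace_smul, ← map_mul, ← this, smul_eq_mul, ← mul_assoc,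
      inv_mul_cancel₀ (by positivity), one_mul]
  refine ⟨((2 : ℂ) ^ p)⁻¹ • Φ ρ, ⟨?_, ?_⟩, h⟩
  · obtain ⟨B, rfl⟩ := exists_conjTranspose_mul_self hρ.1
    rw [map_mul, hΦ.map_conjTranspose]
    exact (Matrix.posSemidef_conjTranspose_mul_self _).smul (by positivity)
  · have := h 1
    rwa [map_one, mul_one, mul_one, hρ.2] at this

/-- Every density matrix on qubits induces one on Fock space. -/
lemma exists_isDensity_pullback (hΦ : IsRepresentation (pathMaj p) Φ) {ρ' : Op (Fin (2 * p))}
    (hρ : IsDensity ρ') : ∃ ρ : Op (Fin p), IsDensity ρ ∧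
      ∀ A, (ρ' * Φ A).trace = (ρ * A).trace := by
  -- The matrix that represents the functional $A\mapsto\operatorname{Tr}\rho'\Phi(A)$ under the
  -- trace pairing, read off on matrix units.
  set ρ : Op (Fin p) := Matrix.of fun x y => (ρ' * Φ (Matrix.single y x 1)).trace with hdef
  have h : ∀ A, (ρ' * Φ A).trace = (ρ * A).trace := by
    intro A
    induction A using Matrix.induction_on' with
    | h_zero => simp
    | h_add A B hA hB => rw [map_add, mul_add, mul_add, Matrix.trace_add, Matrix.trace_add, hA, hB]
    | h_std_basis x y z =>
      have : Matrix.single x y z = z • Matrix.single x y (1 : ℂ) := by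
        rw [Matrix.smul_single, smul_eq_mul, mul_one]
      rw [this, map_smul, mul_smul_comm, mul_smul_comm, Matrix.trace_smul, Matrix.trace_smul,
        Matrix.trace_mul_single, hdef]
      simp
  refine ⟨ρ, ⟨?_, ?_⟩, h⟩
  · refine .of_dotProduct_mulVec_nonneg ?_ fun z => ?_
    · ext x y
      rw [Matrix.conjTranspose_apply, hdef, Matrix.of_apply, Matrix.of_apply,
        ← Matrix.trace_conjTranspose, Matrix.conjTranspose_mul, ← hΦ.map_conjTranspose,
        hρ.1.1.eq, Matrix.trace_mul_comm]
      simp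
    -- With $B=|0\rangle\langle z|$ one has $|z\rangle\langle z|=B^*B$, so the expectation in $z$ is
    -- the trace of the positive operator $\Phi(B)\rho'\Phi(B)^*$. The basis state in $B$ is
    -- arbitrary.
    · set B : Op (Fin p) := Matrix.vecMulVec (Pi.single (fun _ => false) 1) (star z) with hB
      have hBB : Bᴴ * B = Matrix.vecMulVec z (star z) := by
        ext x y
        simp [hB, Matrix.mul_apply, Matrix.vecMulVec_apply, Pi.single_apply]
      have h1 : star z ⬝ᵥ ρ *ᵥ z = (Φ B * ρ' * (Φ B)ᴴ).trace := by
        rw [Matrix.trace_mul_comm, ← mul_assoc, ← hΦ.map_conjTranspose, ← map_mul, hBB,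
          Matrix.trace_mul_comm, h, Matrix.mul_vecMulVec, Matrix.trace_vecMulVec,
          dotProduct_comm]
      rw [h1]
      exact (hρ.1.mul_mul_conjTranspose_same _).trace_nonneg
  · have := h 1
    rwa [map_one, mul_one, mul_one, hρ.2, eq_comm] at this

/-! ### Parity -/

section Parity

variable {ι : Type} [Fintype ι] [DecidableEq ι]

/-- The parity of the number of fermions in the modes that are stored in the sites `e k`. -/
def parity (e : Fin p → ι) : Op ι := Matrix.diagonal fun u => ∏ k, sgn (u (e k))

lemma parity_mul_self (e : Fin p → ι) : parity e * parity e = 1 := by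
  rw [parity, Matrix.diagonal_mul_diagonal, ← Matrix.diagonal_one]
  congr 1; ext u
  rw [← Finset.prod_mul_distrib]; simp

lemma parity_conjTranspose (e : Fin p → ι) : (parity e)ᴴ = parity e := by
  have hs : ∀ b, star (sgn b) = sgn b := fun b => by cases b <;> simp [sgn]
  rw [parity, Matrix.diagonal_conjTranspose]
  congr 1; ext u
  simp only [Pi.star_apply, star_prod, hs]

lemma parity_commute_diagonal (e : Fin p → ι) (f : (ι → Bool) → ℂ) :
    Commute (parity e) (Matrix.diagonal f) := by
  rw [Commute, SemiconjBy, parity, Matrix.diagonal_mul_diagonal, Matrix.diagonal_mul_diagonal]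
  simp only [mul_comm]

/-- A Majorana operator flips exactly one occupation number. -/
lemma parity_anti_majorana {e : Fin p → ι} (he : Function.Injective e) (c : Fin p × Bool) :
    Anti (parity e) (majorana e c) := by
  have hX : Anti (parity e) (pauliX (e c.1)) := by
    unfold Anti parity
    rw [diagonal_mul_pauliX, ← mul_neg, Matrix.diagonal_neg]
    congr 2; ext u
    rw [← Finset.mul_prod_erase _ _ (Finset.mem_univ c.1),
      ← Finset.mul_prod_erase _ (fun k => sgn (u (e k))) (Finset.mem_univ c.1), flip_same, sgn_not,
      neg_mul]
    congr 2
    refine Finset.prod_congr rfl fun k hk => ?_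
    rw [flip_of_ne (he.ne (Finset.ne_of_mem_erase hk))]
  refine Anti.mul_commute_right ?_ (parity_commute_diagonal e _).symm
  split_ifs
  · refine Anti.symm (Anti.smul_left ?_ _)
    have hZ : Commute (pauliZ (e c.1)) (parity e) := (parity_commute_diagonal e _).symm
    unfold Anti at hX ⊢
    rw [mul_assoc, hZ.eq, ← mul_assoc, ← mul_assoc, hX, neg_mul, neg_neg]
  · exact hX

lemma parity_mul_prod {e : Fin p → ι} (he : Function.Injective e) (l : List (Fin p × Bool)) :
    parity e * (l.map (majorana e)).prod =
      (-1 : ℂ) ^ l.length • ((l.map (majorana e)).prod * parity e) := by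
  induction l with
  | nil => simp
  | cons c l ih =>
    have := parity_anti_majorana he c
    unfold Anti at this
    rw [List.map_cons, List.prod_cons, ← mul_assoc, this, neg_mul, mul_assoc, ih,
      List.length_cons, pow_succ, mul_smul_comm, mul_assoc]
    simp

lemma parity_commute_pauli {e : Fin p → ι} {s : ι} (hs : ∀ k, e k ≠ s) (A : Axis) :
    Commute (parity e) (pauli s A) := by
  have hX : Commute (parity e) (pauliX s) := by
    rw [Commute, SemiconjBy, parity, diagonal_mul_pauliX]
    simp only [flip_of_ne (hs _)]
  have hZ : Commute (parity e) (pauliZ s) := parity_commute_diagonal e _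
  cases A
  · exact hX
  · exact (hX.mul_right hZ).smul_right _
  · exact hZ

end Parity

/-! ### Parity conservation and even parts. -/

lemma FermionGate.commute_parity (g : FermionGate p a) :
    Commute (parity (Sum.inl : Fin p → Site p a)) g.op := by
  refine commute_rotation (Commute.smul_right (Commute.mul_right ?_ ?_) _)
  · rw [Commute, SemiconjBy, parity_mul_prod Sum.inl_injective, g.even.neg_one_pow, one_smul]
  · have h : ∀ x ∈ g.word.letters, Commute (parity (Sum.inl : Fin p → Site p a))
        (pauli (Sum.inr x.1) x.2) := fun x _ => parity_commute_pauli (fun k => Sum.inl_ne_inr) _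
    exact commute_wordProd (σ := fun s A => (pauli (Sum.inr s) A : Op (Site p a))) h

lemma commute_parity_circuitOp (C : List (FermionGate p a)) :
    Commute (parity (Sum.inl : Fin p → Site p a)) (circuitOp fermionModel C) := by
  induction C with
  | nil => exact Commute.one_right _
  | cons g C ih => exact ih.mul_right g.commute_parity

/-- The even part of an operator. -/
noncomputable def evenPart (ρ : Op (Fin p)) : Op (Fin p) :=
  (1 / 2 : ℂ) • (ρ + parity (fun k => k) * ρ * parity (fun k => k))

lemma withAncillas_parity (ρ : Op (Fin p)) :
    (withAncillas (parity (fun k => k) * ρ * parity (fun k => k)) : Op (Site p a)) =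
      parity Sum.inl * withAncillas ρ * parity Sum.inl := by
  ext u v
  simp only [parity, Matrix.mul_diagonal, Matrix.diagonal_mul, withAncillas, Matrix.of_apply]
  split_ifs <;> simp

/-- Parity commutes with the circuit and with the measurement of an ancilla, so a proof and its
conjugate by parity are accepted equally often; the even part is their average. -/
lemma circuitAccept_evenPart (C : List (FermionGate p a)) (ρ : Op (Fin p)) :
    circuitAccept fermionModel C (evenPart ρ) = circuitAccept fermionModel C ρ := by
  have h : (parity (fun k => k) * ρ * parity (fun k => k) *
      effect (circuitOp fermionModel C)).trace = (ρ * effect (circuitOp fermionModel C)).trace := by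
    have hC := commute_parity_circuitOp C
    have hA := parity_commute_diagonal (Sum.inl : Fin p → Site p a)
      fun u => if u (.inr 0) = false then 1 else 0
    have hP := parity_mul_self (Sum.inl : Fin p → Site p a)
    have hC' := congrArg Matrix.conjTranspose hC.eq
    rw [Matrix.conjTranspose_mul, Matrix.conjTranspose_mul, parity_conjTranspose] at hC'
    change Commute _ (acceptProjector p a) at hA
    rw [← trace_accept, ← trace_accept, withAncillas_parity]
    generalize (withAncillas ρ : Op (Site p a)) = W
    generalize circuitOp fermionModel C = U at *
    have e : acceptProjector p a * (U * (parity Sum.inl * W * parity Sum.inl) * Uᴴ) =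
        parity Sum.inl * (acceptProjector p a * (U * W * Uᴴ) * parity Sum.inl) := by
      calc _ = acceptProjector p a * (U * parity Sum.inl * W * (parity Sum.inl * Uᴴ)) := by
            simp only [mul_assoc]
        _ = acceptProjector p a * (parity Sum.inl * U * W * (Uᴴ * parity Sum.inl)) := by
            rw [← hC.eq, hC']
        _ = acceptProjector p a * parity Sum.inl * (U * W * Uᴴ * parity Sum.inl) := by
            simp only [mul_assoc]
        _ = _ := by rw [← hA.eq]; simp only [mul_assoc]
    rw [e, Matrix.trace_mul_comm, mul_assoc, hP, mul_one]
  unfold circuitAccept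
  rw [trace_accept, trace_accept, evenPart, smul_mul_assoc, add_mul, Matrix.trace_smul,
    Matrix.trace_add, h, ← two_mul, smul_eq_mul, ← mul_assoc]
  norm_num

/-- Every operator is a combination of Majorana words. Conjugation by parity fixes the even ones and
negates the odd ones, so averaging removes the latter; it also preserves positivity and trace. -/
lemma isFermionicState_evenPart {ρ : Op (Fin p)} (hρ : IsDensity ρ) :
    IsFermionicState (evenPart ρ) := by
  refine ⟨⟨?_, ?_⟩, ?_⟩
  · have h := hρ.1.mul_mul_conjTranspose_same (parity fun k : Fin p => k)
    rw [parity_conjTranspose] at h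
    exact (hρ.1.add h).smul (by positivity)
  · rw [evenPart, Matrix.trace_smul, Matrix.trace_add, Matrix.trace_mul_comm (parity _ * ρ),
      ← mul_assoc, parity_mul_self, one_mul, hρ.2]
    norm_num
  · have h : ρ ∈ Algebra.adjoin ℂ (Set.range fun c : Fin p × Bool => majorana (fun k => k) c) := by
      rw [adjoin_majorana]; trivial
    have h' := mem_span_words_of_mem_adjoin _ h
    clear hρ h
    induction h' using Submodule.span_induction with
    | mem x h =>
      obtain ⟨l, rfl⟩ := h
      dsimp only
      have hl := parity_mul_prod (e := fun k : Fin p => k) (fun _ _ h => h) l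
      change evenPart (l.map (majorana fun k => k)).prod ∈ _
      rw [evenPart, hl, smul_mul_assoc, mul_assoc, parity_mul_self, mul_one]
      rcases Nat.even_or_odd l.length with he | ho
      · rw [he.neg_one_pow, one_smul]
        have : (l.map (majorana fun k : Fin p => k)).prod ∈ Submodule.span ℂ
            {M : Op (Fin p) | ∃ l : List (Fin p × Bool),
              Even l.length ∧ M = (l.map (majorana (fun k => k))).prod} :=
          Submodule.subset_span ⟨l, he, rfl⟩
        exact Submodule.smul_mem _ _ (Submodule.add_mem _ this this)
      · rw [ho.neg_one_pow, neg_smul, one_smul, add_neg_cancel, smul_zero]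
        exact Submodule.zero_mem _
    | zero => simp [evenPart]
    | add x y _ _ hx hy =>
      have : evenPart (x + y) = evenPart x + evenPart y := by
        simp only [evenPart, mul_add, add_mul]; module
      rw [this]
      exact Submodule.add_mem _ hx hy
    | smul z x _ hx =>
      have : evenPart (z • x) = z • evenPart x := by
        simp only [evenPart, mul_smul_comm, smul_mul_assoc]; module
      rw [this]
      exact Submodule.smul_mem _ _ hx

/-- Qubit proofs for the compiled circuits are as good as fermionic proofs. -/
theorem exists_qubit_proof {ρ : Op (Fin p)} (hρ : IsFermionicState ρ) :
    ∃ ρ' : Op (Fin (2 * p)), IsDensity ρ' ∧ ∀ (a : ℕ) (C : List (FermionGate p a)),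
      circuitAccept qubitModel (compile C) ρ' = circuitAccept fermionModel C ρ := by
  obtain ⟨Φ, hΦ⟩ := exists_isRepresentation (isMajoranaFamily_pathMaj p) pathMaj_conjTranspose
  obtain ⟨ρ', hρ', h⟩ := exists_isDensity_of_isDensity hΦ hρ.1
  exact ⟨ρ', hρ', fun a C => circuitAccept_compile hΦ C h⟩

/-- Fermionic proofs are as good as qubit proofs for the compiled circuits. -/
theorem exists_fermionic_proof {ρ' : Op (Fin (2 * p))} (hρ : IsDensity ρ') :
    ∃ ρ : Op (Fin p), IsFermionicState ρ ∧ ∀ (a : ℕ) (C : List (FermionGate p a)),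
      circuitAccept qubitModel (compile C) ρ' = circuitAccept fermionModel C ρ := by
  obtain ⟨Φ, hΦ⟩ := exists_isRepresentation (isMajoranaFamily_pathMaj p) pathMaj_conjTranspose
  obtain ⟨ρ, hρ, h⟩ := exists_isDensity_pullback hΦ hρ
  exact ⟨evenPart ρ, isFermionicState_evenPart hρ, fun a C => by
    rw [circuitAccept_evenPart, circuitAccept_compile hΦ C h]⟩

end Accept


/-! ### Running stack programs -/

/-- The program `P` takes `s` to `s'` in at most `T` steps. -/
def Runs (P : Prog) (s : Store) (T : ℕ) (s' : Store) : Prop := ∃ t ≤ T, Exec P s t s'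

lemma Runs.mono {P : Prog} {s s' : Store} {T U : ℕ} (h : Runs P s T s') (hTU : T ≤ U) :
    Runs P s U s' := by
  obtain ⟨t, ht, h⟩ := h
  exact ⟨t, ht.trans hTU, h⟩

lemma Runs.seq {P Q : Prog} {s s' s'' : Store} {T U : ℕ} (h : Runs P s T s')
    (h' : Runs Q s' U s'') : Runs (.seq P Q) s (T + U) s'' := by
  obtain ⟨t, ht, h⟩ := h
  obtain ⟨u, hu, h'⟩ := h'
  exact ⟨t + u, add_le_add ht hu, .seq h h'⟩

lemma Runs.ite_true {c : Test} {P Q : Prog} {s s' : Store} {T : ℕ} (hc : c.Holds s)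
    (h : Runs P s T s') : Runs (.ite c P Q) s (T + 1) s' := by
  obtain ⟨t, ht, h⟩ := h
  exact ⟨t + 1, add_le_add ht le_rfl, .ite_true hc h⟩

lemma Runs.ite_false {c : Test} {P Q : Prog} {s s' : Store} {T : ℕ} (hc : ¬ c.Holds s)
    (h : Runs Q s T s') : Runs (.ite c P Q) s (T + 1) s' := by
  obtain ⟨t, ht, h⟩ := h
  exact ⟨t + 1, add_le_add ht le_rfl, .ite_false hc h⟩

lemma Runs.loop_done {c : Test} {P : Prog} {s : Store} (hc : ¬ c.Holds s) :
    Runs (.loop c P) s 1 s := ⟨1, le_rfl, .loop_done hc⟩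

lemma Runs.loop_step {c : Test} {P : Prog} {s s' s'' : Store} {T U : ℕ} (hc : c.Holds s)
    (h : Runs P s T s') (h' : Runs (.loop c P) s' U s'') :
    Runs (.loop c P) s (T + U + 1) s'' := by
  obtain ⟨t, ht, h⟩ := h
  obtain ⟨u, hu, h'⟩ := h'
  exact ⟨t + u + 1, by omega, .loop_step hc h h'⟩

/-- The effect of a list of instructions. -/
def run (l : List Instr) (s : Store) : Store := l.foldl (fun s i => i.apply s) s

@[simp] lemma run_nil (s : Store) : run [] s = s := rfl

@[simp] lemma run_cons (i : Instr) (l : List Instr) (s : Store) :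
    run (i :: l) s = run l (i.apply s) := rfl

lemma run_append (l l' : List Instr) (s : Store) : run (l ++ l') s = run l' (run l s) :=
  List.foldl_append

/-- The program that executes a list of instructions. It ends with a `pop` from a stack that is
always empty. -/
def block : List Instr → Prog
  | [] => .instr (.pop 9)
  | i :: l => .seq (.instr i) (block l)

/-- The memory with the given contents of the first nine stacks. -/
def st (a b c d e f g h i : List ℕ) : Store := fun n => [a, b, c, d, e, f, g, h, i].getD n []

section Store

variable (a b c d e f g h i x : List ℕ)

lemma update_st (n : ℕ) (s t : Store) (h : t n = x) (h' : ∀ m ≠ n, s m = t m) :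
    Function.update s n x = t := by
  ext1 m
  by_cases hm : m = n
  · subst hm; rw [Function.update_self, h]
  · rw [Function.update_of_ne hm, h' m hm]

@[simp] lemma update_st_zero :
    Function.update (st a b c d e f g h i) 0 x = st x b c d e f g h i :=
  update_st _ _ _ _ rfl fun m hm => by
    rcases m with _ | _ | _ | _ | _ | _ | _ | _ | _ | m <;> first | rfl | exact absurd rfl hm

@[simp] lemma update_st_one :
    Function.update (st a b c d e f g h i) 1 x = st a x c d e f g h i :=
  update_st _ _ _ _ rfl fun m hm => by
    rcases m with _ | _ | _ | _ | _ | _ | _ | _ | _ | m <;> first | rfl | exact absurd rfl hm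

@[simp] lemma update_st_two :
    Function.update (st a b c d e f g h i) 2 x = st a b x d e f g h i :=
  update_st _ _ _ _ rfl fun m hm => by
    rcases m with _ | _ | _ | _ | _ | _ | _ | _ | _ | m <;> first | rfl | exact absurd rfl hm

@[simp] lemma update_st_three :
    Function.update (st a b c d e f g h i) 3 x = st a b c x e f g h i :=
  update_st _ _ _ _ rfl fun m hm => by
    rcases m with _ | _ | _ | _ | _ | _ | _ | _ | _ | m <;> first | rfl | exact absurd rfl hm

@[simp] lemma update_st_four :
    Function.update (st a b c d e f g h i) 4 x = st a b c d x f g h i :=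
  update_st _ _ _ _ rfl fun m hm => by
    rcases m with _ | _ | _ | _ | _ | _ | _ | _ | _ | m <;> first | rfl | exact absurd rfl hm

@[simp] lemma update_st_five :
    Function.update (st a b c d e f g h i) 5 x = st a b c d e x g h i :=
  update_st _ _ _ _ rfl fun m hm => by
    rcases m with _ | _ | _ | _ | _ | _ | _ | _ | _ | m <;> first | rfl | exact absurd rfl hm

@[simp] lemma update_st_six :
    Function.update (st a b c d e f g h i) 6 x = st a b c d e f x h i :=
  update_st _ _ _ _ rfl fun m hm => by
    rcases m with _ | _ | _ | _ | _ | _ | _ | _ | _ | m <;> first | rfl | exact absurd rfl hm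

@[simp] lemma update_st_seven :
    Function.update (st a b c d e f g h i) 7 x = st a b c d e f g x i :=
  update_st _ _ _ _ rfl fun m hm => by
    rcases m with _ | _ | _ | _ | _ | _ | _ | _ | _ | m <;> first | rfl | exact absurd rfl hm

@[simp] lemma update_st_eight :
    Function.update (st a b c d e f g h i) 8 x = st a b c d e f g h x :=
  update_st _ _ _ _ rfl fun m hm => by
    rcases m with _ | _ | _ | _ | _ | _ | _ | _ | _ | m <;> first | rfl | exact absurd rfl hm

@[simp] lemma update_st_nine : Function.update (st a b c d e f g h i) 9 [] = st a b c d e f g h i :=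
  update_st _ _ _ _ rfl fun _ _ => rfl

@[simp] lemma st_zero : st a b c d e f g h i 0 = a := rfl
@[simp] lemma st_one : st a b c d e f g h i 1 = b := rfl
@[simp] lemma st_two : st a b c d e f g h i 2 = c := rfl
@[simp] lemma st_three : st a b c d e f g h i 3 = d := rfl
@[simp] lemma st_four : st a b c d e f g h i 4 = e := rfl
@[simp] lemma st_five : st a b c d e f g h i 5 = f := rfl
@[simp] lemma st_six : st a b c d e f g h i 6 = g := rfl
@[simp] lemma st_seven : st a b c d e f g h i 7 = h := rfl
@[simp] lemma st_eight : st a b c d e f g h i 8 = i := rfl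
@[simp] lemma st_nine : st a b c d e f g h i 9 = [] := rfl

lemma runs_block {a b c d e f g h i : List ℕ} (l : List Instr) {l1 l2 l3 l4 l5 l6 l7 l8 l9 : List ℕ}
    (hl : run l (st a b c d e f g h i) = st l1 l2 l3 l4 l5 l6 l7 l8 l9) :
    Runs (block l) (st a b c d e f g h i) (l.length + 1) (st l1 l2 l3 l4 l5 l6 l7 l8 l9) := by
  have key : ∀ (l : List Instr) (s : Store), Exec (block l) s (l.length + 1)
      ((Instr.pop 9).apply (run l s)) := by
    intro l
    induction l with
    | nil => exact fun s => .instr _ _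
    | cons j l ih =>
      intro s
      have := Exec.seq (.instr j s) (ih (j.apply s))
      rw [add_comm 1] at this
      exact this
  refine ⟨_, le_rfl, ?_⟩
  have := key l (st a b c d e f g h i)
  rw [hl] at this
  simpa [Instr.apply] using this

end Store

lemma holds_pos {k v : ℕ} {l : List ℕ} {s : Store} (h : s k = (v + 1) :: l) :
    (Test.pos k).Holds s := ⟨v, l, h⟩

lemma not_holds_pos {k : ℕ} {l : List ℕ} {s : Store} (h : s k = 0 :: l) :
    ¬ (Test.pos k).Holds s := by
  rintro ⟨v, l', h'⟩
  rw [h] at h'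
  simp at h'

lemma holds_nonempty {k v : ℕ} {l : List ℕ} {s : Store} (h : s k = v :: l) :
    (Test.nonempty k).Holds s := by
  intro h'
  rw [h] at h'
  simp at h'

lemma not_holds_nonempty {k : ℕ} {s : Store} (h : s k = []) : ¬ (Test.nonempty k).Holds s :=
  fun h' => h' h

/-! ### The program that compiles circuits -/

/-- Append a number to the output. -/
def emitLit (n : ℕ) : List Instr := .push 1 :: List.replicate n (.succ 1)

/-- Append the letter in the stacks `3`, `4` and `5` to the output. -/
def emitLetter : List Instr := [.copy 3 1, .copy 4 1, .copy 5 1]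

/-- Append a letter at the additional ancilla to the output. -/
def emitWork (n : ℕ) : List Instr := emitLit 1 ++ emitLit 1 ++ emitLit n

/-- Append the code of the controlled letter to the output. -/
def emitControl : List Instr :=
  (List.replicate 2 (emitLit 0)).flatten ++
    (List.replicate 2 (emitLit 1 ++ emitWork 0)).flatten ++
    (List.replicate 14 (emitLit 1 ++ emitLetter)).flatten ++
    (List.replicate 14 (emitLit 2 ++ emitWork 0 ++ emitLetter)).flatten

/-- The code of a controlled letter, given by the kind and the number of its site and its axis. -/
def controlCode (y : ℕ × ℕ × ℕ) : List ℕ :=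
  (List.replicate 2 [0]).flatten ++ (List.replicate 2 [1, 1, 1, 0]).flatten ++
    (List.replicate 14 [1, y.1, y.2.1, y.2.2]).flatten ++
    (List.replicate 14 [2, 1, 1, 0, y.1, y.2.1, y.2.2]).flatten

/-- Running `l` appends `w` to the output. -/
def Emits (y : ℕ × ℕ × ℕ) (l : List Instr) (w : List ℕ) : Prop :=
  ∀ a b c g h i, run l (st a b c [y.1] [y.2.1] [y.2.2] g h i) =
    st a (w.reverse ++ b) c [y.1] [y.2.1] [y.2.2] g h i

lemma Emits.append {y : ℕ × ℕ × ℕ} {l l' : List Instr} {w w' : List ℕ} (h : Emits y l w)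
    (h' : Emits y l' w') : Emits y (l ++ l') (w ++ w') := by
  intro a b c _ _ _
  rw [run_append, h, h', List.reverse_append, List.append_assoc]

lemma Emits.replicate {y : ℕ × ℕ × ℕ} {l : List Instr} {w : List ℕ} (h : Emits y l w) (n : ℕ) :
    Emits y (List.replicate n l).flatten (List.replicate n w).flatten := by
  induction n with
  | zero => intro a b c _ _ _; simp
  | succ n ih => rw [List.replicate_succ, List.replicate_succ]; exact h.append ih

lemma run_emitLit (n : ℕ) (a b c d e f g h i : List ℕ) :
    run (emitLit n) (st a b c d e f g h i) = st a (n :: b) c d e f g h i := by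
  have key : ∀ n m, run (List.replicate n (.succ 1)) (st a (m :: b) c d e f g h i) =
      st a ((m + n) :: b) c d e f g h i := by
    intro n
    induction n with
    | zero => simp
    | succ n ih =>
      intro m
      rw [List.replicate_succ, run_cons]
      simp only [Instr.apply, st_one, List.modifyHead_cons, update_st_one, ih]
      rw [add_assoc, add_comm 1]
  simp [emitLit, Instr.apply, key]

lemma emits_lit (y : ℕ × ℕ × ℕ) (n : ℕ) : Emits y (emitLit n) [n] :=
  fun _ _ _ _ _ _ => run_emitLit ..

lemma emits_letter (y : ℕ × ℕ × ℕ) : Emits y emitLetter [y.1, y.2.1, y.2.2] := by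
  intro a b c _ _ _
  simp [emitLetter, Instr.apply]

lemma emits_work (y : ℕ × ℕ × ℕ) (n : ℕ) : Emits y (emitWork n) [1, 1, n] :=
  ((emits_lit y 1).append (emits_lit y 1)).append (emits_lit y n)

lemma emits_control (y : ℕ × ℕ × ℕ) : Emits y emitControl (controlCode y) :=
  ((((emits_lit y 0).replicate 2).append (((emits_lit y 1).append (emits_work y 0)).replicate 2)
    ).append (((emits_lit y 1).append (emits_letter y)).replicate 14)).append
    ((((emits_lit y 2).append (emits_work y 0)).append (emits_letter y)).replicate 14)

/-- Save the letter in the stacks `3`, `4` and `5`. -/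
def saveLetter : List Instr := [.copy 5 2, .copy 4 2, .copy 3 2]

/-- The letters on the stack of saved letters. -/
def flat (l : List (ℕ × ℕ × ℕ)) : List ℕ := l.flatMap fun y => [y.1, y.2.1, y.2.2]

/-- Emit and save the letter in the stacks `3`, `4` and `5`. -/
def emitSave : List Instr := emitControl ++ saveLetter

/-- Stack `1` collects the output in reverse. Stack `2` stores the letters last in, first out, which
is the order in which the second half of a compiled gate needs them. -/
lemma run_emitSave (y : ℕ × ℕ × ℕ) (a b c g h i : List ℕ) :
    run emitSave (st a b c [y.1] [y.2.1] [y.2.2] g h i) =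
      st a ((controlCode y).reverse ++ b) (flat [y] ++ c) [y.1] [y.2.1] [y.2.2] g h i := by
  rw [emitSave, run_append, emits_control y]
  simp [saveLetter, Instr.apply, flat]

/-- Halve the number on stack `4` into stack `8`, adding the remainder to stack `5`. -/
def halveLoop : Prog :=
  .loop (.pos 4) (.seq (block [.pred 4])
    (.ite (.pos 4) (block [.pred 4, .succ 8]) (block [.succ 5])))

lemma runs_halveLoop (a b c d g h : List ℕ) (v x u : ℕ) :
    Runs halveLoop (st a b c d [v] [x] g h [u]) (8 * v + 1)
      (st a b c d [0] [x + v % 2] g h [u + v / 2]) := by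
  induction v using Nat.strong_induction_on generalizing u with
  | _ v ih =>
    match v with
    | 0 => exact Runs.loop_done (not_holds_pos rfl)
    | 1 =>
      have h1 : Runs (block [.pred 4]) (st a b c d [1] [x] g h [u]) 2
        (st a b c d [0] [x] g h [u]) := runs_block _ (by simp [Instr.apply])
      have h2 : Runs (block [.succ 5]) (st a b c d [0] [x] g h [u]) 2
        (st a b c d [0] [x + 1] g h [u]) := runs_block _ (by simp [Instr.apply])
      exact (Runs.loop_step (holds_pos rfl) (h1.seq (Runs.ite_false (not_holds_pos rfl) h2))
        (Runs.loop_done (not_holds_pos rfl))).mono (by omega)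
    | v + 2 =>
      have h1 : Runs (block [.pred 4]) (st a b c d [v + 2] [x] g h [u]) 2
        (st a b c d [v + 1] [x] g h [u]) := runs_block _ (by simp [Instr.apply])
      have h2 : Runs (block [.pred 4, .succ 8]) (st a b c d [v + 1] [x] g h [u]) 3
        (st a b c d [v] [x] g h [u + 1]) := runs_block _ (by simp [Instr.apply])
      have hv1 : (v + 2) % 2 = v % 2 := by omega
      have hv2 : u + (v + 2) / 2 = u + 1 + v / 2 := by omega
      rw [hv1, hv2]
      exact (Runs.loop_step (holds_pos rfl) (h1.seq (Runs.ite_true (holds_pos rfl) h2))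
        (ih v (by omega) (u + 1))).mono (by omega)

/-- The triple of a letter on the proof. -/
def proofTriple {N : ℕ} (x : Fin N × Axis) : ℕ × ℕ × ℕ := (0, x.1, x.2.code)

/-- The reversed code of a list of controlled letters. -/
def outCode (l : List (ℕ × ℕ × ℕ)) : List ℕ := (l.flatMap controlCode).reverse

lemma outCode_append (l l' : List (ℕ × ℕ × ℕ)) :
    outCode (l ++ l') = outCode l' ++ outCode l := by simp [outCode]

lemma flat_reverse_append (l l' : List (ℕ × ℕ × ℕ)) :
    flat (l ++ l').reverse = flat l'.reverse ++ flat l.reverse := by simp [flat]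

/-- Replace a positive number on stack `4` by its parent and emit the letter at the parent. -/
def ancestorStep : Prog :=
  .seq (block [.pred 4, .push 8, .push 5])
    (.seq halveLoop (.seq (block [.pop 4, .copy 8 4, .pop 8]) (block (emitSave ++ [.pop 5]))))

/-- Emit the letters of the ancestors. -/
def ancestorLoop : Prog := .loop (.pos 4) ancestorStep

/-- The cost of emitting and saving a letter. -/
def emitCost : ℕ := emitSave.length + 20

/-- Halving thus yields a whole letter: the quotient is the parent and the remainder is the axis. -/
lemma turn_code (v : ℕ) : (turn v).code = v % 2 := by
  unfold turn
  rcases Nat.mod_two_eq_zero_or_one v with h | h <;> simp [h, Axis.code]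

lemma runs_ancestorStep (a b c g h : List ℕ) (v : ℕ) :
    Runs ancestorStep (st a b c [0] [v + 1] [] g h []) (emitCost + 8 * v)
      (st a (outCode [(0, v / 2, v % 2)] ++ b) (flat [(0, v / 2, v % 2)].reverse ++ c) [0] [v / 2]
        [] g h []) := by
  have h1 : Runs (block [.pred 4, .push 8, .push 5]) (st a b c [0] [v + 1] [] g h []) 4
    (st a b c [0] [v] [0] g h [0]) := runs_block _ (by simp [Instr.apply])
  have h2 := runs_halveLoop a b c [0] g h v 0 0
  rw [zero_add, zero_add] at h2
  have h3 : Runs (block [.pop 4, .copy 8 4, .pop 8])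
    (st a b c [0] [0] [v % 2] g h [v / 2]) 4 (st a b c [0] [v / 2] [v % 2] g h []) :=
      runs_block _ (by simp [Instr.apply])
  have h4 : Runs (block (emitSave ++ [.pop 5])) (st a b c [0] [v / 2] [v % 2] g h [])
      (emitSave.length + 2)
      (st a (outCode [(0, v / 2, v % 2)] ++ b) (flat [(0, v / 2, v % 2)].reverse ++ c) [0] [v / 2]
        [] g h []) :=
    (runs_block _ (by
      rw [run_append, run_emitSave (0, v / 2, v % 2)]
      simp [Instr.apply, outCode])).mono (by simp)
  exact (h1.seq (h2.seq (h3.seq h4))).mono (by unfold emitCost; omega)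

lemma runs_ancestorLoop {N : ℕ} (a b c g h : List ℕ) (v : ℕ) (hv : v < N) :
    Runs ancestorLoop (st a b c [0] [v] [] g h []) (v * (emitCost + 8 * v + 1) + 1)
      (st a (outCode ((ancestors v hv).map proofTriple) ++ b)
        (flat ((ancestors v hv).map proofTriple).reverse ++ c) [0] [0] [] g h []) := by
  induction v using Nat.strong_induction_on generalizing b c with
  | _ v ih =>
    match v with
    | 0 => simpa [ancestors, outCode, flat, ancestorLoop] using Runs.loop_done (not_holds_pos rfl)
    | v + 1 =>
      have h2 := ih (v / 2) (by omega) (outCode [(0, v / 2, v % 2)] ++ b)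
        (flat [(0, v / 2, v % 2)].reverse ++ c) (by omega)
      have h1 := Runs.loop_step (holds_pos rfl) (runs_ancestorStep a b c g h v) h2
      rw [← List.append_assoc, ← List.append_assoc, ← outCode_append, ← flat_reverse_append] at h1
      have e : (ancestors (v + 1) hv).map proofTriple =
          [(0, v / 2, v % 2)] ++ (ancestors (v / 2) (by omega : v / 2 < N)).map proofTriple := by
        rw [ancestors, List.map_cons, proofTriple, turn_code]; rfl
      rw [e]
      refine h1.mono ?_
      -- The time bound pretends that there are $v$ rounds instead of logarithmically many; a
      -- polynomial bound is enough.
      have h3 : v / 2 * (emitCost + 8 * (v / 2) + 1) ≤ v * (emitCost + 8 * v + 1) :=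
        Nat.mul_le_mul (by omega) (by omega)
      have h4 : (v + 1) * (emitCost + 8 * v + 1) ≤ (v + 1) * (emitCost + 8 * (v + 1) + 1) :=
        Nat.mul_le_mul le_rfl (by omega)
      have h5 : (v + 1) * (emitCost + 8 * v + 1) =
        v * (emitCost + 8 * v + 1) + (emitCost + 8 * v + 1) := by ring
      omega

/-- Double the number on stack `0` into stack `4`. -/
def doubleLoop : Prog := .loop (.pos 0) (block [.pred 0, .succ 4, .succ 4])

lemma runs_doubleLoop (a b c g h : List ℕ) (k x : ℕ) :
    Runs doubleLoop (st (k :: a) b c [] [x] [] g h []) (5 * k + 1)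
      (st (0 :: a) b c [] [2 * k + x] [] g h []) := by
  induction k generalizing x with
  | zero => simpa [doubleLoop] using Runs.loop_done (not_holds_pos rfl)
  | succ k ih =>
    have h1 : Runs (block [.pred 0, .succ 4, .succ 4]) (st ((k + 1) :: a) b c [] [x] [] g h []) 4
      (st (k :: a) b c [] [x + 2] [] g h []) := runs_block _ (by simp [Instr.apply])
    have e : 2 * (k + 1) + x = 2 * k + (x + 2) := by ring
    rw [e]
    exact (Runs.loop_step (holds_pos rfl) h1 (ih (x + 2))).mono (by omega)

/-- Emit the letters of a Majorana operator. -/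
def majoranaStep : Prog :=
  .seq (block [.pred 6, .push 4]) (.seq doubleLoop (.seq (block [.pop 0])
    (.seq (.ite (.pos 0) (block [.succ 4]) (block []))
      (.seq (block ([.pop 0, .push 3, .push 5, .succ 5, .succ 5] ++ (emitSave ++ [.pop 5])))
        (.seq ancestorLoop (block [.pop 3, .pop 4]))))))

lemma runs_majoranaStep {p : ℕ} (a b c g h : List ℕ) (n : ℕ) (x : Fin p × Bool) :
    Runs majoranaStep (st ((x.1 : ℕ) :: x.2.toNat :: a) b c [] [] [] ((n + 1) :: g) h [])
      (5 * p + 2 * emitCost + 2 * p * (emitCost + 16 * p + 1))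
      (st a (outCode ((path (majIndex x) (majIndex_lt x)).map proofTriple) ++ b)
        (flat ((path (majIndex x) (majIndex_lt x)).map proofTriple).reverse ++ c) [] [] []
        (n :: g) h []) := by
  obtain ⟨k, t⟩ := x
  have h1 : Runs (block [.pred 6, .push 4])
      (st ((k : ℕ) :: t.toNat :: a) b c [] [] [] ((n + 1) :: g) h []) 3
      (st ((k : ℕ) :: t.toNat :: a) b c [] [0] [] (n :: g) h []) :=
    runs_block _ (by simp [Instr.apply])
  have h2 := runs_doubleLoop (t.toNat :: a) b c (n :: g) h k 0
  rw [add_zero] at h2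
  have h3 : Runs (block [.pop 0]) (st (0 :: t.toNat :: a) b c [] [2 * (k : ℕ)] [] (n :: g) h []) 2
      (st (t.toNat :: a) b c [] [2 * (k : ℕ)] [] (n :: g) h []) :=
    runs_block _ (by simp [Instr.apply])
  have h4 : Runs (.ite (.pos 0) (block [.succ 4]) (block []))
      (st (t.toNat :: a) b c [] [2 * (k : ℕ)] [] (n :: g) h []) 3
      (st (t.toNat :: a) b c [] [majIndex (k, t)] [] (n :: g) h []) := by
    cases t
    · exact (Runs.ite_false (not_holds_pos rfl)
        (runs_block _ (by simp [majIndex]))).mono (by simp)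
    · exact Runs.ite_true (holds_pos rfl) (runs_block _ (by simp [Instr.apply, majIndex]))
  set v := majIndex (k, t) with hv
  have hlt : v < 2 * p := majIndex_lt (k, t)
  -- The letter of the node itself: kind 0 for the proof, and axis code 2, which is $Z$.
  have h5 : Runs (block ([.pop 0, .push 3, .push 5, .succ 5, .succ 5] ++ (emitSave ++ [.pop 5])))
      (st (t.toNat :: a) b c [] [v] [] (n :: g) h []) (emitSave.length + 7)
      (st a (outCode [(0, v, 2)] ++ b) (flat [(0, v, 2)].reverse ++ c) [0] [v] [] (n :: g) h []) :=
    (runs_block _ (by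
      rw [run_append]
      simp only [run_cons, run_nil, Instr.apply, st_zero, st_three, st_five, update_st_zero,
        update_st_three, update_st_five, List.tail_cons, List.modifyHead_cons]
      rw [run_append, run_emitSave (0, v, 2)]
      simp [Instr.apply, outCode])).mono (by simp)
  have h6 := runs_ancestorLoop a (outCode [(0, v, 2)] ++ b) (flat [(0, v, 2)].reverse ++ c)
    (n :: g) h v hlt
  rw [← List.append_assoc, ← List.append_assoc, ← outCode_append, ← flat_reverse_append] at h6
  have e : (path v hlt).map proofTriple = [(0, v, 2)] ++ (ancestors v hlt).map proofTriple := rfl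
  rw [← e] at h6
  have h7 : ∀ b c, Runs (block [.pop 3, .pop 4]) (st a b c [0] [0] [] (n :: g) h []) 3
      (st a b c [] [] [] (n :: g) h []) := fun b c => runs_block _ (by simp [Instr.apply])
  refine (h1.seq (h2.seq (h3.seq (h4.seq (h5.seq (h6.seq (h7 _ _))))))).mono ?_
  have h8 : v * (emitCost + 8 * v + 1) ≤ 2 * p * (emitCost + 16 * p + 1) :=
    Nat.mul_le_mul (by omega) (by omega)
  have := k.2
  unfold emitCost at *
  omega

/-- Emit the letter of an ancilla qubit. -/
def ancillaStep : Prog :=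
  .seq (block [.pred 6, .copy 0 4, .pop 0]) (.seq (.ite (.pos 4) (block [.succ 4]) (block []))
    (block ([.copy 0 5, .pop 0, .push 3, .succ 3] ++ (emitSave ++ [.pop 3, .pop 4, .pop 5]))))

/-- The triple of a letter on an ancilla qubit. -/
def ancillaTriple {a : ℕ} (x : Fin (a + 1) × Axis) : ℕ × ℕ × ℕ :=
  (1, ((1 : Fin (a + 2)).succAbove x.1 : Fin (a + 2)), x.2.code)

/-- Ancilla numbers other than 0 are shifted past the additional qubit; this is the conditional
increment of the program. -/
lemma val_succAbove_one {a : ℕ} (k : Fin (a + 1)) :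
    (((1 : Fin (a + 2)).succAbove k : Fin (a + 2)) : ℕ) = if (k : ℕ) = 0 then 0 else (k : ℕ) + 1 := by
  rcases Fin.eq_zero_or_eq_succ k with rfl | ⟨j, rfl⟩
  · simp
  · rw [Fin.succAbove_of_le_castSucc]
    · simp
    · rw [Fin.le_def]; simp

lemma runs_ancillaStep {m : ℕ} (a b c g h : List ℕ) (n : ℕ) (x : Fin (m + 1) × Axis) :
    Runs ancillaStep (st ((x.1 : ℕ) :: x.2.code :: a) b c [] [] [] ((n + 1) :: g) h [])
      (2 * emitCost)
      (st a (outCode [ancillaTriple x] ++ b) (flat [ancillaTriple x].reverse ++ c) [] [] []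
        (n :: g) h []) := by
  obtain ⟨k, A⟩ := x
  have h1 : Runs (block [.pred 6, .copy 0 4, .pop 0])
      (st ((k : ℕ) :: A.code :: a) b c [] [] [] ((n + 1) :: g) h []) 4
      (st (A.code :: a) b c [] [(k : ℕ)] [] (n :: g) h []) := runs_block _ (by simp [Instr.apply])
  have h2 : Runs (.ite (.pos 4) (block [.succ 4]) (block []))
      (st (A.code :: a) b c [] [(k : ℕ)] [] (n :: g) h []) 3
      (st (A.code :: a) b c [] [(ancillaTriple (k, A)).2.1] [] (n :: g) h []) := by
    simp only [ancillaTriple, val_succAbove_one]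
    rcases Nat.eq_zero_or_eq_succ_pred (k : ℕ) with e | e
    · rw [e]
      exact (Runs.ite_false (not_holds_pos rfl) (runs_block _ (by simp))).mono (by simp)
    · rw [e]
      exact Runs.ite_true (holds_pos rfl) (runs_block _ (by simp [Instr.apply]))
  have h3 : Runs (block ([.copy 0 5, .pop 0, .push 3, .succ 3] ++
        (emitSave ++ [.pop 3, .pop 4, .pop 5])))
      (st (A.code :: a) b c [] [(ancillaTriple (k, A)).2.1] [] (n :: g) h [])
      (emitSave.length + 8)
      (st a (outCode [ancillaTriple (k, A)] ++ b) (flat [ancillaTriple (k, A)].reverse ++ c)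
        [] [] [] (n :: g) h []) :=
    (runs_block _ (by
      rw [run_append]
      simp only [run_cons, run_nil, Instr.apply, st_zero, st_three, st_five, update_st_zero,
        update_st_three, update_st_five, List.tail_cons, List.modifyHead_cons, List.head?_cons,
        Option.toList_some, List.cons_append, List.nil_append]
      rw [run_append]
      have := run_emitSave (ancillaTriple (k, A)) a b c (n :: g) h []
      change run _ (run _ (st a b c [(ancillaTriple (k, A)).1] [(ancillaTriple (k, A)).2.1]
        [(ancillaTriple (k, A)).2.2] (n :: g) h [])) = _
      rw [this]
      simp [Instr.apply, outCode])).mono (by simp)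
  exact (h1.seq (h2.seq h3)).mono (by unfold emitCost; omega)


/-- Emit the codes of the saved letters and delete them. -/
def unsaveStep : Prog :=
  block ([.copy 2 3, .pop 2, .copy 2 4, .pop 2, .copy 2 5, .pop 2] ++
    (emitControl ++ [.pop 3, .pop 4, .pop 5]))

lemma runs_unsaveLoop (a b g h : List ℕ) (l : List (ℕ × ℕ × ℕ)) :
    Runs (.loop (.nonempty 2) unsaveStep) (st a b (flat l) [] [] [] g h [])
      (l.length * (emitCost + 1) + 1) (st a (outCode l ++ b) [] [] [] [] g h []) := by
  induction l generalizing b with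
  | nil => simpa [flat, outCode] using Runs.loop_done (not_holds_nonempty rfl)
  | cons y l ih =>
    have h1 : Runs unsaveStep (st a b (flat (y :: l)) [] [] [] g h []) emitCost
        (st a (outCode [y] ++ b) (flat l) [] [] [] g h []) :=
      (runs_block _ (by
        rw [run_append]
        simp only [run_cons, run_nil, Instr.apply, st_two, st_three, st_four, st_five,
          update_st_two, update_st_three, update_st_four, update_st_five, List.tail_cons,
          List.head?_cons, Option.toList_some, List.cons_append, List.nil_append, flat,
          List.flatMap_cons]
        rw [run_append, emits_control y]
        simp [Instr.apply, outCode])).mono (by simp [emitCost, emitSave]; omega)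
    have h2 := Runs.loop_step (holds_nonempty rfl) h1 (ih (outCode [y] ++ b))
    rw [← List.append_assoc, ← outCode_append] at h2
    exact h2.mono (by rw [List.length_cons, add_mul]; omega)

/-- Emit the gate between the two controlled words. Its axis depends on the number on stack `7`. -/
def middleStep : Prog :=
  .seq (block [.pred 7]) (.seq (.ite (.pos 7)
      (.seq (block [.pred 7])
        (.ite (.pos 7) (block (emitLit 1 ++ emitWork 2)) (block (emitLit 1 ++ emitWork 1))))
      (block (emitLit 1 ++ emitWork 2)))
    (block [.pop 7]))

lemma runs_emitWork (a b c d e f g h i : List ℕ) (n : ℕ) :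
    Runs (block (emitLit 1 ++ emitWork n)) (st a b c d e f g h i) (n + 8)
      (st a ([1, 1, 1, n].reverse ++ b) c d e f g h i) :=
  (runs_block _ (by
    simp only [emitWork, run_append, run_emitLit]
    rfl)).mono (by simp [emitWork, emitLit])

/-- Two decrements with a positivity test after each single out $n=2$. The last number is the axis
code, 1 for $Y$ and 2 for $Z$. -/
lemma runs_middleStep (a b c : List ℕ) (n : ℕ) :
    Runs middleStep (st a b c [] [] [] [] [n] []) 30
      (st a ([1, 1, 1, if n = 2 then 1 else 2].reverse ++ b) c [] [] [] [] [] []) := by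
  have hpop : ∀ b m, Runs (block [.pop 7]) (st a b c [] [] [] [] [m] []) 2
      (st a b c [] [] [] [] [] []) := fun b m => runs_block _ (by simp [Instr.apply])
  have hpred : ∀ b m, Runs (block [.pred 7]) (st a b c [] [] [] [] [m] []) 2
      (st a b c [] [] [] [] [m - 1] []) := fun b m => runs_block _ (by simp [Instr.apply])
  have hemit := fun m n => runs_emitWork a b c [] [] [] [] [m] [] n
  match n with
  | 0 =>
    exact ((hpred b 0).seq ((Runs.ite_false (not_holds_pos rfl) (hemit 0 2)).seq
      (hpop _ 0))).mono (by omega)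
  | 1 =>
    exact ((hpred b 1).seq ((Runs.ite_false (not_holds_pos rfl) (hemit 0 2)).seq
      (hpop _ 0))).mono (by omega)
  | 2 =>
    exact ((hpred b 2).seq ((Runs.ite_true (holds_pos rfl) ((hpred b 1).seq
      (Runs.ite_false (not_holds_pos rfl) (hemit 0 1)))).seq (hpop _ 0))).mono (by omega)
  | n + 3 =>
    rw [if_neg (by omega)]
    exact ((hpred b (n + 3)).seq ((Runs.ite_true (holds_pos rfl) ((hpred b (n + 2)).seq
      (Runs.ite_true (holds_pos rfl) (hemit (n + 1) 2)))).seq (hpop _ (n + 1)))).mono (by omega)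

/-- The cost of a Majorana operator. -/
def majoranaCost (p : ℕ) : ℕ := 5 * p + 2 * emitCost + 2 * p * (emitCost + 16 * p + 1)

/-! ### Compiling gates and whole circuits, with running times. -/

section Gates

variable {p m : ℕ}

/-- The triples of the letters of a Majorana operator. -/
def majTriples (x : Fin p × Bool) : List (ℕ × ℕ × ℕ) :=
  (path (majIndex x) (majIndex_lt x)).map proofTriple

lemma runs_majoranaLoop (a b c h : List ℕ) (l : List (Fin p × Bool)) :
    Runs (.loop (.pos 6) majoranaStep)
      (st (l.flatMap (fun c => [(c.1 : ℕ), c.2.toNat]) ++ a) b c [] [] [] [l.length] h [])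
      (l.length * (majoranaCost p + 1) + 1)
      (st a (outCode (l.flatMap majTriples) ++ b) (flat (l.flatMap majTriples).reverse ++ c)
        [] [] [] [0] h []) := by
  induction l generalizing b c with
  | nil => simpa [flat, outCode] using Runs.loop_done (not_holds_pos rfl)
  | cons x l ih =>
    have h1 := runs_majoranaStep (l.flatMap (fun c => [(c.1 : ℕ), c.2.toNat]) ++ a) b c [] h
      l.length x
    have h2 := Runs.loop_step (holds_pos rfl) h1 (ih _ _)
    rw [← List.append_assoc, ← List.append_assoc, ← outCode_append, ← flat_reverse_append] at h2
    exact h2.mono (by rw [List.length_cons, add_mul, majoranaCost]; omega)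

lemma runs_ancillaLoop (a b c h : List ℕ) (l : List (Fin (m + 1) × Axis)) :
    Runs (.loop (.pos 6) ancillaStep)
      (st (l.flatMap (fun l => [(l.1 : ℕ), l.2.code]) ++ a) b c [] [] [] [l.length] h [])
      (l.length * (2 * emitCost + 1) + 1)
      (st a (outCode (l.map ancillaTriple) ++ b) (flat (l.map ancillaTriple).reverse ++ c)
        [] [] [] [0] h []) := by
  induction l generalizing b c with
  | nil => simpa [flat, outCode] using Runs.loop_done (not_holds_pos rfl)
  | cons x l ih =>
    have h1 := runs_ancillaStep (l.flatMap (fun l => [(l.1 : ℕ), l.2.code]) ++ a) b c [] h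
      l.length x
    have h2 := Runs.loop_step (holds_pos rfl) h1 (ih _ _)
    rw [← List.append_assoc, ← List.append_assoc, ← outCode_append, ← flat_reverse_append] at h2
    exact h2.mono (by rw [List.length_cons, add_mul]; omega)

/-- Compile one gate. -/
def gateStep : Prog :=
  .seq (block [.copy 0 6, .copy 0 7, .pop 0]) (.seq (.loop (.pos 6) majoranaStep)
    (.seq (block [.pop 6, .copy 0 6, .pop 0]) (.seq (.loop (.pos 6) ancillaStep)
      (.seq (block [.pop 6]) (.seq middleStep (.loop (.nonempty 2) unsaveStep))))))

/-- The triple of a letter. -/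
def letterTriple : (Fin (2 * p) ⊕ Fin (m + 1)) × Axis → ℕ × ℕ × ℕ
  | (.inl k, A) => proofTriple (k, A)
  | (.inr k, A) => ancillaTriple (k, A)

lemma FermionGate.map_letterTriple (g : FermionGate p m) :
    g.letters.map letterTriple =
      g.maj.flatMap majTriples ++ g.word.letters.map ancillaTriple := by
  rw [FermionGate.letters, List.map_append, List.map_flatMap, List.map_map]
  congr 1
  refine congrArg (fun f => List.flatMap f g.maj) ?_
  ext1 x
  rw [majLetters, List.map_map]
  rfl

lemma flatMap_replicate {α β : Type*} (f : α → List β) (n : ℕ) (x : α) :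
    (List.replicate n x).flatMap f = (List.replicate n (f x)).flatten := by
  rw [List.flatMap_def, List.map_replicate]

lemma code_controlGates (x : (Fin (2 * p) ⊕ Fin (m + 1)) × Axis) :
    (controlGates x).flatMap QubitGate.code = controlCode (letterTriple x) := by
  simp only [controlGates, List.flatMap_append, flatMap_replicate, controlCode]
  obtain ⟨k | k, A⟩ := x <;> rfl

lemma code_flatMap_controlGates (l : List ((Fin (2 * p) ⊕ Fin (m + 1)) × Axis)) :
    ((l.flatMap controlGates).flatMap QubitGate.code).reverse = outCode (l.map letterTriple) := by
  rw [outCode, List.flatMap_assoc, List.flatMap_map]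
  simp only [code_controlGates]

lemma code_middle (A : Axis) :
    (singleGate (work (a := m) (N := 2 * p)) A).code = [1, 1, 1, A.code] := rfl

lemma FermionGate.code_compileGate (g : FermionGate p m) :
    ((compileGate g).flatMap QubitGate.code).reverse =
      outCode (g.letters.map letterTriple).reverse ++
        ([1, 1, 1, if g.maj.length = 2 then 1 else 2].reverse ++
          outCode (g.letters.map letterTriple)) := by
  rw [compileGate, List.flatMap_append, List.reverse_append, code_flatMap_controlGates,
    List.flatMap_cons, List.reverse_append, code_flatMap_controlGates, code_middle,
    List.map_reverse, List.append_assoc]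
  split_ifs <;> rfl

lemma length_path_le (v : ℕ) {N : ℕ} (h : v < N) : (path v h).length ≤ Nat.log 2 N + 1 := by
  rw [path, List.length_cons]
  exact Nat.succ_le_succ ((length_ancestors_le v h).trans (Nat.log_mono_right h))

lemma length_majTriples_le (x : Fin p × Bool) : (majTriples x).length ≤ 2 * p := by
  have h := length_path_le (majIndex x) (majIndex_lt x)
  have h' := majIndex_lt x
  have := Nat.log_lt_self 2 (x := 2 * p) (by omega)
  rw [majTriples, List.length_map]
  omega

lemma length_flatMap_le {α β : Type*} {f : α → List β} {n : ℕ} {l : List α}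
    (h : ∀ x ∈ l, (f x).length ≤ n) : (l.flatMap f).length ≤ l.length * n := by
  induction l with
  | nil => simp
  | cons x l ih =>
    rw [List.flatMap_cons, List.length_append, List.length_cons, add_mul]
    have := h x (by simp)
    have := ih fun y hy => h y (by simp [hy])
    omega

/-- At most four Majorana words of at most $2p$ letters each, and two ancilla letters. The linear
bound is crude but only enters running times. -/
lemma FermionGate.length_letters_le (g : FermionGate p m) :
    (g.letters.map letterTriple).length ≤ 8 * p + 2 := by
  rw [g.map_letterTriple, List.length_append, List.length_map]
  have h1 := length_flatMap_le (l := g.maj) fun x _ => length_majTriples_le x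
  have h2 := g.word.length_le
  have h3 := Nat.mul_le_mul_right (2 * p) g.length_le
  omega

/-- The cost of a gate. -/
def gateCost (p : ℕ) : ℕ :=
  4 * (majoranaCost p + 1) + 2 * (2 * emitCost + 1) + (8 * p + 2) * (emitCost + 1) + 50

/-- Stack `6` counts the letters still to be read, while stack `7` keeps the number of Majorana
operators for the middle gate. Besides the output, only the unread input survives, so the step can
be iterated. -/
lemma runs_gateStep (a b : List ℕ) (g : FermionGate p m) :
    Runs gateStep (st (g.code ++ a) b [] [] [] [] [] [] []) (gateCost p)
      (st a (((compileGate g).flatMap QubitGate.code).reverse ++ b) [] [] [] [] [] [] []) := by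
  set lm := g.maj.flatMap (fun c => [(c.1 : ℕ), c.2.toNat]) with hlm
  set lw := g.word.letters.flatMap (fun l => [(l.1 : ℕ), l.2.code]) with hlw
  have hcode : g.code ++ a =
      g.maj.length :: (lm ++ (g.word.letters.length :: (lw ++ a))) := by
    simp [FermionGate.code, hlm, hlw]
  set n := g.maj.length with hn
  set k := g.word.letters.length with hk
  rw [hcode]
  have h1 : Runs (block [.copy 0 6, .copy 0 7, .pop 0])
      (st (n :: (lm ++ (k :: (lw ++ a)))) b [] [] [] [] [] [] []) 4
      (st (lm ++ (k :: (lw ++ a))) b [] [] [] [] [n] [n] []) :=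
    runs_block _ (by simp [Instr.apply])
  have h2 := runs_majoranaLoop (k :: (lw ++ a)) b [] [n] g.maj
  set b1 := outCode (g.maj.flatMap majTriples) ++ b with hb1
  set c1 := flat (g.maj.flatMap majTriples).reverse ++ [] with hc1
  have h3 : Runs (block [.pop 6, .copy 0 6, .pop 0])
      (st (k :: (lw ++ a)) b1 c1 [] [] [] [0] [n] []) 4
      (st (lw ++ a) b1 c1 [] [] [] [k] [n] []) :=
    runs_block _ (by simp [Instr.apply])
  have h4 := runs_ancillaLoop a b1 c1 [n] g.word.letters
  set b2 := outCode (g.word.letters.map ancillaTriple) ++ b1 with hb2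
  set c2 := flat (g.word.letters.map ancillaTriple).reverse ++ c1 with hc2
  have hb2' : b2 = outCode (g.letters.map letterTriple) ++ b := by
    rw [g.map_letterTriple, outCode_append, hb2, hb1, List.append_assoc]
  have hc2' : c2 = flat (g.letters.map letterTriple).reverse := by
    rw [g.map_letterTriple, flat_reverse_append, hc2, hc1, List.append_nil]
  have h5 : Runs (block [.pop 6]) (st a b2 c2 [] [] [] [0] [n] []) 2
      (st a b2 c2 [] [] [] [] [n] []) := runs_block _ (by simp [Instr.apply])
  have h6 := runs_middleStep a b2 c2 n
  have h7 := runs_unsaveLoop a ([1, 1, 1, if n = 2 then 1 else 2].reverse ++ b2) [] []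
    (g.letters.map letterTriple).reverse
  rw [← hc2'] at h7
  have e : ((compileGate g).flatMap QubitGate.code).reverse ++ b =
      outCode (g.letters.map letterTriple).reverse ++
        ([1, 1, 1, if n = 2 then 1 else 2].reverse ++ b2) := by
    rw [g.code_compileGate, hb2', List.append_assoc, List.append_assoc]
  rw [e]
  refine (h1.seq (h2.seq (h3.seq (h4.seq (h5.seq (h6.seq h7)))))).mono ?_
  have i1 : n * (majoranaCost p + 1) ≤ 4 * (majoranaCost p + 1) :=
    Nat.mul_le_mul_right _ g.length_le
  have i2 : k * (2 * emitCost + 1) ≤ 2 * (2 * emitCost + 1) :=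
    Nat.mul_le_mul_right _ g.word.length_le
  have i3 : (g.letters.map letterTriple).reverse.length * (emitCost + 1) ≤
      (8 * p + 2) * (emitCost + 1) := by
    rw [List.length_reverse]
    exact Nat.mul_le_mul_right _ g.length_letters_le
  unfold gateCost
  rw [hn] at i1
  rw [hk] at i2
  omega

lemma runs_gateLoop (b : List ℕ) (C : List (FermionGate p m)) :
    Runs (.loop (.nonempty 0) gateStep)
      (st (C.flatMap FermionGate.code) b [] [] [] [] [] [] []) (C.length * (gateCost p + 1) + 1)
      (st [] (((compile C).flatMap QubitGate.code).reverse ++ b) [] [] [] [] [] [] []) := by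
  induction C generalizing b with
  | nil => simpa [compile] using Runs.loop_done (not_holds_nonempty rfl)
  | cons g C ih =>
    have h1 := runs_gateStep (C.flatMap FermionGate.code) b g
    have h2 := Runs.loop_step (holds_nonempty rfl) h1 (ih _)
    have e : ((compile (g :: C)).flatMap QubitGate.code).reverse =
        ((compile C).flatMap QubitGate.code).reverse ++
          ((compileGate g).flatMap QubitGate.code).reverse := by
      simp [compile]
    rw [e, List.append_assoc]
    exact h2.mono (by rw [List.length_cons, add_mul]; omega)

lemma runs_moveLoop (a b : List ℕ) :
    Runs (.loop (.nonempty 1) (block [.copy 1 0, .pop 1])) (st a b [] [] [] [] [] [] [])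
      (b.length * 4 + 1) (st (b.reverse ++ a) [] [] [] [] [] [] [] []) := by
  induction b generalizing a with
  | nil => simpa using Runs.loop_done (not_holds_nonempty rfl)
  | cons x b ih =>
    have h1 : Runs (block [.copy 1 0, .pop 1]) (st a (x :: b) [] [] [] [] [] [] []) 3
        (st (x :: a) b [] [] [] [] [] [] []) := runs_block _ (by simp [Instr.apply])
    have h2 := Runs.loop_step (holds_nonempty rfl) h1 (ih (x :: a))
    rw [List.reverse_cons, List.append_assoc]
    exact h2.mono (by rw [List.length_cons]; omega)

/-- Compile a circuit. -/
def compileProg : Prog :=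
  .seq (.loop (.nonempty 0) gateStep) (.loop (.nonempty 1) (block [.copy 1 0, .pop 1]))

lemma length_controlCode (y : ℕ × ℕ × ℕ) : (controlCode y).length = 164 := by
  simp only [controlCode, List.length_append, List.length_flatten, List.map_replicate,
    List.sum_replicate, List.length_cons, List.length_nil, smul_eq_mul]

/-- Each letter is emitted twice, at 164 numbers apiece, and the middle gate takes four numbers. -/
lemma FermionGate.length_code_compileGate_le (g : FermionGate p m) :
    ((compileGate g).flatMap QubitGate.code).length ≤ 328 * (8 * p + 2) + 4 := by
  have h : ∀ l : List (ℕ × ℕ × ℕ), (outCode l).length ≤ l.length * 164 := fun l => by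
    rw [outCode, List.length_reverse]
    exact length_flatMap_le fun y _ => (length_controlCode y).le
  rw [← List.length_reverse, g.code_compileGate, List.length_append, List.length_append]
  have h1 := h (g.letters.map letterTriple)
  have h2 := h (g.letters.map letterTriple).reverse
  have h3 := g.length_letters_le
  rw [List.length_reverse] at h2
  simp only [List.length_reverse, List.length_cons, List.length_nil]
  omega

/-- The cost of compiling a circuit with `n` gates. -/
def compileCost (p n : ℕ) : ℕ :=
  n * (gateCost p + 1) + 1 + (n * (328 * (8 * p + 2) + 4) * 4 + 1)

lemma runs_compileProg (C : List (FermionGate p m)) :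
    Runs compileProg (st (C.flatMap FermionGate.code) [] [] [] [] [] [] [] [])
      (compileCost p C.length)
      (st ((compile C).flatMap QubitGate.code) [] [] [] [] [] [] [] []) := by
  have h1 := runs_gateLoop [] C
  have h2 := runs_moveLoop [] ((((compile C).flatMap QubitGate.code).reverse ++ []))
  rw [List.append_nil, List.reverse_reverse, List.append_nil, List.length_reverse] at h2
  rw [List.append_nil] at h1
  refine (h1.seq h2).mono (add_le_add le_rfl ?_)
  have : ((compile C).flatMap QubitGate.code).length ≤ C.length * (328 * (8 * p + 2) + 4) := by
    rw [compile, List.flatMap_assoc]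
    exact length_flatMap_le fun g _ => g.length_code_compileGate_le
  omega

end Gates

/-! ### Composing programs -/

/-- Rename the stacks of an instruction. -/
def Instr.rename (f : ℕ → ℕ) : Instr → Instr
  | .push k => .push (f k)
  | .pop k => .pop (f k)
  | .succ k => .succ (f k)
  | .pred k => .pred (f k)
  | .copy j k => .copy (f j) (f k)

/-- Rename the stack of a test. -/
def Test.rename (f : ℕ → ℕ) : Test → Test
  | .nonempty k => .nonempty (f k)
  | .pos k => .pos (f k)

/-- Rename the stacks of a program. -/
def Prog.rename (f : ℕ → ℕ) : Prog → Prog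
  | .instr i => .instr (i.rename f)
  | .seq P Q => .seq (P.rename f) (Q.rename f)
  | .ite c P Q => .ite (c.rename f) (P.rename f) (Q.rename f)
  | .loop c P => .loop (c.rename f) (P.rename f)

section Rename

variable {f : ℕ → ℕ}

lemma Instr.apply_rename (hf : Function.Injective f) (i : Instr) {s σ : Store}
    (h : ∀ n, σ (f n) = s n) (n : ℕ) : (i.rename f).apply σ (f n) = i.apply s n := by
  cases i <;> simp only [Instr.rename, Instr.apply, Function.update_apply, hf.eq_iff, h]

lemma Test.holds_rename (c : Test) {s σ : Store} (h : ∀ n, σ (f n) = s n) :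
    (c.rename f).Holds σ ↔ c.Holds s := by
  cases c <;> simp only [Test.rename, Test.Holds, h]

/-- Only the stacks in the range of $f$ need to match, so a program can run beside arbitrary
leftovers of another one. -/
lemma Exec.rename (hf : Function.Injective f) {P : Prog} {s s' : Store} {t : ℕ}
    (hP : Exec P s t s') {σ : Store} (h : ∀ n, σ (f n) = s n) :
    ∃ σ', Exec (P.rename f) σ t σ' ∧ ∀ n, σ' (f n) = s' n := by
  induction hP generalizing σ with
  | instr i s => exact ⟨_, .instr _ _, i.apply_rename hf h⟩
  | seq _ _ ih1 ih2 =>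
    obtain ⟨σ1, e1, h1⟩ := ih1 h
    obtain ⟨σ2, e2, h2⟩ := ih2 h1
    exact ⟨σ2, .seq e1 e2, h2⟩
  | ite_true hc _ ih =>
    obtain ⟨σ1, e1, h1⟩ := ih h
    exact ⟨σ1, .ite_true ((Test.holds_rename _ h).2 hc) e1, h1⟩
  | ite_false hc _ ih =>
    obtain ⟨σ1, e1, h1⟩ := ih h
    exact ⟨σ1, .ite_false (fun h' => hc ((Test.holds_rename _ h).1 h')) e1, h1⟩
  | loop_done hc => exact ⟨σ, .loop_done (fun h' => hc ((Test.holds_rename _ h).1 h')), h⟩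
  | loop_step hc _ _ ih1 ih2 =>
    obtain ⟨σ1, e1, h1⟩ := ih1 h
    obtain ⟨σ2, e2, h2⟩ := ih2 h1
    exact ⟨σ2, .loop_step ((Test.holds_rename _ h).2 hc) e1 e2, h2⟩

end Rename

/-! ### Untouched stacks and growth during executions. -/

/-- A bound for the stacks that an instruction changes. -/
def Instr.width : Instr → ℕ
  | .push k => k + 1
  | .pop k => k + 1
  | .succ k => k + 1
  | .pred k => k + 1
  | .copy _ k => k + 1

/-- A bound for the stacks that a program changes. -/
def Prog.width : Prog → ℕ
  | .instr i => i.width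
  | .seq P Q => max P.width Q.width
  | .ite _ P Q => max P.width Q.width
  | .loop _ P => P.width

lemma Exec.eq_of_width_le {P : Prog} {s s' : Store} {t : ℕ} (h : Exec P s t s') {k : ℕ}
    (hk : P.width ≤ k) : s' k = s k := by
  induction h with
  | instr i s =>
    cases i <;> exact Function.update_of_ne (by simp [Prog.width, Instr.width] at hk; omega) _ _
  | seq _ _ ih1 ih2 =>
    rw [ih2 ((le_max_right _ _).trans hk), ih1 ((le_max_left _ _).trans hk)]
  | ite_true _ _ ih => exact ih ((le_max_left _ _).trans hk)
  | ite_false _ _ ih => exact ih ((le_max_right _ _).trans hk)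
  | loop_done _ => rfl
  | loop_step _ _ _ ih1 ih2 => rw [ih2 hk, ih1 hk]

/-- Bounds the size of a written circuit by the time spent on writing it. -/
lemma Exec.length_le {P : Prog} {s s' : Store} {t : ℕ} (h : Exec P s t s') (k : ℕ) :
    (s' k).length ≤ (s k).length + t := by
  induction h with
  | instr i s =>
    cases i with
    | copy j k' =>
      simp only [Instr.apply, Function.update_apply]
      split_ifs with e
      · subst e
        rcases s j with _ | ⟨x, l⟩ <;> simp
      · omega
    | _ k' =>
      simp only [Instr.apply, Function.update_apply]
      split_ifs with e
      · subst e; simp <;> omega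
      · omega
  | seq _ _ ih1 ih2 => omega
  | ite_true _ _ ih => omega
  | ite_false _ _ ih => omega
  | loop_done _ => omega
  | loop_step _ _ _ ih1 ih2 => omega


/-- The stacks that the second of two composed programs uses: the first is the output of the first
program, the others are fresh. -/
def shift (K : ℕ) : ℕ → ℕ
  | 0 => 2
  | n + 1 => K + 3 + n

lemma shift_injective (K : ℕ) : Function.Injective (shift K) := by
  intro i j h
  cases i <;> cases j <;> simp [shift] at h ⊢ <;> omega

/-- The program `P`, followed by the compilation of its output. -/
def composed (P : Prog) : Prog := .seq P (compileProg.rename (shift P.width))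

lemma exec_composed {p m : ℕ} {P : Prog} {x r : List Bool} {T : ℕ} {s : Store}
    {C : List (FermionGate p m)} (h : Exec P (initStore x r) T s)
    (hs : s 2 = C.flatMap FermionGate.code) :
    ∃ (t : ℕ) (s' : Store), t ≤ T + compileCost p C.length ∧
      Exec (composed P) (initStore x r) t s' ∧ s' 2 = (compile C).flatMap QubitGate.code := by
  obtain ⟨t, ht, hC⟩ := runs_compileProg C
  -- The output of the first program serves as input stack; the other stacks lie beyond its width
  -- and beyond the two input stacks, so they are still empty.
  have hσ : ∀ n, s (shift P.width n) = st (C.flatMap FermionGate.code) [] [] [] [] [] [] [] [] n := by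
    intro n
    cases n with
    | zero => exact hs
    | succ n =>
      have h1 : s (P.width + 3 + n) = initStore x r (P.width + 3 + n) :=
        h.eq_of_width_le (by omega)
      have h2 : initStore x r (P.width + 3 + n) = [] := by
        obtain ⟨k, hk⟩ : ∃ k, P.width + 3 + n = k + 2 := ⟨P.width + 1 + n, by omega⟩
        rw [hk]; rfl
      rw [shift, h1, h2]
      rcases n with _ | _ | _ | _ | _ | _ | _ | _ | n <;> rfl
  obtain ⟨s', hs', h'⟩ := hC.rename (shift_injective _) hσ
  exact ⟨T + t, s', add_le_add le_rfl ht, .seq h hs', h' 0⟩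

lemma length_le_length_code {p m : ℕ} (C : List (FermionGate p m)) :
    C.length ≤ (C.flatMap FermionGate.code).length := by
  induction C with
  | nil => simp
  | cons g C ih =>
    rw [List.flatMap_cons, List.length_append, List.length_cons]
    have : 0 < g.code.length := by simp [FermionGate.code]
    omega

lemma compileCost_mono (p : ℕ) {n n' : ℕ} (h : n ≤ n') : compileCost p n ≤ compileCost p n' := by
  unfold compileCost
  gcongr

lemma exists_polynomial_compileCost (p T : Polynomial ℕ) : ∃ U : Polynomial ℕ, ∀ n,
    T.eval n + compileCost (p.eval n) (T.eval n) = U.eval n := by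
  set E : Polynomial ℕ := Polynomial.C emitCost with hE
  refine ⟨T + (T * ((4 * ((5 * p + 2 * E + 2 * p * (E + 16 * p + 1)) + 1) + 2 * (2 * E + 1) +
    (8 * p + 2) * (E + 1) + 50) + 1) + 1 + (T * (328 * (8 * p + 2) + 4) * 4 + 1)), fun n => ?_⟩
  simp only [compileCost, gateCost, majoranaCost, hE, Polynomial.eval_add, Polynomial.eval_mul,
    Polynomial.eval_C, Polynomial.eval_one, Polynomial.eval_ofNat]

/-! ### The qubit verifier -/

/-! ### Transport along equalities of register sizes. -/

section Cast

variable {p p' a a' : ℕ}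

/-- The compiled circuit on registers of given sizes. -/
def compileTo (hp : p' = 2 * p) (ha : a' = a + 1) (C : List (FermionGate p a)) :
    List (QubitGate p' a') := by
  subst hp ha
  exact compile C

lemma code_compileTo (hp : p' = 2 * p) (ha : a' = a + 1) (C : List (FermionGate p a)) :
    (compileTo hp ha C).flatMap QubitGate.code = (compile C).flatMap QubitGate.code := by
  subst hp ha; rfl

lemma exists_qubit_proof_compileTo (hp : p' = 2 * p) {ρ : Op (Fin p)} (hρ : IsFermionicState ρ) :
    ∃ ρ' : Op (Fin p'), IsDensity ρ' ∧ ∀ (a a' : ℕ) (ha : a' = a + 1) (C : List (FermionGate p a)),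
      circuitAccept qubitModel (compileTo hp ha C) ρ' = circuitAccept fermionModel C ρ := by
  subst hp
  obtain ⟨ρ', hρ', h⟩ := exists_qubit_proof hρ
  exact ⟨ρ', hρ', fun a a' ha C => by subst ha; exact h a C⟩

lemma exists_fermionic_proof_compileTo (hp : p' = 2 * p) {ρ' : Op (Fin p')} (hρ : IsDensity ρ') :
    ∃ ρ : Op (Fin p), IsFermionicState ρ ∧
      ∀ (a a' : ℕ) (ha : a' = a + 1) (C : List (FermionGate p a)),
      circuitAccept qubitModel (compileTo hp ha C) ρ' = circuitAccept fermionModel C ρ := by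
  subst hp
  obtain ⟨ρ, hρ, h⟩ := exists_fermionic_proof hρ
  exact ⟨ρ, hρ, fun a a' ha C => by subst ha; exact h a C⟩

/-! ### Counting the accessed qubits. -/

lemma mem_access_iff {g : QubitGate p a} {k : Fin p} :
    k ∈ g.access ↔ Sum.inl k ∈ g.word.letters.map Prod.fst := by
  simp only [QubitGate.access, List.mem_toFinset, List.mem_filterMap, List.mem_map,
    Sum.getLeft?_eq_some_iff]

lemma mem_access_controlGates {N : ℕ} {x : (Fin N ⊕ Fin (a + 1)) × Axis}
    {g : QubitGate N (a + 1)} (hg : g ∈ controlGates x) {k : Fin N} (hk : k ∈ g.access) :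
    x.1 = .inl k := by
  have hx : ∀ s : Fin N ⊕ Fin (a + 1), (.inl k : Site N (a + 1)) = place s → s = .inl k := by
    rintro (s | s) h
    · exact (congrArg Sum.inl (Sum.inl.inj h)).symm
    · simp [place] at h
  simp only [controlGates, List.mem_append, List.mem_replicate] at hg
  rw [mem_access_iff] at hk
  rcases hg with ((⟨-, rfl⟩ | ⟨-, rfl⟩) | ⟨-, rfl⟩) | ⟨-, rfl⟩
  · simp [phaseGate] at hk
  · simp [singleGate, work] at hk
  · simp only [singleGate, List.map_cons, List.map_nil, List.mem_singleton] at hk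
    exact hx _ hk
  · simp only [coupledGate, List.map_cons, List.map_nil, List.mem_cons, List.not_mem_nil,
      or_false] at hk
    rcases hk with hk | hk
    · simp [work] at hk
    · exact hx _ hk

lemma mem_access_compileGate {f : FermionGate p a} {g : QubitGate (2 * p) (a + 1)}
    (hg : g ∈ compileGate f) {k : Fin (2 * p)} (hk : k ∈ g.access) :
    ∃ c : Fin p × Bool, c.1 ∈ f.access ∧
      k ∈ (path (majIndex c) (majIndex_lt c)).map Prod.fst := by
  have hl : ∃ x ∈ f.letters, x.1 = .inl k := by
    simp only [compileGate, List.mem_append, List.mem_cons, List.mem_flatMap,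
      List.mem_reverse] at hg
    rcases hg with ⟨x, hx, hg⟩ | rfl | ⟨x, hx, hg⟩
    · exact ⟨x, hx, mem_access_controlGates hg hk⟩
    · rw [mem_access_iff] at hk
      simp [singleGate, work] at hk
    · exact ⟨x, hx, mem_access_controlGates hg hk⟩
  obtain ⟨x, hx, hxk⟩ := hl
  rw [FermionGate.letters, List.mem_append] at hx
  rcases hx with hx | hx
  · obtain ⟨c, hc, hx⟩ := List.mem_flatMap.1 hx
    obtain ⟨y, hy, rfl⟩ := List.mem_map.1 hx
    refine ⟨c, List.mem_toFinset.2 (List.mem_map_of_mem hc), ?_⟩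
    rw [← Sum.inl.inj hxk]
    exact List.mem_map_of_mem hy
  · obtain ⟨y, hy, rfl⟩ := List.mem_map.1 hx
    simp at hxk

/-- All accessed qubits lie on the heap paths of the Majorana operators of accessed modes. The
factor 2 counts these operators per mode, the other factor the nodes on a path. -/
lemma ncard_access_compile_le (C : List (FermionGate p a)) :
    {k | ∃ g ∈ compile C, k ∈ g.access}.ncard ≤
      {k | ∃ g ∈ C, k ∈ g.access}.ncard * (2 * (Nat.log 2 (2 * p) + 1)) := by
  classical
  set S : Finset (Fin p) := Finset.univ.filter fun k => ∃ g ∈ C, k ∈ g.access with hS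
  set S' : Finset (Fin (2 * p)) := (S ×ˢ Finset.univ).biUnion fun c =>
    ((path (majIndex c) (majIndex_lt c)).map Prod.fst).toFinset with hS'
  have h1 : {k | ∃ g ∈ compile C, k ∈ g.access} ⊆ (S' : Set (Fin (2 * p))) := by
    rintro k ⟨g, hg, hk⟩
    obtain ⟨f, hf, hg⟩ := List.mem_flatMap.1 hg
    obtain ⟨c, hc, hk⟩ := mem_access_compileGate hg hk
    rw [Finset.mem_coe, hS', Finset.mem_biUnion]
    exact ⟨c, by simp only [hS, Finset.mem_product, Finset.mem_filter, Finset.mem_univ, true_and,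
      and_true]; exact ⟨f, hf, hc⟩, List.mem_toFinset.2 hk⟩
  have h2 : {k | ∃ g ∈ C, k ∈ g.access} = (S : Set (Fin p)) := by ext; simp [hS]
  rw [h2, Set.ncard_coe_finset]
  refine (Set.ncard_le_ncard h1 (Finset.finite_toSet _)).trans ?_
  rw [Set.ncard_coe_finset]
  refine (Finset.card_biUnion_le_card_mul _ _ (Nat.log 2 (2 * p) + 1) fun c _ => ?_).trans ?_
  · refine (List.toFinset_card_le _).trans ?_
    rw [List.length_map]
    exact length_path_le _ _
  · rw [Finset.card_product, Finset.card_univ, Fintype.card_bool, mul_assoc]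

lemma ncard_access_compileTo_le (hp : p' = 2 * p) (ha : a' = a + 1) (C : List (FermionGate p a)) :
    {k | ∃ g ∈ compileTo hp ha C, k ∈ g.access}.ncard ≤
      {k | ∃ g ∈ C, k ∈ g.access}.ncard * (2 * (Nat.log 2 (2 * p) + 1)) := by
  subst hp ha; exact ncard_access_compile_le C

end Cast

lemma eval_two_mul (p : Polynomial ℕ) (n : ℕ) : (2 * p).eval n = 2 * p.eval n := by
  rw [Polynomial.eval_mul, Polynomial.eval_ofNat]

lemma eval_add_one (p : Polynomial ℕ) (n : ℕ) : (p + 1).eval n = p.eval n + 1 := by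
  rw [Polynomial.eval_add, Polynomial.eval_one]

/-- The qubit verifier that simulates a fermionic verifier. -/
noncomputable def qubitVerifier (V : Verifier fermionModel) : Verifier qubitModel where
  p := 2 * V.p
  a := V.a + 1
  m := V.m
  circuit x r := compileTo (eval_two_mul _ _) (eval_add_one _ _) (V.circuit x r)
  polyTime := by
    obtain ⟨P, T, h⟩ := V.polyTime
    obtain ⟨U, hU⟩ := exists_polynomial_compileCost V.p T
    refine ⟨composed P, U, fun x r => ?_⟩
    obtain ⟨t, s, ht, hs, hc⟩ := h x r
    obtain ⟨t', s', ht', hs', hc'⟩ := exec_composed (C := V.circuit x r) hs hc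
    refine ⟨t', s', ?_, hs', hc'.trans (code_compileTo _ _ _).symm⟩
    -- Every gate has a nonempty description, so the running time bounds the number of gates and the
    -- compilation cost becomes polynomial in $n$.
    have hlen : (V.circuit x r).length ≤ T.eval x.length := by
      have h1 := length_le_length_code (V.circuit x r)
      have h2 := hs.length_le 2
      rw [hc] at h2
      have h3 : (initStore x (List.ofFn r) 2).length = 0 := rfl
      rw [h3] at h2
      exact h1.trans (h2.trans (by omega))
    rw [← hU]
    exact ht'.trans (add_le_add ht (compileCost_mono _ hlen))

lemma qubitVerifier_accessesAtMost {V : Verifier fermionModel} {q : ℕ → ℕ}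
    (h : V.AccessesAtMost q) :
    (qubitVerifier V).AccessesAtMost fun n => q n * (2 * (Nat.log 2 (2 * V.p.eval n) + 1)) :=
  fun x r => (ncard_access_compileTo_le (eval_two_mul _ _) (eval_add_one _ _) (V.circuit x r)).trans
    (Nat.mul_le_mul_right _ (h x r))

theorem pcp_fermion_subset_pcp_qubit {L : PromiseProblem} {q : ℕ → ℕ}
    (h : L ∈ PCP fermionModel q) :
    ∃ p : Polynomial ℕ,
      L ∈ PCP qubitModel fun n => q n * (2 * (Nat.log 2 (2 * p.eval n) + 1)) := by
  obtain ⟨V, hq, hyes, hno⟩ := h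
  refine ⟨V.p, qubitVerifier V, qubitVerifier_accessesAtMost hq, fun x hx => ?_, fun x hx ρ hρ => ?_⟩
  · obtain ⟨ρ, hρ, h⟩ := hyes x hx
    obtain ⟨ρ', hρ', h'⟩ := exists_qubit_proof_compileTo (eval_two_mul V.p x.length) hρ
    refine ⟨ρ', hρ', h.trans (le_of_eq ?_)⟩
    exact congrArg (· / 2 ^ V.m.eval x.length)
      (Finset.sum_congr rfl fun r _ => (h' _ _ (eval_add_one _ _) (V.circuit x r)).symm)
  · obtain ⟨ρ', hρ', h'⟩ := exists_fermionic_proof_compileTo (eval_two_mul V.p x.length) hρ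
    refine le_trans (le_of_eq ?_) (hno x hx ρ' hρ')
    exact congrArg (· / 2 ^ V.m.eval x.length)
      (Finset.sum_congr rfl fun r _ => h' _ _ (eval_add_one _ _) (V.circuit x r))

/-! ### Growth -/

lemma eval_le_eval_one_mul_pow (p : Polynomial ℕ) {n : ℕ} (hn : 1 ≤ n) :
    p.eval n ≤ p.eval 1 * n ^ p.natDegree := by
  rw [Polynomial.eval_eq_sum_range, Polynomial.eval_eq_sum_range, Finset.sum_mul]
  refine Finset.sum_le_sum fun i hi => ?_
  rw [one_pow, mul_one]
  exact Nat.mul_le_mul_left _ (Nat.pow_le_pow_right hn (by simpa [Nat.lt_succ_iff] using hi))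

lemma isBigO_log_eval (p : Polynomial ℕ) :
    (fun n : ℕ => ((2 * (Nat.log 2 (2 * p.eval n) + 1) : ℕ) : ℝ)) =O[Filter.atTop]
      fun n : ℕ => Real.log n := by
  -- The value at 1 is the sum of the coefficients. The extra 1 makes $\log c$ nonnegative even for
  -- the zero polynomial.
  set c : ℝ := 2 * p.eval 1 + 1 with hc
  have hc1 : 1 ≤ c := by rw [hc]; have : (0 : ℝ) ≤ p.eval 1 := Nat.cast_nonneg _; linarith
  have hl2 : 0 < Real.log 2 := Real.log_pos (by norm_num)
  have hlc : 0 ≤ Real.log c := Real.log_nonneg hc1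
  refine Asymptotics.IsBigO.of_bound (2 * ((Real.log c + p.natDegree) / Real.log 2 + 1)) ?_
  -- From $n=3>e$ on, $\log n\ge1$ absorbs the additive constants.
  filter_upwards [Filter.eventually_ge_atTop 3] with n hn
  have hn0 : (0 : ℝ) < n := by positivity
  have hlog : 1 ≤ Real.log n := by
    rw [Real.le_log_iff_exp_le hn0]
    have h3 : (3 : ℝ) ≤ n := by exact_mod_cast hn
    linarith [Real.exp_one_lt_d9]
  have hx : (2 * p.eval n : ℕ) ≤ c * (n : ℝ) ^ p.natDegree := by
    have h1 : ((p.eval n : ℕ) : ℝ) ≤ (p.eval 1 : ℕ) * (n : ℝ) ^ p.natDegree := by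
      exact_mod_cast eval_le_eval_one_mul_pow p (by omega : 1 ≤ n)
    have h2 : (0 : ℝ) ≤ (n : ℝ) ^ p.natDegree := by positivity
    push_cast
    rw [hc]
    nlinarith
  have hle : (Nat.log 2 (2 * p.eval n) : ℝ) * Real.log 2 ≤
      Real.log c + p.natDegree * Real.log n := by
    have hpow : (2 : ℝ) ^ Nat.log 2 (2 * p.eval n) ≤ c * (n : ℝ) ^ p.natDegree := by
      by_cases h0 : 2 * p.eval n = 0
      · rw [h0, Nat.log_zero_right, pow_zero]
        have : 1 ≤ (n : ℝ) ^ p.natDegree := one_le_pow₀ (by exact_mod_cast (by omega : 1 ≤ n))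
        nlinarith
      · refine le_trans ?_ hx
        exact_mod_cast Nat.pow_log_le_self 2 h0
    have := Real.log_le_log (by positivity) hpow
    rwa [Real.log_pow, Real.log_mul (by positivity) (by positivity), Real.log_pow] at this
  have hle' : (Nat.log 2 (2 * p.eval n) : ℝ) ≤
      (Real.log c + p.natDegree) / Real.log 2 * Real.log n := by
    rw [div_mul_eq_mul_div, le_div_iff₀ hl2]
    nlinarith
  rw [Real.norm_of_nonneg (Nat.cast_nonneg _), Real.norm_of_nonneg (by linarith)]
  push_cast
  linarith

end FermPCP

theorem mainTheorem6 :
    FermPCP.FermPCPBigO (fun _ => 1) ⊆ FermPCP.QPCPBigO (fun n => Real.log n) := by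
  rintro L ⟨q, hq, hL⟩
  obtain ⟨p, hp⟩ := FermPCP.pcp_fermion_subset_pcp_qubit hL
  refine ⟨_, ?_, hp⟩
  have h := hq.mul (FermPCP.isBigO_log_eval p)
  simpa only [Nat.cast_mul (α := ℝ) (q _), one_mul] using h
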